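/- Let $\Bbbk$ be an algebraically closed field of characteristic $0$, let $H$ be a Hopf algebra over $\Bbbk$ with bijective antipode $S$, and let $V$ be a finite-dimensional (left-left) Yetter--Drinfeld module over $H$ with coaction $\delta(v)=v_{(-1)}\otimes v_{(0)}$ and braiding $c(v\otimes w)=v_{(-1)}\cdot w\otimes v_{(0)}$. Let $\mathcal{B}(V)=T(V)/\bigoplus_{n}\ker S_n$ be the Nichols algebra of $V$, where $S_n\colon V^{\otimes n}\to V^{\otimes n}$ is the braided symmetrizer, with its $\mathbb{N}_0$-grading, its diagonal $H$-coaction and its comultiplication $\Delta$ (the multiplicative map into the braided tensor product $\mathcal{B}(V)\otimes\mathcal{B}(V)$ with $\Delta(v)=v\otimes 1+1\otimes v$ for $v\in V$). For a subspace $W\subseteq V$ let $\langle W\rangle\subseteq\mathcal{B}(V)$ be the unital subalgebra generated by $W$. A left coideal subalgebra of $\mathcal{B}(V)$ in the category of $\mathbb{N}_0$-graded $H$-comodules is a unital subalgebra $C$ that is a graded subspace and satisfies $\delta(C)\subseteq H\otimes C$ and $\Delta(C)\subseteq\mathcal{B}(V)\otimes C$. Such a $C$ can be extended in degree $n$ if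 there is $x\in\mathcal{B}(V)(n)$ with $x\notin C$ such that the subalgebra $\langle C,x\rangle$ generated by $C$ and $x$ is again a left coideal subalgebra in the category of $\mathbb{N}_0$-graded $H$-comodules. Let $V^*$ be the dual Yetter--Drinfeld module, with $(h\cdot f)(v)=f(S(h)\cdot v)$ and $f_{(-1)}f_{(0)}(v)=S^{-1}(v_{(-1)})f(v_{(0)})$ for $h\in H$, $f\in V^*$, $v\in V$. Theorem. Let $V_1,V_2\subseteq V$ be $H$-subcomodules with $V=V_1\oplus V_2$, and regard $V_2^*$ as the subspace of $V^*$ consisting of the functionals that vanish on $V_1$. Let $N\ge 2$ and assume that $$\dim\bigoplus_{i=0}^N(\langle V_1\rangle\otimes\langle V_2\rangle)(i)\ \ge\ \dim\bigoplus_{i=0}^N\mathcal{B}(V)(i),$$ where $\langle V_1\rangle\otimes\langle V_2\rangle$ carries the total grading. Assume also that $\langle V_2\rangle\subseteq\mathcal{B}(V)$ and $\langle V_2^*\rangle\subseteq\mathcal{B}(V^*)$ are isomorphic as $\mathbb{N}_0$-graded vector spaces. Then $\langle V_1\rangle\subseteq\mathcal{B}(V)$ is a left coideal subalgebra in the category of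 $\mathbb{N}_0$-graded $H$-comodules, and it cannot be extended in any degree $n$ with $2\le n\le N$. -/

import Mathlib

open TensorProduct

universe u v w

section Conj

/-- For an action `ρ` of `H` on `V`, the linear map sending `a ⊗ (b ⊗ c)` to the endomorphism
`g ⊗ x ↦ a g c ⊗ b · x` of `H ⊗ V`. -/
noncomputable def sandwich {k : Type u} {H : Type v} {V : Type w} [Field k] [Ring H]
    [Algebra k H] [AddCommGroup V] [Module k V] (ρ : H →ₗ[k] Module.End k V) :
    H ⊗[k] (H ⊗[k] H) →ₗ[k] Module.End k (H ⊗[k] V) :=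
  TensorProduct.homTensorHomMap (RingHom.id k) H V H V ∘ₗ
    TensorProduct.map (TensorProduct.lift (LinearMap.mk₂ k
      (fun a c : H => LinearMap.mulLeft k a ∘ₗ LinearMap.mulRight k c)
      (by intros; ext; simp [add_mul]) (by intros; ext; simp)
      (by intros; ext; simp [mul_add]) (by intros; ext; simp))) ρ ∘ₗ
    (TensorProduct.assoc k H H H).symm.toLinearMap ∘ₗ
    (TensorProduct.comm k H H).toLinearMap.lTensor H

variable {k : Type u} {H : Type v} {V : Type w} [Field k] [Ring H] [HopfAlgebra k H]
  [AddCommGroup V] [Module k V]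

@[simp] lemma sandwich_tmul (ρ : H →ₗ[k] Module.End k V) (a b c g : H) (x : V) :
    sandwich ρ (a ⊗ₜ (b ⊗ₜ c)) (g ⊗ₜ x) = (a * g * c) ⊗ₜ ρ b x := by
  simp [sandwich, mul_assoc]

end Conj

/-- A left-left Yetter--Drinfeld module structure over the Hopf algebra `H` on the vector space
`V`. -/
structure YetterDrinfeldModule (k : Type u) (H : Type v) (V : Type w) [Field k] [Ring H]
    [HopfAlgebra k H] [AddCommGroup V] [Module k V] where
  /-- the left action of `H` -/
  action : H →ₐ[k] Module.End k V
  /-- the left coaction `δ` of `H` -/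
  coaction : V →ₗ[k] H ⊗[k] V
  /-- coassociativity of the coaction -/
  coassoc : ∀ x : V, TensorProduct.assoc k H H V ((Coalgebra.comul.rTensor V) (coaction x)) =
    (coaction.lTensor H) (coaction x)
  /-- counitality of the coaction -/
  counit_coaction : ∀ x : V, (Coalgebra.counit.rTensor V) (coaction x) = (1 : k) ⊗ₜ[k] x
  /-- `δ(h · x) = h₍₁₎ x₍₋₁₎ S(h₍₃₎) ⊗ h₍₂₎ · x₍₀₎` -/
  compat : ∀ (h : H) (x : V), coaction (action h x) =
    sandwich action.toLinearMap (((HopfAlgebra.antipode k).lTensor H).lTensor H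
      (Coalgebra.comul.lTensor H (Coalgebra.comul h))) (coaction x)

namespace YetterDrinfeldModule

section Diagonal

variable {k : Type u} {H : Type v} [Field k] [Ring H] [HopfAlgebra k H]
variable {X Y Z X' Y' : Type*} [AddCommGroup X] [Module k X] [AddCommGroup Y] [Module k Y]
  [AddCommGroup Z] [Module k Z] [AddCommGroup X'] [Module k X'] [AddCommGroup Y'] [Module k Y']

/-- The diagonal action `h · (x ⊗ y) = h₍₁₎ · x ⊗ h₍₂₎ · y`. -/
noncomputable def diagAction (ρ : H →ₗ[k] Module.End k X) (σ : H →ₗ[k] Module.End k Y) :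
    H →ₗ[k] Module.End k (X ⊗[k] Y) :=
  TensorProduct.homTensorHomMap (RingHom.id k) X Y X Y ∘ₗ TensorProduct.map ρ σ ∘ₗ Coalgebra.comul

/-- The diagonal coaction `x ⊗ y ↦ x₍₋₁₎ y₍₋₁₎ ⊗ (x₍₀₎ ⊗ y₍₀₎)`. -/
noncomputable def diagCoaction (δ : X →ₗ[k] H ⊗[k] X) (ε : Y →ₗ[k] H ⊗[k] Y) :
    X ⊗[k] Y →ₗ[k] H ⊗[k] (X ⊗[k] Y) :=
  (LinearMap.mul' k H).rTensor (X ⊗[k] Y) ∘ₗ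
    (TensorProduct.tensorTensorTensorComm k H X H Y).toLinearMap ∘ₗ TensorProduct.map δ ε

/-- The Yetter--Drinfeld braiding `x ⊗ y ↦ x₍₋₁₎ · y ⊗ x₍₀₎`, for a coaction `δ` of `H` on `X`
and an action `σ` of `H` on `Y`. -/
noncomputable def braiding (δ : X →ₗ[k] H ⊗[k] X) (σ : H →ₗ[k] Module.End k Y) :
    X ⊗[k] Y →ₗ[k] Y ⊗[k] X :=
  (TensorProduct.lift σ).rTensor X ∘ₗ (TensorProduct.rightComm k H X Y).toLinearMap ∘ₗ
    δ.rTensor Y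

lemma braiding_tmul (δ : X →ₗ[k] H ⊗[k] X) (σ : H →ₗ[k] Module.End k Y) (x : X) (y : Y) :
    braiding δ σ (x ⊗ₜ y) = (σ.flip y).rTensor X (δ x) := by
  simp only [braiding, LinearMap.comp_apply, LinearMap.rTensor_tmul]
  induction δ x with
  | zero => simp
  | add a b ha hb => simp only [TensorProduct.add_tmul, map_add, ha, hb]
  | tmul h x => simp

lemma diagAction_tmul (ρ : H →ₗ[k] Module.End k X) (σ : H →ₗ[k] Module.End k Y) (h : H) (x : X)
    (y : Y) : diagAction ρ σ h (x ⊗ₜ y) =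
      TensorProduct.map (ρ.flip x) (σ.flip y) (Coalgebra.comul h) := by
  simp only [diagAction, LinearMap.comp_apply]
  induction (Coalgebra.comul h : H ⊗[k] H) with
  | zero => simp
  | add a b ha hb => simp only [map_add, LinearMap.add_apply, ha, hb]
  | tmul a b => simp

lemma diagAction_assoc (ρ : H →ₗ[k] Module.End k X) (σ : H →ₗ[k] Module.End k Y)
    (τ : H →ₗ[k] Module.End k Z) (h : H) :
    (TensorProduct.assoc k X Y Z).toLinearMap ∘ₗ diagAction (diagAction ρ σ) τ h =
      diagAction ρ (diagAction σ τ) h ∘ₗ (TensorProduct.assoc k X Y Z).toLinearMap := by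
  ext x y z
  have key := congrArg (TensorProduct.map (ρ.flip x) (TensorProduct.map (σ.flip y) (τ.flip z)))
    (Coalgebra.coassoc_apply (R := k) h)
  have e1 : ∀ t : H ⊗[k] H, TensorProduct.map (ρ.flip x)
      (TensorProduct.map (σ.flip y) (τ.flip z)) (TensorProduct.assoc k H H H
        (Coalgebra.comul.rTensor H t)) = TensorProduct.assoc k X Y Z
        (TensorProduct.map ((diagAction ρ σ).flip (x ⊗ₜ y)) (τ.flip z) t) := by
    intro t
    induction t with
    | zero => simp
    | add a b ha hb => simp only [map_add, ha, hb]
    | tmul a b =>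
      simp only [LinearMap.rTensor_tmul, TensorProduct.map_tmul, LinearMap.flip_apply,
        diagAction_tmul]
      induction (Coalgebra.comul a : H ⊗[k] H) with
      | zero => simp
      | add a b ha hb => simp only [map_add, TensorProduct.add_tmul, ha, hb]
      | tmul a b => simp
  have e2 : ∀ t : H ⊗[k] H, TensorProduct.map (ρ.flip x)
      (TensorProduct.map (σ.flip y) (τ.flip z)) (Coalgebra.comul.lTensor H t) =
        (TensorProduct.map (ρ.flip x) ((diagAction σ τ).flip (y ⊗ₜ z)) t) := by
    intro t
    induction t with
    | zero => simp
    | add a b ha hb => simp only [map_add, ha, hb]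
    | tmul a b => simp [diagAction_tmul]
  rw [e1, e2] at key
  simpa [diagAction_tmul] using key

/-- equivariance is preserved by tensoring -/
lemma diagAction_map {ρ : H →ₗ[k] Module.End k X} {ρ' : H →ₗ[k] Module.End k X'}
    {σ : H →ₗ[k] Module.End k Y} {σ' : H →ₗ[k] Module.End k Y'} {f : X →ₗ[k] X'} {g : Y →ₗ[k] Y'}
    (hf : ∀ h, f ∘ₗ ρ h = ρ' h ∘ₗ f) (hg : ∀ h, g ∘ₗ σ h = σ' h ∘ₗ g) (h : H) :
    TensorProduct.map f g ∘ₗ diagAction ρ σ h = diagAction ρ' σ' h ∘ₗ TensorProduct.map f g := by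
  ext x y
  simp only [diagAction_tmul, TensorProduct.AlgebraTensorModule.curry_apply,
    LinearMap.restrictScalars_self, TensorProduct.curry_apply, LinearMap.comp_apply,
    TensorProduct.map_tmul]
  induction (Coalgebra.comul h : H ⊗[k] H) with
  | zero => simp
  | add a b ha hb => simp only [map_add, ha, hb]
  | tmul a b =>
    have h1 := LinearMap.congr_fun (hf a) x
    have h2 := LinearMap.congr_fun (hg b) y
    simp at h1 h2
    simp [h1, h2]

/-- the braiding is natural in the second argument -/
lemma braiding_natural (δ : X →ₗ[k] H ⊗[k] X) {σ : H →ₗ[k] Module.End k Y}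
    {σ' : H →ₗ[k] Module.End k Y'} {g : Y →ₗ[k] Y'} (hg : ∀ h, g ∘ₗ σ h = σ' h ∘ₗ g) :
    g.rTensor X ∘ₗ braiding δ σ = braiding δ σ' ∘ₗ g.lTensor X := by
  ext x y
  simp only [braiding_tmul, TensorProduct.AlgebraTensorModule.curry_apply,
    LinearMap.restrictScalars_self, TensorProduct.curry_apply, LinearMap.comp_apply,
    LinearMap.lTensor_tmul]
  induction δ x with
  | zero => simp
  | add a b ha hb => simp only [map_add, ha, hb]
  | tmul a b =>
    have h2 := LinearMap.congr_fun (hg a) y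
    simp at h2
    simp [h2]

/-- the hexagon identity for the braiding -/
lemma braiding_diagAction (δ : X →ₗ[k] H ⊗[k] X)
    (hδ : ∀ x : X, TensorProduct.assoc k H H X ((Coalgebra.comul.rTensor X) (δ x)) =
      (δ.lTensor H) (δ x)) (σ : H →ₗ[k] Module.End k Y) (τ : H →ₗ[k] Module.End k Z) :
    (TensorProduct.assoc k Y Z X).toLinearMap ∘ₗ braiding δ (diagAction σ τ) =
      (braiding δ τ).lTensor Y ∘ₗ (TensorProduct.assoc k Y X Z).toLinearMap ∘ₗ
        (braiding δ σ).rTensor Z ∘ₗ (TensorProduct.assoc k X Y Z).symm.toLinearMap := by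
  ext x y z
  have key := congrArg (TensorProduct.map (σ.flip y) ((τ.flip z).rTensor X)) (hδ x)
  have e1 : ∀ t : H ⊗[k] X, TensorProduct.map (σ.flip y) ((τ.flip z).rTensor X)
      (TensorProduct.assoc k H H X (Coalgebra.comul.rTensor X t)) = TensorProduct.assoc k Y Z X
        (((diagAction σ τ).flip (y ⊗ₜ z)).rTensor X t) := by
    intro t
    induction t with
    | zero => simp
    | add a b ha hb => simp only [map_add, ha, hb]
    | tmul a b =>
      simp only [LinearMap.rTensor_tmul, LinearMap.flip_apply, diagAction_tmul]
      induction (Coalgebra.comul a : H ⊗[k] H) with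
      | zero => simp
      | add a b ha hb => simp only [map_add, TensorProduct.add_tmul, ha, hb]
      | tmul a b => simp
  have e2 : ∀ t : H ⊗[k] X, TensorProduct.map (σ.flip y) ((τ.flip z).rTensor X)
      (δ.lTensor H t) = (braiding δ τ).lTensor Y (TensorProduct.assoc k Y X Z
        (((σ.flip y).rTensor X t) ⊗ₜ z)) := by
    intro t
    induction t with
    | zero => simp
    | add a b ha hb => simp only [map_add, ha, hb, TensorProduct.add_tmul]
    | tmul a b => simp [braiding_tmul]
  rw [e1, e2] at key
  simpa [braiding_tmul] using key

lemma diagCoaction_assoc (δ : X →ₗ[k] H ⊗[k] X) (ε : Y →ₗ[k] H ⊗[k] Y) (ζ : Z →ₗ[k] H ⊗[k] Z) :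
    (TensorProduct.assoc k X Y Z).toLinearMap.lTensor H ∘ₗ diagCoaction (diagCoaction δ ε) ζ =
      diagCoaction δ (diagCoaction ε ζ) ∘ₗ (TensorProduct.assoc k X Y Z).toLinearMap := by
  ext x y z
  simp only [diagCoaction, TensorProduct.AlgebraTensorModule.curry_apply,
    LinearMap.restrictScalars_self, TensorProduct.curry_apply, LinearMap.comp_apply,
    TensorProduct.map_tmul, LinearEquiv.coe_coe, TensorProduct.assoc_tmul]
  induction δ x with
  | zero => simp
  | add a b ha hb => simp only [map_add, ha, hb, TensorProduct.add_tmul]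
  | tmul a x =>
    induction ε y with
    | zero => simp
    | add a b ha hb => simp only [map_add, ha, hb, TensorProduct.add_tmul, TensorProduct.tmul_add]
    | tmul b y =>
      induction ζ z with
      | zero => simp
      | add a b ha hb => simp only [map_add, ha, hb, TensorProduct.tmul_add]
      | tmul c z => simp [mul_assoc]

/-- colinearity is preserved by tensoring -/
lemma diagCoaction_map {δ : X →ₗ[k] H ⊗[k] X} {δ' : X' →ₗ[k] H ⊗[k] X'}
    {ε : Y →ₗ[k] H ⊗[k] Y} {ε' : Y' →ₗ[k] H ⊗[k] Y'} {f : X →ₗ[k] X'} {g : Y →ₗ[k] Y'}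
    {x : X} {y : Y} (hf : f.lTensor H (δ x) = δ' (f x)) (hg : g.lTensor H (ε y) = ε' (g y)) :
    (TensorProduct.map f g).lTensor H (diagCoaction δ ε (x ⊗ₜ y)) =
      diagCoaction δ' ε' (TensorProduct.map f g (x ⊗ₜ y)) := by
  simp only [diagCoaction, LinearMap.comp_apply,
    TensorProduct.map_tmul, LinearEquiv.coe_coe, ← hf, ← hg]
  induction δ x with
  | zero => simp
  | add a b ha hb => simp only [map_add, ha, hb, TensorProduct.add_tmul]
  | tmul a x =>
    induction ε y with
    | zero => simp
    | add a b ha hb => simp only [map_add, ha, hb, TensorProduct.tmul_add]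
    | tmul b y => simp

end Diagonal

section Compat

open Coalgebra HopfAlgebra WithConv LinearMap

variable {k : Type u} {H : Type v} {V : Type w} [Field k] [Ring H] [HopfAlgebra k H]
  [AddCommGroup V] [Module k V]

/-- The antipode is an anti-morphism of coalgebras. -/
lemma comul_antipode (h : H) : comul (R := k) (antipode k h) =
    TensorProduct.map (antipode k) (antipode k) (TensorProduct.comm k H H (comul h)) := by
  let i1 : H →ₐ[k] H ⊗[k] H := Algebra.TensorProduct.includeLeft
  let i2 : H →ₐ[k] H ⊗[k] H := Algebra.TensorProduct.includeRight
  let S : H →ₗ[k] H := antipode k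
  let G : H →ₗ[k] H ⊗[k] H :=
    TensorProduct.map S S ∘ₗ (TensorProduct.comm k H H).toLinearMap ∘ₗ comul
  have hG : toConv G = toConv (i2.toLinearMap ∘ₗ S) * toConv (i1.toLinearMap ∘ₗ S) := by
    ext h
    simp only [G, LinearMap.comp_apply, convMul_apply, LinearEquiv.coe_coe]
    induction (comul h : H ⊗[k] H) with
    | zero => simp
    | add a b ha hb => simp only [map_add, ha, hb]
    | tmul a b => simp [i1, i2]
  have hD : toConv (comul : H →ₗ[k] H ⊗[k] H) = toConv i1.toLinearMap * toConv i2.toLinearMap := by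
    ext h
    simp only [convMul_apply]
    induction (comul h : H ⊗[k] H) with
    | zero => simp
    | add a b ha hb => rw [map_add, map_add, ← ha, ← hb]
    | tmul a b => simp [i1, i2]
  have h1 : toConv (i1.toLinearMap ∘ₗ S) * toConv i1.toLinearMap = 1 := by
    have := algHom_comp_convMul_distrib i1 (toConv S) (toConv LinearMap.id)
    apply WithConv.ofConv_injective
    rw [antipode_mul_id] at this
    refine Eq.trans this.symm ?_
    ext; simp
  have h2 : toConv (i2.toLinearMap ∘ₗ S) * toConv i2.toLinearMap = 1 := by
    have := algHom_comp_convMul_distrib i2 (toConv S) (toConv LinearMap.id)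
    apply WithConv.ofConv_injective
    rw [antipode_mul_id] at this
    refine Eq.trans this.symm ?_
    ext; simp
  have hGD : toConv G * toConv (comul : H →ₗ[k] H ⊗[k] H) = 1 := by
    rw [hG, hD, mul_assoc, ← mul_assoc (toConv (i1.toLinearMap ∘ₗ S)), h1, one_mul, h2]
  have := left_inv_eq_right_inv hGD (LinearMap.comul_right_inv (R := k) (C := H))
  exact (LinearMap.congr_fun (WithConv.toConv_injective this) h).symm

/-- `g ⊗ x ↦ g h₂ ⊗ x` summed over `δ(h₁ · x)`: the element
`(h₍₁₎ · x)₍₋₁₎ h₍₂₎ ⊗ (h₍₁₎ · x)₍₀₎` for a given linear map `h ↦ δ(h · x)`. -/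
noncomputable def rightTwist (W : H →ₗ[k] H ⊗[k] V) : H →ₗ[k] H ⊗[k] V :=
  (LinearMap.mul' k H).rTensor V ∘ₗ (TensorProduct.rightComm k H V H).toLinearMap ∘ₗ
    W.rTensor H ∘ₗ comul

lemma sandwich_mul_right (ρ : H →ₗ[k] Module.End k V) (t : H ⊗[k] (H ⊗[k] H)) (q : H) (z : H ⊗[k] V) :
    sandwich ρ (t * (1 ⊗ₜ (1 ⊗ₜ q))) z =
      (LinearMap.mulRight k q).rTensor V (sandwich ρ t z) := by
  induction t with
  | zero => simp
  | add a b ha hb => simp only [add_mul, map_add, LinearMap.add_apply, ha, hb]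
  | tmul a t =>
    induction t with
    | zero => simp
    | add b c hb hc =>
      simp only [TensorProduct.tmul_add, add_mul, map_add, LinearMap.add_apply, hb, hc]
    | tmul f b =>
      induction z with
      | zero => simp
      | add c d hc hd => simp only [map_add, hc, hd]
      | tmul g x => simp [mul_assoc]

lemma sandwich_conv (ρ : H →ₐ[k] Module.End k V) (h : H) (z : H ⊗[k] V) :
    sandwich ρ.toLinearMap (TensorProduct.map LinearMap.id ((TensorProduct.mk k H H).flip 1)
      (comul h)) z = diagAction (LinearMap.mul k H) ρ.toLinearMap h z := by
  simp only [diagAction, LinearMap.comp_apply]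
  induction (comul h : H ⊗[k] H) with
  | zero => simp
  | add a b ha hb => simp only [map_add, LinearMap.add_apply, ha, hb]
  | tmul a b =>
    induction z with
    | zero => simp
    | add c d hc hd => simp only [map_add, hc, hd]
    | tmul g x => simp

/-- The compatibility condition in the form
`h₍₁₎ x₍₋₁₎ ⊗ h₍₂₎ · x₍₀₎ = (h₍₁₎ · x)₍₋₁₎ h₍₂₎ ⊗ (h₍₁₎ · x)₍₀₎`. -/
lemma compat_iff (ρ : H →ₐ[k] Module.End k V) (δ : V →ₗ[k] H ⊗[k] V) (x : V) :
    (∀ h : H, δ (ρ h x) =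
      sandwich ρ.toLinearMap (((antipode k).lTensor H).lTensor H
        (comul.lTensor H (comul h))) (δ x)) ↔
    (∀ h : H, diagAction (LinearMap.mul k H) ρ.toLinearMap h (δ x) =
      rightTwist (δ ∘ₗ ρ.toLinearMap.flip x) h) := by
  let i1 : H →ₗ[k] H ⊗[k] (H ⊗[k] H) := (Algebra.TensorProduct.includeLeft : H →ₐ[k] H ⊗[k] (H ⊗[k] H)).toLinearMap
  let j2 : H →ₗ[k] H ⊗[k] (H ⊗[k] H) := (TensorProduct.mk k H (H ⊗[k] H) 1) ∘ₗ (TensorProduct.mk k H H).flip 1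
  let i3 : H →ₐ[k] H ⊗[k] (H ⊗[k] H) := (Algebra.TensorProduct.includeRight : _ →ₐ[k] H ⊗[k] (H ⊗[k] H)).comp
    (Algebra.TensorProduct.includeRight : H →ₐ[k] H ⊗[k] H)
  let S : H →ₗ[k] H := antipode k
  have hU : ∀ h, ((antipode k).lTensor H).lTensor H
      (comul.lTensor H (comul h)) =
      (toConv i1 * (toConv j2 * toConv (i3.toLinearMap ∘ₗ S))) h := by
    intro h
    simp only [convMul_apply]
    induction (comul h : H ⊗[k] H) with
    | zero => simp
    | add a b ha hb => simp only [map_add, ha, hb]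
    | tmul a b =>
      simp only [LinearMap.lTensor_tmul, TensorProduct.map_tmul, mul'_apply,
        show ((toConv j2 * toConv (i3.toLinearMap ∘ₗ S)).ofConv b) =
          mul' k (H ⊗[k] (H ⊗[k] H)) (TensorProduct.map j2 (i3.toLinearMap ∘ₗ S) (comul b)) from rfl]
      induction (comul b : H ⊗[k] H) with
      | zero => simp
      | add a b ha hb => simp only [map_add, TensorProduct.tmul_add, mul_add, ha, hb]
      | tmul b c => simp [i1, j2, i3, S]
  have h12 : ∀ h, (toConv i1 * toConv j2) h = TensorProduct.map LinearMap.id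
      ((TensorProduct.mk k H H).flip 1) (comul h) := by
    intro h
    simp only [convMul_apply]
    induction (comul h : H ⊗[k] H) with
    | zero => simp
    | add a b ha hb => simp only [map_add, ha, hb]
    | tmul a b => simp [i1, j2]
  have hS : toConv (i3.toLinearMap ∘ₗ S) * toConv i3.toLinearMap = 1 := by
    have := algHom_comp_convMul_distrib i3 (toConv S) (toConv LinearMap.id)
    apply WithConv.ofConv_injective
    rw [antipode_mul_id] at this
    refine Eq.trans this.symm ?_
    ext; simp
  have hassoc : ∀ F G K : WithConv (H →ₗ[k] H ⊗[k] (H ⊗[k] H)), F * G * K = F * (G * K) :=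
    fun F G K => mul_assoc F G K
  have hone : ∀ F : WithConv (H →ₗ[k] H ⊗[k] (H ⊗[k] H)), F * 1 = F := fun F => mul_one F
  -- right twisting a sandwich is convolution with `i3`
  have hT : ∀ (F : WithConv (H →ₗ[k] H ⊗[k] (H ⊗[k] H))) (h : H),
      rightTwist ((sandwich ρ.toLinearMap).flip (δ x) ∘ₗ F.ofConv) h =
      sandwich ρ.toLinearMap ((F * toConv i3.toLinearMap) h) (δ x) := by
    intro F h
    simp only [convMul_apply, rightTwist, LinearMap.comp_apply]
    induction (comul h : H ⊗[k] H) with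
    | zero => simp
    | add a b ha hb => simp only [map_add, LinearMap.add_apply, ha, hb]
    | tmul p q =>
      simp only [TensorProduct.map_tmul, mul'_apply, LinearMap.rTensor_tmul, LinearMap.comp_apply,
        LinearMap.flip_apply]
      have : (ofConv (toConv i3.toLinearMap)) q = 1 ⊗ₜ (1 ⊗ₜ q) := by simp [i3]
      rw [this, sandwich_mul_right]
      induction (sandwich ρ.toLinearMap (F.ofConv p) (δ x)) with
      | zero => simp
      | add a b ha hb => simp only [map_add, TensorProduct.add_tmul, ha, hb]
      | tmul a b => simp
  constructor
  · intro hc h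
    have e : δ ∘ₗ ρ.toLinearMap.flip x = (sandwich ρ.toLinearMap).flip (δ x) ∘ₗ
        (toConv i1 * (toConv j2 * toConv (i3.toLinearMap ∘ₗ S))).ofConv := by
      ext p
      have := hc p
      rw [hU] at this
      exact this
    rw [e, hT, hassoc, hassoc, hS, hone, h12, sandwich_conv]
  · intro hc h
    -- twist twice
    let T : H ⊗[k] (H ⊗[k] H) →ₗ[k] H ⊗[k] V :=
      (LinearMap.mul' k H).rTensor V ∘ₗ (TensorProduct.rightComm k H V H).toLinearMap ∘ₗ
        TensorProduct.map (δ ∘ₗ ρ.toLinearMap.flip x) (mul' k H ∘ₗ S.lTensor H)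
    have t1 : T (comul.lTensor H (comul h)) = δ (ρ h x) := by
      have a1 : ∀ t : H ⊗[k] H, T (comul.lTensor H t) =
          (LinearMap.mul' k H).rTensor V (TensorProduct.rightComm k H V H
            (TensorProduct.map (δ ∘ₗ ρ.toLinearMap.flip x)
              (Algebra.linearMap k H) (counit.lTensor H t))) := by
        intro t
        induction t with
        | zero => simp
        | add a b ha hb => simp only [map_add, ha, hb]
        | tmul a b => simp [T, S, mul_antipode_lTensor_comul_apply]
      rw [a1, Coalgebra.lTensor_counit_comul]
      simp only [TensorProduct.map_tmul, LinearMap.comp_apply, LinearMap.flip_apply,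
        AlgHom.toLinearMap_apply, Algebra.linearMap_apply, map_one]
      induction δ (ρ h x) with
      | zero => simp
      | add a b ha hb => simp only [map_add, TensorProduct.add_tmul, ha, hb]
      | tmul a b => simp
    have t2 : T (comul.lTensor H (comul h)) =
        sandwich ρ.toLinearMap ((toConv i1 * (toConv j2 * toConv (i3.toLinearMap ∘ₗ S))) h) (δ x) := by
      rw [← Coalgebra.coassoc_apply, ← hassoc]
      simp only [convMul_apply (toConv i1 * toConv j2)]
      have a2 : ∀ t : H ⊗[k] H, T (TensorProduct.assoc k H H H (comul.rTensor H t)) =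
          sandwich ρ.toLinearMap (mul' k (H ⊗[k] (H ⊗[k] H)) (TensorProduct.map (toConv i1 * toConv j2).ofConv
            (ofConv (toConv (i3.toLinearMap ∘ₗ S))) t)) (δ x) := by
        intro t
        induction t with
        | zero => simp
        | add a b ha hb => simp only [map_add, LinearMap.add_apply, ha, hb]
        | tmul p q =>
          have e3 : (ofConv (toConv (i3.toLinearMap ∘ₗ S))) q = 1 ⊗ₜ (1 ⊗ₜ S q) := by simp [i3]
          rw [TensorProduct.map_tmul, mul'_apply, e3, sandwich_mul_right,
            show (toConv i1 * toConv j2).ofConv p = _ from h12 p, sandwich_conv, hc]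
          simp only [rightTwist, LinearMap.rTensor_tmul, LinearMap.comp_apply]
          induction (comul p : H ⊗[k] H) with
          | zero => simp
          | add a b ha hb => simp only [map_add, TensorProduct.add_tmul, ha, hb]
          | tmul a b =>
            simp only [T, LinearMap.comp_apply, TensorProduct.assoc_tmul, TensorProduct.map_tmul,
              LinearEquiv.coe_coe, LinearMap.rTensor_tmul, LinearMap.flip_apply,
              LinearMap.lTensor_tmul, mul'_apply]
            induction δ (ρ.toLinearMap a x) with
            | zero => simp
            | add a b ha hb => simp only [map_add, TensorProduct.add_tmul, ha, hb]
            | tmul a b => simp [mul_assoc]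
      exact a2 _
    rw [hU, ← t2, t1]

end Compat

section Braid

open Coalgebra HopfAlgebra

variable {k : Type u} {H : Type v} {V : Type w} [Field k] [Ring H] [HopfAlgebra k H]
  [AddCommGroup V] [Module k V] (Y : YetterDrinfeldModule k H V)

/-- The braiding `c(x ⊗ y) = x₍₋₁₎ · y ⊗ x₍₀₎` of a Yetter--Drinfeld module. -/
noncomputable def braid : V ⊗[k] V →ₗ[k] V ⊗[k] V :=
  braiding Y.coaction Y.action.toLinearMap

lemma diagAction_coaction (h : H) (x : V) :
    diagAction (LinearMap.mul k H) Y.action.toLinearMap h (Y.coaction x) =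
      rightTwist (Y.coaction ∘ₗ Y.action.toLinearMap.flip x) h :=
  (compat_iff Y.action Y.coaction x).1 (fun h => Y.compat h x) h

lemma braid_equivariant (h : H) :
    Y.braid ∘ₗ diagAction Y.action.toLinearMap Y.action.toLinearMap h =
      diagAction Y.action.toLinearMap Y.action.toLinearMap h ∘ₗ Y.braid := by
  ext v w
  have e1 : ∀ t : H ⊗[k] H, Y.braid (TensorProduct.map (Y.action.toLinearMap.flip v)
      (Y.action.toLinearMap.flip w) t) = (Y.action.toLinearMap.flip w).rTensor V
      ((LinearMap.mul' k H).rTensor V (TensorProduct.rightComm k H V H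
        ((Y.coaction ∘ₗ Y.action.toLinearMap.flip v).rTensor H t))) := by
    intro t
    induction t with
    | zero => simp
    | add a b ha hb => simp only [map_add, ha, hb]
    | tmul a b =>
      simp only [braid, TensorProduct.map_tmul, braiding_tmul, LinearMap.rTensor_tmul,
        LinearMap.comp_apply, LinearMap.flip_apply]
      induction Y.coaction (Y.action.toLinearMap a v) with
      | zero => simp
      | add a b ha hb => simp only [map_add, TensorProduct.add_tmul, ha, hb]
      | tmul g x => simp
  have e2 := LinearMap.congr_fun (diagAction_map (ρ := LinearMap.mul k H)
    (ρ' := Y.action.toLinearMap) (σ := Y.action.toLinearMap) (σ' := Y.action.toLinearMap)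
    (f := Y.action.toLinearMap.flip w) (g := LinearMap.id) (by intro h; ext g; simp)
    (by intro h; ext; simp) h) (Y.coaction v)
  simp only [LinearMap.comp_apply] at e2
  simp only [TensorProduct.AlgebraTensorModule.curry_apply,
    LinearMap.restrictScalars_self, TensorProduct.curry_apply, LinearMap.comp_apply]
  rw [diagAction_tmul, e1, braid, braiding_tmul]
  exact Eq.trans (congrArg _ (diagAction_coaction Y h v).symm) e2

lemma braid_colinear : Y.braid.lTensor H ∘ₗ diagCoaction Y.coaction Y.coaction =
    diagCoaction Y.coaction Y.coaction ∘ₗ Y.braid := by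
  ext v w
  simp only [TensorProduct.AlgebraTensorModule.curry_apply,
    LinearMap.restrictScalars_self, TensorProduct.curry_apply, LinearMap.comp_apply]
  -- both sides are `g ⊗ x ↦ diagAction g (δ w) ⊗ x` applied to `δ v`
  let R : H ⊗[k] V →ₗ[k] H ⊗[k] (V ⊗[k] V) := (TensorProduct.assoc k H V V).toLinearMap ∘ₗ
    ((diagAction (LinearMap.mul k H) Y.action.toLinearMap).flip (Y.coaction w)).rTensor V
  have l : Y.braid.lTensor H (diagCoaction Y.coaction Y.coaction (v ⊗ₜ w)) =
      R (Y.coaction v) := by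
    let G : H ⊗[k] (H ⊗[k] V) →ₗ[k] H ⊗[k] (V ⊗[k] V) :=
      (TensorProduct.assoc k H V V).toLinearMap ∘ₗ
      ((TensorProduct.homTensorHomMap (RingHom.id k) H V H V ∘ₗ
        TensorProduct.map (LinearMap.mul k H) Y.action.toLinearMap).flip (Y.coaction w)).rTensor V ∘ₗ
      (TensorProduct.assoc k H H V).symm.toLinearMap
    have g1 : ∀ t : H ⊗[k] V, G (Y.coaction.lTensor H t) = Y.braid.lTensor H
        ((LinearMap.mul' k H).rTensor (V ⊗[k] V) (TensorProduct.tensorTensorTensorComm k H V H V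
          (t ⊗ₜ Y.coaction w))) := by
      intro t
      induction t with
      | zero => simp
      | add a b ha hb => simp only [map_add, TensorProduct.add_tmul, ha, hb]
      | tmul g x =>
        simp only [G, LinearMap.comp_apply, LinearMap.lTensor_tmul]
        induction Y.coaction w with
        | zero =>
          simp only [map_zero, TensorProduct.tmul_zero]
          induction Y.coaction x with
          | zero => simp
          | add a b ha hb => simp only [map_add, TensorProduct.tmul_add, ha, hb, add_zero]
          | tmul => simp
        | add a b ha hb =>
          simp only [map_add, TensorProduct.tmul_add, ← ha, ← hb]
          induction Y.coaction x with
          | zero => simp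
          | add a b ha hb => simp only [map_add, TensorProduct.tmul_add, ha, hb]; abel
          | tmul => simp
        | tmul b y =>
          simp only [TensorProduct.tensorTensorTensorComm_tmul, LinearMap.rTensor_tmul,
            LinearMap.lTensor_tmul, braid, braiding_tmul]
          induction Y.coaction x with
          | zero => simp
          | add a b ha hb => simp only [map_add, TensorProduct.tmul_add, ha, hb]
          | tmul => simp
    have g2 : ∀ t : H ⊗[k] V, G (TensorProduct.assoc k H H V (comul.rTensor V t)) = R t := by
      intro t
      induction t with
      | zero => simp
      | add a b ha hb => simp only [map_add, ha, hb]
      | tmul g x =>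
        simp only [G, R, LinearMap.comp_apply, LinearMap.rTensor_tmul, diagAction,
          LinearMap.flip_apply]
        induction (comul g : H ⊗[k] H) with
        | zero => simp
        | add a b ha hb =>
          simp only [map_add, TensorProduct.add_tmul, ha, hb, LinearMap.add_apply]
        | tmul a b => simp
    rw [← g2, Y.coassoc, g1]
    simp [diagCoaction]
  have r : diagCoaction Y.coaction Y.coaction (Y.braid (v ⊗ₜ w)) = R (Y.coaction v) := by
    let Q : H ⊗[k] (H ⊗[k] V) →ₗ[k] H ⊗[k] (V ⊗[k] V) :=
      (TensorProduct.assoc k H V V).toLinearMap ∘ₗ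
      ((LinearMap.mul' k H).rTensor V ∘ₗ (TensorProduct.rightComm k H V H).toLinearMap ∘ₗ
        (Y.coaction ∘ₗ Y.action.toLinearMap.flip w).rTensor H).rTensor V ∘ₗ
      (TensorProduct.assoc k H H V).symm.toLinearMap
    have g1 : ∀ t : H ⊗[k] V, Q (Y.coaction.lTensor H t) = diagCoaction Y.coaction Y.coaction
        ((Y.action.toLinearMap.flip w).rTensor V t) := by
      intro t
      induction t with
      | zero => simp
      | add a b ha hb => simp only [map_add, ha, hb]
      | tmul g x =>
        simp only [Q, LinearMap.comp_apply, LinearMap.lTensor_tmul, diagCoaction,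
          LinearMap.rTensor_tmul, TensorProduct.map_tmul, LinearMap.flip_apply]
        induction Y.coaction x with
        | zero => simp
        | add a b ha hb => simp only [map_add, TensorProduct.tmul_add, ha, hb]
        | tmul b y =>
          simp only [TensorProduct.assoc_symm_tmul, LinearMap.rTensor_tmul, LinearMap.comp_apply,
            LinearMap.flip_apply, LinearEquiv.coe_coe]
          induction Y.coaction (Y.action.toLinearMap g w) with
          | zero => simp
          | add a b ha hb => simp only [map_add, TensorProduct.add_tmul, ha, hb]
          | tmul => simp
    have g2 : ∀ t : H ⊗[k] V, Q (TensorProduct.assoc k H H V (comul.rTensor V t)) = R t := by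
      intro t
      induction t with
      | zero => simp
      | add a b ha hb => simp only [map_add, ha, hb]
      | tmul g x =>
        simp only [Q, R, LinearMap.comp_apply, LinearMap.rTensor_tmul, LinearMap.flip_apply,
          diagAction_coaction, rightTwist]
        induction (comul g : H ⊗[k] H) with
        | zero => simp
        | add a b ha hb => simp only [map_add, TensorProduct.add_tmul, ha, hb]
        | tmul a b => simp
    rw [← g2, Y.coassoc, g1, braid, braiding_tmul]
  rw [l, r]

end Braid

section Tensor

open Coalgebra HopfAlgebra

variable {k : Type u} {H : Type v} {V : Type w} [Field k] [Ring H] [HopfAlgebra k H]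
  [AddCommGroup V] [Module k V]

/-- Prepending a letter: `v ⊗ t ↦ v t`. -/
noncomputable def cons (k : Type u) (V : Type w) [Field k] [AddCommGroup V] [Module k V] :
    V ⊗[k] TensorAlgebra k V →ₗ[k] TensorAlgebra k V :=
  LinearMap.mul' k (TensorAlgebra k V) ∘ₗ (TensorAlgebra.ι k).rTensor (TensorAlgebra k V)

@[simp] lemma cons_tmul (v : V) (t : TensorAlgebra k V) :
    cons k V (v ⊗ₜ t) = TensorAlgebra.ι k v * t := by simp [cons]

/-- The linear map on the tensor algebra given by
`v₁ v₂ ⋯ vₙ ↦ F (v₁ ⊗ F (v₂ ⊗ ⋯ F (vₙ ⊗ p)))`. -/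
noncomputable def foldWords {P : Type*} [AddCommGroup P] [Module k P] (F : V ⊗[k] P →ₗ[k] P)
    (p : P) : TensorAlgebra k V →ₗ[k] P :=
  (TensorAlgebra.lift k (TensorProduct.curry F : V →ₗ[k] Module.End k P)).toLinearMap.flip p

section Fold
variable {P : Type*} [AddCommGroup P] [Module k P] (F : V ⊗[k] P →ₗ[k] P) (p : P)

@[simp] lemma foldWords_one : foldWords F p 1 = p := by simp [foldWords]

@[simp] lemma foldWords_mul (v : V) (t : TensorAlgebra k V) :
    foldWords F p (TensorAlgebra.ι k v * t) = F (v ⊗ₜ foldWords F p t) := by simp [foldWords]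

lemma foldWords_comp_cons : foldWords F p ∘ₗ cons k V = F ∘ₗ (foldWords F p).lTensor V := by
  ext v t; simp

end Fold

lemma words_induction {P : TensorAlgebra k V → Prop} (one : P 1)
    (add : ∀ s t, P s → P t → P (s + t)) (smul : ∀ (r : k) t, P t → P (r • t))
    (mul : ∀ v t, P t → P (TensorAlgebra.ι k v * t)) (t : TensorAlgebra k V) : P t := by
  have key : ∀ s, P s → P (t * s) := by
    induction t using TensorAlgebra.induction with
    | algebraMap r => intro s hs; rw [← Algebra.smul_def]; exact smul r s hs
    | ι v => intro s hs; exact mul v s hs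
    | add a b ha hb => intro s hs; rw [add_mul]; exact add _ _ (ha s hs) (hb s hs)
    | mul a b ha hb => intro s hs; rw [mul_assoc]; exact ha _ (hb s hs)
  simpa using key 1 one

lemma words_ext {P : Type*} [AddCommGroup P] [Module k P] {f g : TensorAlgebra k V →ₗ[k] P}
    (one : f 1 = g 1) (mul : ∀ v t, f t = g t → f (TensorAlgebra.ι k v * t) =
      g (TensorAlgebra.ι k v * t)) : f = g := by
  ext t
  refine words_induction (P := fun t => f t = g t) one ?_ ?_ mul t
  · intro s t hs ht; simp [hs, ht]
  · intro r t ht; simp [ht]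

/-- The map `D` on the tensor algebra with `D 1 = 0` and `D (v t) = v ⊗ t + N (v ⊗ D t)`. -/
noncomputable def peel (N : V ⊗[k] (V ⊗[k] TensorAlgebra k V) →ₗ[k] V ⊗[k] TensorAlgebra k V) :
    TensorAlgebra k V →ₗ[k] V ⊗[k] TensorAlgebra k V :=
  LinearMap.snd k (TensorAlgebra k V) (V ⊗[k] TensorAlgebra k V) ∘ₗ foldWords
    (LinearMap.prod (cons k V ∘ₗ (LinearMap.fst k _ _).lTensor V)
      ((LinearMap.fst k _ _).lTensor V + N ∘ₗ (LinearMap.snd k _ _).lTensor V))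
    ((1, 0) : TensorAlgebra k V × (V ⊗[k] TensorAlgebra k V))

section Peel
variable (N : V ⊗[k] (V ⊗[k] TensorAlgebra k V) →ₗ[k] V ⊗[k] TensorAlgebra k V)

@[simp] lemma peel_one : peel N 1 = 0 := by simp [peel]

@[simp] lemma peel_mul (v : V) (t : TensorAlgebra k V) :
    peel N (TensorAlgebra.ι k v * t) = v ⊗ₜ t + N (v ⊗ₜ peel N t) := by
  have h : LinearMap.fst k (TensorAlgebra k V) (V ⊗[k] TensorAlgebra k V) ∘ₗ foldWords
    (LinearMap.prod (cons k V ∘ₗ (LinearMap.fst k _ _).lTensor V)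
      ((LinearMap.fst k _ _).lTensor V + N ∘ₗ (LinearMap.snd k _ _).lTensor V))
    ((1, 0) : TensorAlgebra k V × (V ⊗[k] TensorAlgebra k V)) = LinearMap.id := by
    apply words_ext
    · simp
    · intro v t ht
      simp only [LinearMap.comp_apply] at ht
      simp [ht]
  have ht := LinearMap.congr_fun h t
  simp only [LinearMap.comp_apply, LinearMap.id_apply, LinearMap.fst_apply] at ht
  simp [peel, ht]

end Peel

/-- Splitting off the first letter: `v t ↦ v ⊗ t`, and `1 ↦ 0`. -/
noncomputable def uncons (k : Type u) (V : Type w) [Field k] [AddCommGroup V] [Module k V] :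
    TensorAlgebra k V →ₗ[k] V ⊗[k] TensorAlgebra k V := peel 0

@[simp] lemma uncons_one : uncons k V 1 = 0 := by simp [uncons]

@[simp] lemma uncons_mul (v : V) (t : TensorAlgebra k V) :
    uncons k V (TensorAlgebra.ι k v * t) = v ⊗ₜ t := by simp [uncons]

@[simp] lemma uncons_cons (y : V ⊗[k] TensorAlgebra k V) : uncons k V (cons k V y) = y := by
  have : uncons k V ∘ₗ cons k V = LinearMap.id := by ext v t; simp
  exact LinearMap.congr_fun this y

lemma cons_injective : Function.Injective (cons k V) :=
  Function.LeftInverse.injective (g := uncons k V) uncons_cons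

/-- For a braiding `c`, the map `v ⊗ x ⊗ t ↦ (id ⊗ cons)(c(v ⊗ x) ⊗ t)`. -/
noncomputable def slide (c : V ⊗[k] V →ₗ[k] V ⊗[k] V) :
    V ⊗[k] (V ⊗[k] TensorAlgebra k V) →ₗ[k] V ⊗[k] TensorAlgebra k V :=
  (cons k V).lTensor V ∘ₗ (TensorProduct.assoc k V V (TensorAlgebra k V)).toLinearMap ∘ₗ
    c.rTensor (TensorAlgebra k V) ∘ₗ (TensorProduct.assoc k V V (TensorAlgebra k V)).symm.toLinearMap

/-- The map `cᵢ` (indexed from `i = 0`) on the tensor algebra: on `V^{⊗ n}` with `n ≥ i + 2` it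
applies `c` to the tensor factors at the positions `i` and `i + 1`, counted from `0`
(on `V^{⊗ n}` with `n < i + 2`, where `cᵢ` has no meaning, it is zero). -/
noncomputable def braidAt (c : V ⊗[k] V →ₗ[k] V ⊗[k] V) : ℕ → Module.End k (TensorAlgebra k V)
  | 0 => cons k V ∘ₗ slide c ∘ₗ (uncons k V).lTensor V ∘ₗ uncons k V
  | i + 1 => cons k V ∘ₗ (braidAt c i).lTensor V ∘ₗ uncons k V

/-- A reduced word of a permutation `s` of `{0, …, n - 1}`: a list `[i₁, …, iₘ]` of minimal length
such that `s` is the product `sᵢ₁ ∘ ⋯ ∘ sᵢₘ` of the adjacent transpositions `sᵢ = (i  i + 1)`.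
If `s` is a permutation of `{0, …, n}` and `p = s⁻¹ 0`, then `s = s' ∘ (s₀ ∘ s₁ ∘ ⋯ ∘ s_{p-1})`,
where `s'` fixes `0`, and the word consists of a reduced word of `s'` and `[0, 1, …, p - 1]`. -/
def reducedWord : (n : ℕ) → Equiv.Perm (Fin n) → List ℕ
  | 0, _ => []
  | n + 1, s =>
    (reducedWord n (Equiv.Perm.decomposeFin (s * (Fin.cycleRange (s.symm 0))⁻¹)).2).map Nat.succ ++
      List.range (s.symm 0)

/-- The action on `V^{⊗ n}` of the Matsumoto lift of a permutation to the braid group: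
`cᵢ₁ ∘ ⋯ ∘ cᵢₘ` for a reduced word `[i₁, …, iₘ]` of the permutation. -/
noncomputable def matsumotoLift (c : V ⊗[k] V →ₗ[k] V ⊗[k] V) (n : ℕ) (s : Equiv.Perm (Fin n)) :
    Module.End k (TensorAlgebra k V) :=
  ((reducedWord n s).map (braidAt c)).prod

/-- The braided symmetrizer `Sₙ`; only its values on `V^{⊗ n}` are meaningful. -/
noncomputable def symmetrizer (c : V ⊗[k] V →ₗ[k] V ⊗[k] V) (n : ℕ) :
    Module.End k (TensorAlgebra k V) :=
  ∑ s : Equiv.Perm (Fin n), matsumotoLift c n s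

/-- The degree `n` part `T(V)(n) = V^{⊗ n}` of the tensor algebra. -/
noncomputable abbrev tensorDegree (k : Type u) (V : Type w) [Field k] [AddCommGroup V]
    [Module k V] (n : ℕ) : Submodule k (TensorAlgebra k V) :=
  LinearMap.range (TensorAlgebra.ι k : V →ₗ[k] TensorAlgebra k V) ^ n

/-- The projection of the tensor algebra onto its degree `n` part. -/
noncomputable def degreeProj (k : Type u) (V : Type w) [Field k] [AddCommGroup V] [Module k V]
    (n : ℕ) : Module.End k (TensorAlgebra k V) :=
  GradedAlgebra.proj (tensorDegree k V) n

lemma degreeProj_one (n : ℕ) : degreeProj k V n 1 = if n = 0 then 1 else 0 := by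
  rw [degreeProj, GradedAlgebra.proj_apply]
  have h1 : (1 : TensorAlgebra k V) ∈ tensorDegree k V 0 := SetLike.GradedOne.one_mem
  split_ifs with h
  · subst h; exact DirectSum.decompose_of_mem_same _ h1
  · exact DirectSum.decompose_of_mem_ne _ h1 (Ne.symm h)

lemma degreeProj_zero_mul (v : V) (t : TensorAlgebra k V) :
    degreeProj k V 0 (TensorAlgebra.ι k v * t) = 0 := by
  rw [degreeProj, GradedAlgebra.proj_apply]
  exact DirectSum.coe_decompose_mul_of_left_mem_of_not_le (tensorDegree k V) (i := 1)
    (by simp) (by simp)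

lemma degreeProj_succ_mul (n : ℕ) (v : V) (t : TensorAlgebra k V) :
    degreeProj k V (n + 1) (TensorAlgebra.ι k v * t) =
      TensorAlgebra.ι k v * degreeProj k V n t := by
  rw [degreeProj, degreeProj, GradedAlgebra.proj_apply, GradedAlgebra.proj_apply, add_comm]
  exact DirectSum.coe_decompose_mul_add_of_left_mem (tensorDegree k V) (i := 1) (by simp)

lemma degreeProj_idem (n : ℕ) (t : TensorAlgebra k V) :
    degreeProj k V n (degreeProj k V n t) = degreeProj k V n t := by
  simp [degreeProj, GradedAlgebra.proj_apply]

end Tensor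

section Symmetrizer

open Coalgebra HopfAlgebra

variable {k : Type u} {V : Type w} [Field k] [AddCommGroup V] [Module k V]
  (c : V ⊗[k] V →ₗ[k] V ⊗[k] V)

/-- The map `1 + c₁ + c₁ c₂ + ⋯ + c₁ ⋯ cₙ₋₁` on `V^{⊗ n} = V ⊗ V^{⊗ (n - 1)}`. -/
noncomputable def firstComponent : TensorAlgebra k V →ₗ[k] V ⊗[k] TensorAlgebra k V :=
  peel (slide c)

lemma braidAt_succ_prod (l : List ℕ) (y : V ⊗[k] TensorAlgebra k V) :
    ((l.map Nat.succ).map (braidAt c)).prod (cons k V y) =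
      cons k V (((l.map (braidAt c)).prod).lTensor V y) := by
  induction l with
  | nil => simp [Module.End.one_eq_id]
  | cons i l ih =>
    simp only [List.map_cons, List.prod_cons, Module.End.mul_apply, ih]
    simp [braidAt, Module.End.mul_eq_comp, LinearMap.lTensor_comp]

lemma sum_range_braidAt (n : ℕ) (t : TensorAlgebra k V) :
    ∑ j ∈ Finset.range n, ((List.range j).map (braidAt c)).prod (degreeProj k V n t) =
      cons k V (firstComponent c (degreeProj k V n t)) := by
  induction n generalizing t with
  | zero =>
    suffices h : cons k V ∘ₗ firstComponent c ∘ₗ degreeProj k V 0 = 0 by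
      simpa using (LinearMap.congr_fun h t).symm
    apply words_ext
    · simp [degreeProj_one, firstComponent]
    · intro v t _; simp [degreeProj_zero_mul]
  | succ n ih =>
    suffices h : (∑ j ∈ Finset.range (n + 1), ((List.range j).map (braidAt c)).prod) ∘ₗ
        degreeProj k V (n + 1) = cons k V ∘ₗ firstComponent c ∘ₗ degreeProj k V (n + 1) by
      simpa using LinearMap.congr_fun h t
    apply words_ext
    · simp [degreeProj_one]
    · intro v t _
      simp only [LinearMap.comp_apply, degreeProj_succ_mul, LinearMap.sum_apply]
      rw [Finset.sum_range_succ', firstComponent, peel_mul, map_add, add_comm, cons_tmul]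
      refine congrArg₂ _ ?_ ?_
      · simp
      · have e : ∀ j, ((List.range (j + 1)).map (braidAt c)).prod
            (TensorAlgebra.ι k v * degreeProj k V n t) = braidAt c 0 (cons k V (v ⊗ₜ
              (((List.range j).map (braidAt c)).prod (degreeProj k V n t)))) := by
          intro j
          rw [List.range_succ_eq_map, List.map_cons, List.prod_cons, Module.End.mul_apply,
            ← cons_tmul, braidAt_succ_prod, LinearMap.lTensor_tmul]
        rw [Finset.sum_congr rfl fun j _ => e j, ← map_sum, ← map_sum, ← TensorProduct.tmul_sum, ih]
        simp [braidAt, firstComponent]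

lemma firstComponent_degreeProj (n : ℕ) (t : TensorAlgebra k V) :
    (degreeProj k V n).lTensor V (firstComponent c t) =
      firstComponent c (degreeProj k V (n + 1) t) := by
  have hs0 : ∀ y, (degreeProj k V 0).lTensor V (slide c y) = 0 := by
    have : (degreeProj k V 0) ∘ₗ cons k V = 0 := by ext v t; simp [degreeProj_zero_mul]
    intro y
    simp only [slide, LinearMap.comp_apply]
    rw [← LinearMap.comp_apply, ← LinearMap.lTensor_comp, this]
    simp
  have hs : ∀ m v y, (degreeProj k V (m + 1)).lTensor V (slide c (v ⊗ₜ y)) =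
      slide c (v ⊗ₜ (degreeProj k V m).lTensor V y) := by
    have h : ∀ m, (degreeProj k V (m + 1)) ∘ₗ cons k V = cons k V ∘ₗ
      (degreeProj k V m).lTensor V := by intro m; ext v t; simp [degreeProj_succ_mul]
    intro m v y
    simp only [slide, LinearMap.comp_apply]
    rw [← LinearMap.comp_apply, ← LinearMap.lTensor_comp, h]
    induction y with
    | zero => simp
    | add a b ha hb => simp only [TensorProduct.tmul_add, map_add, ha, hb]
    | tmul x t =>
      simp only [LinearEquiv.coe_coe, TensorProduct.assoc_symm_tmul, LinearMap.rTensor_tmul,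
        LinearMap.lTensor_tmul]
      induction c (v ⊗ₜ x) with
      | zero => simp
      | add a b ha hb => simp only [TensorProduct.add_tmul, map_add, ha, hb]
      | tmul => simp
  suffices h : (degreeProj k V n).lTensor V ∘ₗ firstComponent c =
      firstComponent c ∘ₗ degreeProj k V (n + 1) from LinearMap.congr_fun h t
  induction n with
  | zero =>
    apply words_ext
    · simp [degreeProj_one, firstComponent]
    · intro v t _
      simp only [LinearMap.comp_apply, degreeProj_succ_mul, firstComponent, peel_mul, map_add,
        LinearMap.lTensor_tmul, hs0]
      have : peel (slide c) ∘ₗ degreeProj k V 0 = 0 := by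
        apply words_ext
        · simp [degreeProj_one]
        · intro v t _; simp [degreeProj_zero_mul]
      have := LinearMap.congr_fun this t
      simp only [LinearMap.comp_apply, LinearMap.zero_apply] at this
      simp [this]
  | succ n ih =>
    apply words_ext
    · simp [degreeProj_one, firstComponent]
    · intro v t _
      have := LinearMap.congr_fun ih t
      simp only [LinearMap.comp_apply, firstComponent] at this
      simp only [LinearMap.comp_apply, degreeProj_succ_mul, firstComponent, peel_mul, map_add,
        LinearMap.lTensor_tmul, hs, this]

lemma symmetrizer_succ (n : ℕ) (t : TensorAlgebra k V) :
    symmetrizer c (n + 1) (degreeProj k V (n + 1) t) =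
      cons k V ((symmetrizer c n).lTensor V (firstComponent c (degreeProj k V (n + 1) t))) := by
  let e : Equiv.Perm (Fin (n + 1)) → Fin (n + 1) × Equiv.Perm (Fin n) := fun s =>
    (s.symm 0, (Equiv.Perm.decomposeFin (s * (Fin.cycleRange (s.symm 0))⁻¹)).2)
  have he : Function.Bijective e := by
    rw [Fintype.bijective_iff_injective_and_card]
    constructor
    · intro s s' h
      have h1 : s.symm 0 = s'.symm 0 := congrArg Prod.fst h
      have h2 := congrArg Prod.snd h
      have h3 : ∀ s : Equiv.Perm (Fin (n + 1)),
          (Equiv.Perm.decomposeFin (s * (Fin.cycleRange (s.symm 0))⁻¹)).1 = 0 := by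
        intro s
        have := Equiv.Perm.decomposeFin_symm_apply_zero
          (Equiv.Perm.decomposeFin (s * (Fin.cycleRange (s.symm 0))⁻¹)).1
          (Equiv.Perm.decomposeFin (s * (Fin.cycleRange (s.symm 0))⁻¹)).2
        rw [Prod.mk.eta, Equiv.symm_apply_apply] at this
        rw [← this, Equiv.Perm.mul_apply]
        have : (Fin.cycleRange (s.symm 0))⁻¹ 0 = s.symm 0 := Fin.cycleRange_symm_zero _
        rw [this]; simp
      have h4 := Equiv.Perm.decomposeFin.injective (Prod.ext ((h3 s).trans (h3 s').symm) h2)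
      rw [h1] at h4
      exact mul_right_cancel h4
    · simp [Fintype.card_perm, Nat.factorial_succ]
  have h1 : symmetrizer c (n + 1) = ∑ q : Fin (n + 1) × Equiv.Perm (Fin n),
      (((reducedWord n q.2).map Nat.succ).map (braidAt c)).prod *
        ((List.range q.1).map (braidAt c)).prod := by
    rw [symmetrizer]
    refine Fintype.sum_bijective e he _ _ ?_
    intro s
    simp [matsumotoLift, reducedWord, e]
  rw [h1, Fintype.sum_prod_type_right]
  simp only [← Finset.mul_sum]
  rw [← Finset.sum_mul, Module.End.mul_apply, LinearMap.sum_apply Finset.univ (fun i : Fin (n + 1) =>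
    ((List.range i).map (braidAt c)).prod), Fin.sum_univ_eq_sum_range (fun j => ((List.range j).map (braidAt c)).prod
      (degreeProj k V (n + 1) t)), sum_range_braidAt, LinearMap.sum_apply]
  simp only [braidAt_succ_prod, symmetrizer, matsumotoLift]
  rw [← map_sum]
  congr 1
  rw [← LinearMap.coe_lTensorHom, map_sum, LinearMap.sum_apply]

/-- The braided symmetrizer on degree `n`, extended by zero to all other degrees. -/
noncomputable def omega (n : ℕ) : Module.End k (TensorAlgebra k V) :=
  symmetrizer c n ∘ₗ degreeProj k V n

lemma omega_zero : omega c 0 = degreeProj k V 0 := by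
  ext t
  simp [omega, symmetrizer, matsumotoLift, reducedWord]

lemma omega_succ (n : ℕ) (t : TensorAlgebra k V) :
    omega c (n + 1) t = cons k V ((omega c n).lTensor V (firstComponent c t)) := by
  rw [omega, LinearMap.comp_apply, symmetrizer_succ, ← firstComponent_degreeProj, omega,
    LinearMap.lTensor_comp, LinearMap.comp_apply]

/-- The space `⊕ₙ ker Sₙ`. -/
noncomputable def radical : Submodule k (TensorAlgebra k V) :=
  ⨅ n, LinearMap.ker (omega c n)

lemma mem_radical {t : TensorAlgebra k V} : t ∈ radical c ↔ ∀ n, omega c n t = 0 := by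
  simp [radical]

/-- An element of `W ⊗ T(V)` killed by all `id ⊗ Sₙ` lies in `W ⊗ ⊕ₙ ker Sₙ`. -/
lemma apply_eq_zero_of_omega {W Z : Type*} [AddCommGroup W] [Module k W] [AddCommGroup Z]
    [Module k Z] {y : W ⊗[k] TensorAlgebra k V} (hy : ∀ n, (omega c n).lTensor W y = 0)
    (F : W ⊗[k] TensorAlgebra k V →ₗ[k] Z) (hF : ∀ w, ∀ s ∈ radical c, F (w ⊗ₜ s) = 0) :
    F y = 0 := by
  classical
  let b := Module.Basis.ofVectorSpace k W
  let e := TensorProduct.equivFinsuppOfBasisLeft (N := TensorAlgebra k V) b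
  have h1 : ∀ (f : Module.End k (TensorAlgebra k V)) (y : W ⊗[k] TensorAlgebra k V) i,
      e (f.lTensor W y) i = f (e y i) := by
    intro f y i
    induction y with
    | zero => simp
    | add a b ha hb => simp only [map_add, Finsupp.add_apply, ha, hb]
    | tmul w s => simp [e]
  have h2 : ∀ i, e y i ∈ radical c := by
    intro i
    rw [mem_radical]
    intro n
    rw [← h1, hy, map_zero, Finsupp.zero_apply]
  have h3 : y = (e y).sum fun i n => b i ⊗ₜ n := by
    conv_lhs => rw [← e.symm_apply_apply y]
    exact TensorProduct.equivFinsuppOfBasisLeft_symm_apply b (e y)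
  rw [h3, Finsupp.sum, map_sum]
  exact Finset.sum_eq_zero fun i _ => hF _ _ (h2 i)

/-- `D` maps the radical into `V ⊗ radical`. -/
lemma omega_firstComponent {t : TensorAlgebra k V} (ht : t ∈ radical c) (n : ℕ) :
    (omega c n).lTensor V (firstComponent c t) = 0 := by
  apply cons_injective
  rw [← omega_succ, map_zero]
  exact (mem_radical c).1 ht _

lemma mul_mem_radical (s : TensorAlgebra k V) {t : TensorAlgebra k V} (ht : t ∈ radical c) :
    s * t ∈ radical c := by
  have key : ∀ (n : ℕ) (v : V), ∀ t ∈ radical c, omega c n (TensorAlgebra.ι k v * t) = 0 := by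
    intro n
    induction n with
    | zero => intro v t _; rw [omega_zero, degreeProj_zero_mul]
    | succ n ih =>
      intro v t ht
      rw [omega_succ, firstComponent, peel_mul, map_add, map_add, LinearMap.lTensor_tmul,
        (mem_radical c).1 ht n]
      simp only [TensorProduct.tmul_zero, map_zero, zero_add]
      refine apply_eq_zero_of_omega c (omega_firstComponent c ht)
        (cons k V ∘ₗ (omega c n).lTensor V ∘ₗ slide c ∘ₗ TensorProduct.mk k _ _ v) ?_
      intro x s hs
      simp only [slide, LinearMap.comp_apply, TensorProduct.mk_apply, LinearEquiv.coe_coe,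
        TensorProduct.assoc_symm_tmul, LinearMap.rTensor_tmul]
      induction c (v ⊗ₜ x) with
      | zero => simp
      | add a b ha hb => simp only [TensorProduct.add_tmul, map_add, ha, hb, add_zero]
      | tmul a b => simp [ih b s hs]
  induction s using TensorAlgebra.induction generalizing t with
  | algebraMap r => rw [← Algebra.smul_def]; exact Submodule.smul_mem _ _ ht
  | ι v => exact (mem_radical c).2 fun n => key n v t ht
  | add a b ha hb => rw [add_mul]; exact Submodule.add_mem _ (ha ht) (hb ht)
  | mul a b ha hb => rw [mul_assoc]; exact ha (hb ht)

end Symmetrizer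

section TensorYD

open Coalgebra HopfAlgebra

variable {k : Type u} {H : Type v} {V : Type w} [Field k] [Ring H] [HopfAlgebra k H]
  [AddCommGroup V] [Module k V] (Y : YetterDrinfeldModule k H V)

/-- The diagonal action of `H` on the tensor algebra:
`h · (v₁ ⋯ vₙ) = (h₍₁₎ · v₁) ⋯ (h₍ₙ₎ · vₙ)` and `h · 1 = ε(h) 1`. -/
noncomputable def tensorAction : H →ₗ[k] Module.End k (TensorAlgebra k V) :=
  LinearMap.flip <| foldWords
    (LinearMap.lcomp k (TensorAlgebra k V) comul ∘ₗ
      LinearMap.llcomp k (H ⊗[k] H) (V ⊗[k] TensorAlgebra k V) (TensorAlgebra k V) (cons k V) ∘ₗ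
      TensorProduct.homTensorHomMap (RingHom.id k) H H V (TensorAlgebra k V) ∘ₗ
      Y.action.toLinearMap.flip.rTensor (H →ₗ[k] TensorAlgebra k V))
    (Algebra.linearMap k (TensorAlgebra k V) ∘ₗ counit)

/-- The diagonal coaction of `H` on the tensor algebra, the algebra map
`v₁ ⋯ vₙ ↦ v₁₍₋₁₎ ⋯ vₙ₍₋₁₎ ⊗ v₁₍₀₎ ⋯ vₙ₍₀₎`. -/
noncomputable def tensorCoaction : TensorAlgebra k V →ₐ[k] H ⊗[k] TensorAlgebra k V :=
  TensorAlgebra.lift k ((TensorAlgebra.ι k).lTensor H ∘ₗ Y.coaction)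

/-- Left multiplication by `v ⊗ 1 + 1 ⊗ v` in the braided tensor product algebra `T(V) ⊗ T(V)`:
`v ⊗ (a ⊗ b) ↦ v a ⊗ b + (v₍₋₁₎ · a) ⊗ v₍₀₎ b`. -/
noncomputable def primitiveMul :
    V ⊗[k] (TensorAlgebra k V ⊗[k] TensorAlgebra k V) →ₗ[k]
      TensorAlgebra k V ⊗[k] TensorAlgebra k V :=
  ((cons k V).rTensor (TensorAlgebra k V) + (cons k V).lTensor (TensorAlgebra k V) ∘ₗ
    (TensorProduct.assoc k (TensorAlgebra k V) V (TensorAlgebra k V)).toLinearMap ∘ₗ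
    (braiding Y.coaction Y.tensorAction).rTensor (TensorAlgebra k V)) ∘ₗ
  (TensorProduct.assoc k V (TensorAlgebra k V) (TensorAlgebra k V)).symm.toLinearMap

/-- The comultiplication of the tensor algebra: the algebra map to the braided tensor product
algebra `T(V) ⊗ T(V)`, whose product is `(a ⊗ b)(a' ⊗ b') = a (b₍₋₁₎ · a') ⊗ b₍₀₎ b'`, with
`Δ(v) = v ⊗ 1 + 1 ⊗ v` for `v` in `V`. Thus `Δ(v₁ ⋯ vₙ) = Δ(v₁) (⋯ (Δ(vₙ) (1 ⊗ 1)))`. -/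
noncomputable def tensorComul : TensorAlgebra k V →ₗ[k] TensorAlgebra k V ⊗[k] TensorAlgebra k V :=
  foldWords Y.primitiveMul (1 ⊗ₜ 1)

lemma tensorAction_one (h : H) : Y.tensorAction h 1 = algebraMap k _ (counit h) := by
  simp [tensorAction]

lemma cons_equivariant (h : H) :
    cons k V ∘ₗ diagAction Y.action.toLinearMap Y.tensorAction h = Y.tensorAction h ∘ₗ cons k V := by
  ext v t
  simp only [TensorProduct.AlgebraTensorModule.curry_apply,
    LinearMap.restrictScalars_self, TensorProduct.curry_apply, LinearMap.comp_apply]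
  rw [diagAction_tmul, cons_tmul]
  conv_rhs => rw [tensorAction, LinearMap.flip_apply, foldWords_mul]
  rfl

lemma counit_tensorAction (h : H) (t : TensorAlgebra k V) :
    TensorAlgebra.algebraMapInv (Y.tensorAction h t) =
      counit h * TensorAlgebra.algebraMapInv t := by
  suffices e : TensorAlgebra.algebraMapInv.toLinearMap ∘ₗ Y.tensorAction h =
      (counit h : k) • TensorAlgebra.algebraMapInv.toLinearMap from LinearMap.congr_fun e t
  apply words_ext
  · simp [tensorAction_one, TensorAlgebra.algebraMapInv]
  · intro v t _
    have := LinearMap.congr_fun (Y.cons_equivariant h) (v ⊗ₜ t)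
    simp only [LinearMap.comp_apply, cons_tmul] at this
    simp only [LinearMap.comp_apply, ← this, AlgHom.toLinearMap_apply, LinearMap.smul_apply]
    have e : TensorAlgebra.algebraMapInv.toLinearMap ∘ₗ cons k V = 0 := by
      ext v t; simp [TensorAlgebra.algebraMapInv]
    have := LinearMap.congr_fun e (diagAction Y.action.toLinearMap Y.tensorAction h (v ⊗ₜ t))
    simp only [LinearMap.comp_apply, AlgHom.toLinearMap_apply] at this
    rw [this]
    simp [TensorAlgebra.algebraMapInv]

lemma tensorCoaction_cons :
    (cons k V).lTensor H ∘ₗ diagCoaction Y.coaction Y.tensorCoaction.toLinearMap =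
      Y.tensorCoaction.toLinearMap ∘ₗ cons k V := by
  ext v t
  simp only [TensorProduct.AlgebraTensorModule.curry_apply, LinearMap.restrictScalars_self,
    TensorProduct.curry_apply, LinearMap.comp_apply, cons_tmul, AlgHom.toLinearMap_apply, map_mul,
    diagCoaction, TensorProduct.map_tmul]
  have : Y.tensorCoaction (TensorAlgebra.ι k v) =
    (TensorAlgebra.ι k).lTensor H (Y.coaction v) := by simp [tensorCoaction]
  rw [this]
  induction Y.coaction v with
  | zero => simp
  | add a b ha hb => simp only [TensorProduct.add_tmul, map_add, ha, hb, add_mul]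
  | tmul a x =>
    induction Y.tensorCoaction t with
    | zero => simp
    | add a b ha hb => simp only [TensorProduct.tmul_add, map_add, ha, hb, mul_add]
    | tmul b s => simp

/-- `slide` is a morphism of `H`-modules. -/
lemma slide_equivariant (h : H) :
    slide Y.braid ∘ₗ diagAction Y.action.toLinearMap
      (diagAction Y.action.toLinearMap Y.tensorAction) h =
    diagAction Y.action.toLinearMap Y.tensorAction h ∘ₗ slide Y.braid := by
  have h1 := diagAction_map (f := Y.braid) (g := LinearMap.id) Y.braid_equivariant
    (σ := Y.tensorAction) (σ' := Y.tensorAction) (fun _ => rfl) h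
  have h2 := diagAction_map (f := LinearMap.id) (g := cons k V) (ρ := Y.action.toLinearMap)
    (ρ' := Y.action.toLinearMap) (fun _ => rfl) Y.cons_equivariant h
  have h3 := diagAction_assoc Y.action.toLinearMap Y.action.toLinearMap Y.tensorAction h
  refine LinearMap.ext fun y => ?_
  obtain ⟨z, rfl⟩ := (TensorProduct.assoc k V V (TensorAlgebra k V)).surjective y
  have e3 := LinearMap.congr_fun h3 z
  have e1 := LinearMap.congr_fun h1 z
  have e4 := LinearMap.congr_fun h3 (Y.braid.rTensor _ z)
  have e2 := LinearMap.congr_fun h2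
    (TensorProduct.assoc k V V (TensorAlgebra k V) (Y.braid.rTensor _ z))
  simp only [LinearMap.comp_apply, LinearEquiv.coe_coe] at e1 e2 e3 e4
  simp only [slide, LinearMap.comp_apply, LinearEquiv.coe_coe, ← e3,
    LinearEquiv.symm_apply_apply]
  change (cons k V).lTensor V (TensorProduct.assoc k V V _ (TensorProduct.map Y.braid
    LinearMap.id _)) = _
  rw [e1]
  exact (congrArg ((cons k V).lTensor V) e4).trans e2

lemma firstComponent_equivariant (h : H) :
    firstComponent Y.braid ∘ₗ Y.tensorAction h =
      diagAction Y.action.toLinearMap Y.tensorAction h ∘ₗ firstComponent Y.braid := by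
  ext t
  simp only [LinearMap.comp_apply]
  induction t using words_induction generalizing h with
  | one =>
    rw [tensorAction_one, firstComponent, peel_one, map_zero, Algebra.algebraMap_eq_smul_one,
      map_smul, peel_one, smul_zero]
  | add s t hs ht => simp only [map_add, hs, ht]
  | smul r t ht => simp only [map_smul, ht]
  | mul v t ih =>
    have e1 := LinearMap.congr_fun (Y.cons_equivariant h) (v ⊗ₜ t)
    simp only [LinearMap.comp_apply, cons_tmul] at e1
    have e2 := LinearMap.congr_fun (Y.slide_equivariant h) (v ⊗ₜ firstComponent Y.braid t)
    simp only [LinearMap.comp_apply] at e2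
    have e3 : ∀ y, firstComponent Y.braid (cons k V y) =
        y + slide Y.braid ((firstComponent Y.braid).lTensor V y) := by
      intro y
      suffices e : firstComponent Y.braid ∘ₗ cons k V = LinearMap.id +
        slide Y.braid ∘ₗ (firstComponent Y.braid).lTensor V from LinearMap.congr_fun e y
      ext v t; simp [firstComponent]
    have e4 : (firstComponent Y.braid).lTensor V (diagAction Y.action.toLinearMap
        Y.tensorAction h (v ⊗ₜ t)) = diagAction Y.action.toLinearMap
        (diagAction Y.action.toLinearMap Y.tensorAction) h (v ⊗ₜ firstComponent Y.braid t) := by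
      rw [diagAction_tmul, diagAction_tmul]
      induction (comul h : H ⊗[k] H) with
      | zero => simp
      | add a b ha hb => simp only [map_add, ha, hb]
      | tmul a b => simp [ih]
    rw [← e1, e3, e4, e2, ← map_add]
    simp [firstComponent]

lemma diagCoaction_assoc_apply {X₁ X₂ X₃ : Type*} [AddCommGroup X₁] [Module k X₁]
    [AddCommGroup X₂] [Module k X₂] [AddCommGroup X₃] [Module k X₃]
    (δ : X₁ →ₗ[k] H ⊗[k] X₁) (ε : X₂ →ₗ[k] H ⊗[k] X₂) (ζ : X₃ →ₗ[k] H ⊗[k] X₃) (z) :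
    (TensorProduct.assoc k X₁ X₂ X₃).toLinearMap.lTensor H
      (diagCoaction (diagCoaction δ ε) ζ z) =
      diagCoaction δ (diagCoaction ε ζ) (TensorProduct.assoc k X₁ X₂ X₃ z) :=
  LinearMap.congr_fun (diagCoaction_assoc δ ε ζ) z

/-- `slide` is a morphism of `H`-comodules. -/
lemma slide_colinear (y : V ⊗[k] (V ⊗[k] TensorAlgebra k V)) :
    (slide Y.braid).lTensor H (diagCoaction Y.coaction
      (diagCoaction Y.coaction Y.tensorCoaction.toLinearMap) y) =
    diagCoaction Y.coaction Y.tensorCoaction.toLinearMap (slide Y.braid y) := by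
  obtain ⟨z, rfl⟩ := (TensorProduct.assoc k V V (TensorAlgebra k V)).surjective y
  have h1 : ∀ z, (Y.braid.rTensor (TensorAlgebra k V)).lTensor H
      (diagCoaction (diagCoaction Y.coaction Y.coaction) Y.tensorCoaction.toLinearMap z) =
      diagCoaction (diagCoaction Y.coaction Y.coaction) Y.tensorCoaction.toLinearMap
        (Y.braid.rTensor _ z) := by
    intro z
    induction z with
    | zero => simp
    | add a b ha hb => simp only [map_add, ha, hb]
    | tmul a b =>
      exact diagCoaction_map (g := LinearMap.id) (LinearMap.congr_fun Y.braid_colinear a) (by simp)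
  have h2 : ∀ z, ((cons k V).lTensor V).lTensor H (diagCoaction Y.coaction
      (diagCoaction Y.coaction Y.tensorCoaction.toLinearMap) z) =
      diagCoaction Y.coaction Y.tensorCoaction.toLinearMap ((cons k V).lTensor V z) := by
    intro z
    induction z with
    | zero => simp
    | add a b ha hb => simp only [map_add, ha, hb]
    | tmul a b =>
      exact diagCoaction_map (f := LinearMap.id) (by simp)
        (LinearMap.congr_fun Y.tensorCoaction_cons b)
  rw [← diagCoaction_assoc_apply]
  simp only [slide, LinearMap.lTensor_comp, LinearMap.comp_apply, LinearEquiv.coe_coe,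
    LinearEquiv.symm_apply_apply]
  have h3 : ∀ w : H ⊗[k] ((V ⊗[k] V) ⊗[k] TensorAlgebra k V),
      (TensorProduct.assoc k V V (TensorAlgebra k V)).symm.toLinearMap.lTensor H
        ((TensorProduct.assoc k V V (TensorAlgebra k V)).toLinearMap.lTensor H w) = w := by
    intro w
    rw [← LinearMap.comp_apply, ← LinearMap.lTensor_comp]
    simp
  rw [h3, h1, diagCoaction_assoc_apply, h2]

lemma firstComponent_colinear (t : TensorAlgebra k V) :
    (firstComponent Y.braid).lTensor H (Y.tensorCoaction t) =
      diagCoaction Y.coaction Y.tensorCoaction.toLinearMap (firstComponent Y.braid t) := by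
  induction t using words_induction with
  | one => simp [firstComponent, Algebra.TensorProduct.one_def]
  | add s t hs ht => simp only [map_add, hs, ht]
  | smul r t ht => simp only [map_smul, ht]
  | mul v t ih =>
    have e1 := LinearMap.congr_fun Y.tensorCoaction_cons (v ⊗ₜ t)
    simp only [LinearMap.comp_apply, cons_tmul, AlgHom.toLinearMap_apply] at e1
    have e3 : firstComponent Y.braid ∘ₗ cons k V = LinearMap.id +
        slide Y.braid ∘ₗ (firstComponent Y.braid).lTensor V := by
      ext v t; simp [firstComponent]
    have e4 : ((firstComponent Y.braid).lTensor V).lTensor H (diagCoaction Y.coaction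
        Y.tensorCoaction.toLinearMap (v ⊗ₜ t)) = diagCoaction Y.coaction
        (diagCoaction Y.coaction Y.tensorCoaction.toLinearMap) (v ⊗ₜ firstComponent Y.braid t) :=
      diagCoaction_map (f := LinearMap.id) (by simp) ih
    rw [← e1, ← LinearMap.comp_apply, ← LinearMap.lTensor_comp, e3, LinearMap.lTensor_add,
      LinearMap.lTensor_comp, LinearMap.add_apply, LinearMap.comp_apply, e4, slide_colinear,
      LinearMap.lTensor_id, LinearMap.id_apply, ← map_add]
    simp [firstComponent]

/-- The coaction maps `⊕ₙ ker Sₙ` to `H ⊗ ⊕ₙ ker Sₙ`. -/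
lemma omega_tensorCoaction (n : ℕ) : ∀ t ∈ radical Y.braid,
    (omega Y.braid n).lTensor H (Y.tensorCoaction t) = 0 := by
  induction n with
  | zero =>
    intro t ht
    have e : (degreeProj k V 0).lTensor H ∘ₗ Y.tensorCoaction.toLinearMap =
        (TensorProduct.mk k H (TensorAlgebra k V) 1) ∘ₗ degreeProj k V 0 := by
      apply words_ext
      · simp [degreeProj_one, Algebra.TensorProduct.one_def]
      · intro v t _
        have e1 := LinearMap.congr_fun Y.tensorCoaction_cons (v ⊗ₜ t)
        simp only [LinearMap.comp_apply, cons_tmul, AlgHom.toLinearMap_apply] at e1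
        have e2 : degreeProj k V 0 ∘ₗ cons k V = 0 := by ext v t; simp [degreeProj_zero_mul]
        simp only [LinearMap.comp_apply, AlgHom.toLinearMap_apply, ← e1, degreeProj_zero_mul]
        rw [← LinearMap.comp_apply, ← LinearMap.lTensor_comp, e2]
        simp
    have := LinearMap.congr_fun e t
    simp only [LinearMap.comp_apply, AlgHom.toLinearMap_apply] at this
    rw [omega_zero, this, ← omega_zero Y.braid, (mem_radical _).1 ht 0, map_zero]
  | succ n ih =>
    intro t ht
    have e : omega Y.braid (n + 1) = cons k V ∘ₗ (omega Y.braid n).lTensor V ∘ₗ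
        firstComponent Y.braid := by ext t; exact omega_succ _ _ _
    rw [e, LinearMap.lTensor_comp, LinearMap.lTensor_comp, LinearMap.comp_apply,
      LinearMap.comp_apply, firstComponent_colinear]
    refine apply_eq_zero_of_omega Y.braid (omega_firstComponent _ ht)
      ((cons k V).lTensor H ∘ₗ ((omega Y.braid n).lTensor V).lTensor H ∘ₗ
        diagCoaction Y.coaction Y.tensorCoaction.toLinearMap) ?_
    intro x s hs
    have h0 := ih s hs
    simp only [LinearMap.comp_apply, diagCoaction, TensorProduct.map_tmul,
      AlgHom.toLinearMap_apply]
    have e5 : ∀ a : H ⊗[k] V, ∀ b : H ⊗[k] TensorAlgebra k V,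
        ((omega Y.braid n).lTensor V).lTensor H ((LinearMap.mul' k H).rTensor _
          ((TensorProduct.tensorTensorTensorComm k H V H (TensorAlgebra k V)) (a ⊗ₜ b))) =
        (LinearMap.mul' k H).rTensor _
          ((TensorProduct.tensorTensorTensorComm k H V H (TensorAlgebra k V))
            (a ⊗ₜ (omega Y.braid n).lTensor H b)) := by
      intro a b
      induction a with
      | zero => simp
      | add a a' ha hb => simp only [TensorProduct.add_tmul, map_add, ha, hb]
      | tmul a x =>
        induction b with
        | zero => simp
        | add a a' ha hb => simp only [TensorProduct.tmul_add, map_add, ha, hb]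
        | tmul b s => simp
    simp only [LinearEquiv.coe_coe, e5, h0, TensorProduct.tmul_zero, map_zero]

/-- `⊕ₙ ker Sₙ` is stable under right multiplication. -/
lemma radical_mul_mem (s : TensorAlgebra k V) {t : TensorAlgebra k V} (ht : t ∈ radical Y.braid) :
    t * s ∈ radical Y.braid := by
  have e0 : ∀ (w : V) (t : TensorAlgebra k V), firstComponent Y.braid (t * TensorAlgebra.ι k w) =
      (LinearMap.mulRight k (TensorAlgebra.ι k w)).lTensor V (firstComponent Y.braid t) +
      (Y.action.toLinearMap.flip w).rTensor _ (Y.tensorCoaction t) := by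
    intro w t
    induction t using words_induction with
    | one =>
      have : TensorAlgebra.ι k w = TensorAlgebra.ι k w * 1 := by simp
      rw [one_mul, this, firstComponent, peel_mul]
      simp [Algebra.TensorProduct.one_def]
    | add s t hs ht => simp only [add_mul, map_add, hs, ht]; abel
    | smul r t ht => simp only [Algebra.smul_mul_assoc, map_smul, ht, smul_add]
    | mul v t ih =>
      have h1 : ∀ y, slide Y.braid (v ⊗ₜ
          (LinearMap.mulRight k (TensorAlgebra.ι k w)).lTensor V y) =
          (LinearMap.mulRight k (TensorAlgebra.ι k w)).lTensor V (slide Y.braid (v ⊗ₜ y)) := by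
        intro y
        induction y with
        | zero => simp
        | add a b ha hb => simp only [TensorProduct.tmul_add, map_add, ha, hb]
        | tmul x t =>
          simp only [slide, LinearMap.comp_apply, LinearMap.lTensor_tmul, LinearEquiv.coe_coe,
            TensorProduct.assoc_symm_tmul, LinearMap.rTensor_tmul]
          induction Y.braid (v ⊗ₜ x) with
          | zero => simp
          | add a b ha hb => simp only [TensorProduct.add_tmul, map_add, ha, hb]
          | tmul a b => simp [mul_assoc]
      have h2 : ∀ y : H ⊗[k] TensorAlgebra k V,
          slide Y.braid (v ⊗ₜ ((Y.action.toLinearMap.flip w).rTensor _ y)) =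
          (Y.action.toLinearMap.flip w).rTensor _ (Y.tensorCoaction (TensorAlgebra.ι k v) * y) := by
        intro y
        have : Y.tensorCoaction (TensorAlgebra.ι k v) =
          (TensorAlgebra.ι k).lTensor H (Y.coaction v) := by simp [tensorCoaction]
        rw [this]
        induction y with
        | zero => simp
        | add a b ha hb => simp only [TensorProduct.tmul_add, map_add, ha, hb, mul_add]
        | tmul g t =>
          simp only [slide, LinearMap.comp_apply, LinearMap.rTensor_tmul, LinearEquiv.coe_coe,
            TensorProduct.assoc_symm_tmul, braid, braiding_tmul]
          induction Y.coaction v with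
          | zero => simp
          | add a b ha hb => simp only [TensorProduct.add_tmul, map_add, ha, hb, add_mul]
          | tmul a b => simp
      have e1 : ∀ s, firstComponent Y.braid (TensorAlgebra.ι k v * s) =
        v ⊗ₜ s + slide Y.braid (v ⊗ₜ firstComponent Y.braid s) := fun s => by simp [firstComponent]
      rw [mul_assoc, e1, e1, ih, TensorProduct.tmul_add, map_add, map_add, h1, h2,
        map_mul Y.tensorCoaction]
      simp [add_assoc]
  have key : ∀ (n : ℕ) (w : V), ∀ t ∈ radical Y.braid,
      omega Y.braid n (t * TensorAlgebra.ι k w) = 0 := by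
    intro n
    induction n with
    | zero =>
      intro w t _
      have : degreeProj k V 0 ∘ₗ LinearMap.mulRight k (TensorAlgebra.ι k w) = 0 := by
        apply words_ext
        · have := degreeProj_zero_mul (k := k) w 1
          rw [mul_one] at this
          simp [this]
        · intro v t _; simp [mul_assoc, degreeProj_zero_mul]
      rw [omega_zero]
      exact LinearMap.congr_fun this t
    | succ n ih =>
      intro w t ht
      rw [omega_succ, e0, map_add, map_add]
      have a1 := apply_eq_zero_of_omega Y.braid (omega_firstComponent _ ht)
        (cons k V ∘ₗ (omega Y.braid n).lTensor V ∘ₗ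
          (LinearMap.mulRight k (TensorAlgebra.ι k w)).lTensor V)
        (by intro x s hs; simp [ih w s hs])
      have a2 := apply_eq_zero_of_omega Y.braid (fun n => Y.omega_tensorCoaction n t ht)
        (cons k V ∘ₗ (omega Y.braid n).lTensor V ∘ₗ
          (Y.action.toLinearMap.flip w).rTensor (TensorAlgebra k V))
        (by intro x s hs; simp [(mem_radical _).1 hs])
      simp only [LinearMap.comp_apply] at a1 a2
      rw [a1, a2, add_zero]
  induction s using TensorAlgebra.induction generalizing t with
  | algebraMap r =>
    rw [← Algebra.commutes, ← Algebra.smul_def]; exact Submodule.smul_mem _ _ ht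
  | ι v => exact (mem_radical _).2 fun n => key n v t ht
  | add a b ha hb => rw [mul_add]; exact Submodule.add_mem _ (ha ht) (hb ht)
  | mul a b ha hb => rw [← mul_assoc]; exact hb (ha ht)

end TensorYD

section Coideal

open Coalgebra HopfAlgebra

variable {k : Type u} {H : Type v} {V : Type w} [Field k] [Ring H] [HopfAlgebra k H]
  [AddCommGroup V] [Module k V] (Y : YetterDrinfeldModule k H V)

lemma firstComponent_primitiveMul (v : V) (z : TensorAlgebra k V ⊗[k] TensorAlgebra k V) :
    TensorProduct.assoc k V (TensorAlgebra k V) (TensorAlgebra k V)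
      ((firstComponent Y.braid).rTensor _ (Y.primitiveMul (v ⊗ₜ z))) =
    v ⊗ₜ z + Y.primitiveMul.lTensor V (TensorProduct.assoc k V V _ (Y.braid.rTensor _
      ((TensorProduct.assoc k V V _).symm (v ⊗ₜ (TensorProduct.assoc k V _ _
        ((firstComponent Y.braid).rTensor _ z)))))) := by
  induction z with
  | zero => simp
  | add a b ha hb =>
    simp only [TensorProduct.tmul_add, map_add, ha, hb]; abel
  | tmul a b =>
    let K : V ⊗[k] (TensorAlgebra k V ⊗[k] V) →ₗ[k]
        V ⊗[k] (TensorAlgebra k V ⊗[k] TensorAlgebra k V) :=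
      ((cons k V).lTensor _ ∘ₗ (TensorProduct.assoc k _ V _).toLinearMap).lTensor V ∘ₗ
        (TensorProduct.assoc k V (TensorAlgebra k V ⊗[k] V) (TensorAlgebra k V)).toLinearMap ∘ₗ
        (TensorProduct.mk k _ _).flip b
    have k1 : ∀ β : TensorAlgebra k V ⊗[k] V,
        TensorProduct.assoc k V (TensorAlgebra k V) (TensorAlgebra k V)
          ((firstComponent Y.braid).rTensor _ ((cons k V).lTensor _
            (TensorProduct.assoc k _ V _ (β ⊗ₜ b)))) =
        K (TensorProduct.assoc k V _ V ((firstComponent Y.braid).rTensor V β)) := by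
      intro β
      induction β with
      | zero => simp
      | add a b ha hb => simp only [TensorProduct.add_tmul, map_add, ha, hb]
      | tmul t x =>
        simp only [TensorProduct.assoc_tmul, LinearMap.lTensor_tmul, LinearMap.rTensor_tmul]
        induction firstComponent Y.braid t with
        | zero => simp
        | add a b ha hb => simp only [TensorProduct.add_tmul, map_add, ha, hb]
        | tmul => simp [K]
    have k2 : ∀ y : V ⊗[k] TensorAlgebra k V,
        Y.primitiveMul.lTensor V (TensorProduct.assoc k V V _ (Y.braid.rTensor _
          ((TensorProduct.assoc k V V _).symm (v ⊗ₜ (TensorProduct.assoc k V _ _ (y ⊗ₜ b)))))) =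
        TensorProduct.assoc k V _ _ (slide Y.braid (v ⊗ₜ y) ⊗ₜ b) +
        K ((braiding Y.coaction Y.tensorAction).lTensor V (TensorProduct.assoc k V V _
          (Y.braid.rTensor _ ((TensorProduct.assoc k V V _).symm (v ⊗ₜ y))))) := by
      intro y
      induction y with
      | zero => simp
      | add a b ha hb =>
        simp only [TensorProduct.add_tmul, TensorProduct.tmul_add, map_add, ha, hb]; abel
      | tmul x s =>
        simp only [slide, LinearMap.comp_apply, TensorProduct.assoc_tmul,
          TensorProduct.assoc_symm_tmul, LinearMap.rTensor_tmul, LinearEquiv.coe_coe]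
        induction Y.braid (v ⊗ₜ x) with
        | zero => simp
        | add a b ha hb => simp only [TensorProduct.add_tmul, map_add, ha, hb]; abel
        | tmul p q => simp [K, primitiveMul, TensorProduct.tmul_add]
    have k3 := LinearMap.congr_fun (braiding_natural Y.coaction Y.firstComponent_equivariant)
      (v ⊗ₜ a)
    have k4 := LinearMap.congr_fun (braiding_diagAction Y.coaction Y.coassoc Y.action.toLinearMap
      Y.tensorAction) (v ⊗ₜ firstComponent Y.braid a)
    simp only [LinearMap.comp_apply, LinearMap.lTensor_tmul, LinearEquiv.coe_coe] at k3 k4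
    have k5 : Y.primitiveMul (v ⊗ₜ (a ⊗ₜ b)) = (TensorAlgebra.ι k v * a) ⊗ₜ b +
        (cons k V).lTensor _ (TensorProduct.assoc k _ V _
          (braiding Y.coaction Y.tensorAction (v ⊗ₜ a) ⊗ₜ b)) := by simp [primitiveMul]
    rw [k5, map_add, map_add, k1, k3, k4, LinearMap.rTensor_tmul, LinearMap.rTensor_tmul, k2]
    simp only [firstComponent, peel_mul, TensorProduct.add_tmul, map_add,
      TensorProduct.assoc_tmul]
    rw [add_assoc]
    rfl

lemma firstComponent_tensorComul (t : TensorAlgebra k V) :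
    Y.tensorComul.lTensor V (firstComponent Y.braid t) =
      TensorProduct.assoc k V _ _ ((firstComponent Y.braid).rTensor _ (Y.tensorComul t)) := by
  induction t using words_induction with
  | one => simp [tensorComul, firstComponent]
  | add s t hs ht => simp only [map_add, hs, ht]
  | smul r t ht => simp only [map_smul, ht]
  | mul v t ih =>
    have h1 : Y.tensorComul (TensorAlgebra.ι k v * t) = Y.primitiveMul (v ⊗ₜ Y.tensorComul t) := by
      simp [tensorComul]
    rw [h1, firstComponent_primitiveMul, ← ih]
    conv_lhs => rw [firstComponent, peel_mul, map_add]
    rw [LinearMap.lTensor_tmul]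
    congr 1
    change _ = Y.primitiveMul.lTensor V (TensorProduct.assoc k V V _ (Y.braid.rTensor _
      ((TensorProduct.assoc k V V _).symm (v ⊗ₜ Y.tensorComul.lTensor V (peel _ t)))))
    induction peel (slide Y.braid) t with
    | zero => simp
    | add a b ha hb => simp only [TensorProduct.tmul_add, map_add, ha, hb]
    | tmul x s =>
      simp only [slide, LinearMap.comp_apply, LinearMap.lTensor_tmul,
          TensorProduct.assoc_symm_tmul, LinearMap.rTensor_tmul, LinearEquiv.coe_coe]
      induction Y.braid (v ⊗ₜ x) with
      | zero => simp
      | add a b ha hb => simp only [TensorProduct.add_tmul, map_add, ha, hb]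
      | tmul p q => simp [tensorComul]

lemma counit_tensorComul (t : TensorAlgebra k V) :
    (TensorAlgebra.algebraMapInv.toLinearMap).rTensor _ (Y.tensorComul t) = (1 : k) ⊗ₜ[k] t := by
  let τ : H →ₗ[k] Module.End k k := LinearMap.toSpanSingleton k _ LinearMap.id ∘ₗ counit
  have n1 := braiding_natural Y.coaction (σ := Y.tensorAction) (σ' := τ)
    (g := TensorAlgebra.algebraMapInv.toLinearMap)
    (by intro h; ext t; simp [τ, counit_tensorAction])
  have n2 : ∀ v r, braiding Y.coaction τ (v ⊗ₜ r) = r ⊗ₜ v := by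
    intro v r
    have e : τ.flip r = r • (counit : H →ₗ[k] k) := by ext h; simp [τ, mul_comm]
    rw [braiding_tmul, e, LinearMap.rTensor_smul, LinearMap.smul_apply, Y.counit_coaction,
      TensorProduct.smul_tmul', smul_eq_mul, mul_one]
  have n3 : ∀ v z, (TensorAlgebra.algebraMapInv.toLinearMap).rTensor _
      (Y.primitiveMul (v ⊗ₜ z)) = (LinearMap.mulLeft k (TensorAlgebra.ι k v)).lTensor k
        ((TensorAlgebra.algebraMapInv.toLinearMap).rTensor _ z) := by
    intro v z
    induction z with
    | zero => simp
    | add a b ha hb => simp only [TensorProduct.tmul_add, map_add, ha, hb]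
    | tmul a b =>
      have n4 := LinearMap.congr_fun n1 (v ⊗ₜ a)
      simp only [LinearMap.comp_apply, LinearMap.lTensor_tmul, n2] at n4
      have n5 : ∀ β : TensorAlgebra k V ⊗[k] V,
          (TensorAlgebra.algebraMapInv.toLinearMap).rTensor (TensorAlgebra k V)
            ((cons k V).lTensor _ (TensorProduct.assoc k _ V _ (β ⊗ₜ b))) =
          (cons k V).lTensor k (TensorProduct.assoc k _ V _
            ((TensorAlgebra.algebraMapInv.toLinearMap).rTensor V β ⊗ₜ b)) := by
        intro β
        induction β with
        | zero => simp
        | add a b ha hb => simp only [TensorProduct.add_tmul, map_add, ha, hb]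
        | tmul t x => simp
      simp only [primitiveMul, LinearMap.comp_apply, LinearMap.add_apply, LinearEquiv.coe_coe,
        TensorProduct.assoc_symm_tmul, map_add, n5, LinearMap.rTensor_tmul, n4]
      simp [TensorAlgebra.algebraMapInv]
  induction t using words_induction with
  | one => simp [tensorComul]
  | add s t hs ht => simp only [map_add, hs, ht, TensorProduct.tmul_add]
  | smul r t ht => simp only [map_smul, ht, TensorProduct.tmul_smul]
  | mul v t ih =>
    have h1 : Y.tensorComul (TensorAlgebra.ι k v * t) = Y.primitiveMul (v ⊗ₜ Y.tensorComul t) := by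
      simp [tensorComul]
    rw [h1, n3, ih]
    simp

/-- `⊕ₙ ker Sₙ` is a coideal. -/
lemma tensorComul_radical {B : Type*} [AddCommGroup B] [Module k B]
    (p : TensorAlgebra k V →ₗ[k] B) (hp : ∀ t ∈ radical Y.braid, p t = 0)
    {t : TensorAlgebra k V} (ht : t ∈ radical Y.braid) :
    TensorProduct.map p p (Y.tensorComul t) = 0 := by
  have key : ∀ n, ∀ t ∈ radical Y.braid,
      TensorProduct.map (omega Y.braid n) p (Y.tensorComul t) = 0 := by
    intro n
    induction n with
    | zero =>
      intro t ht
      have e : omega Y.braid 0 = Algebra.linearMap k _ ∘ₗ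
          TensorAlgebra.algebraMapInv.toLinearMap := by
        rw [omega_zero]
        apply words_ext
        · simp [degreeProj_one]
        · intro v t _; simp [degreeProj_zero_mul, TensorAlgebra.algebraMapInv]
      have e2 : TensorProduct.map (omega Y.braid 0) p = TensorProduct.map (Algebra.linearMap k _) p ∘ₗ
          (TensorAlgebra.algebraMapInv.toLinearMap).rTensor _ := by
        rw [e]; ext; simp
      rw [e2, LinearMap.comp_apply, counit_tensorComul, TensorProduct.map_tmul, hp t ht,
        TensorProduct.tmul_zero]
    | succ n ih =>
      intro t ht
      have e : TensorProduct.map (omega Y.braid (n + 1)) p = (cons k V).rTensor B ∘ₗ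
          (TensorProduct.assoc k V _ B).symm.toLinearMap ∘ₗ
          (TensorProduct.map (omega Y.braid n) p).lTensor V ∘ₗ
          (TensorProduct.assoc k V _ _).toLinearMap ∘ₗ (firstComponent Y.braid).rTensor _ := by
        ext a b
        simp only [TensorProduct.AlgebraTensorModule.curry_apply, LinearMap.restrictScalars_self,
          TensorProduct.curry_apply, LinearMap.comp_apply, TensorProduct.map_tmul, omega_succ,
          LinearMap.rTensor_tmul, LinearEquiv.coe_coe]
        induction firstComponent Y.braid a with
        | zero => simp
        | add a b ha hb => simp only [TensorProduct.add_tmul, map_add, ha, hb]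
        | tmul => simp
      rw [e]
      simp only [LinearMap.comp_apply, LinearEquiv.coe_coe, ← firstComponent_tensorComul]
      exact apply_eq_zero_of_omega Y.braid (omega_firstComponent _ ht)
        ((cons k V).rTensor B ∘ₗ (TensorProduct.assoc k V _ B).symm.toLinearMap ∘ₗ
          (TensorProduct.map (omega Y.braid n) p).lTensor V ∘ₗ Y.tensorComul.lTensor V)
        (by intro x s hs; simp [ih s hs])
  have h0 := apply_eq_zero_of_omega Y.braid
    (y := TensorProduct.comm k _ B (p.lTensor _ (Y.tensorComul t))) (W := B)
    (fun n => by
      have := congrArg (TensorProduct.comm k _ B) (key n t ht)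
      rw [map_zero] at this
      rw [← this]
      induction Y.tensorComul t with
      | zero => simp
      | add a b ha hb => simp only [map_add, ha, hb]
      | tmul => simp)
    (p.lTensor B) (by intro w s hs; simp [hp s hs])
  apply (TensorProduct.comm k B B).injective
  rw [map_zero, ← h0]
  induction Y.tensorComul t with
  | zero => simp
  | add a b ha hb => simp only [map_add, ha, hb]
  | tmul => simp

end Coideal

section Nichols

open Coalgebra HopfAlgebra

variable {k : Type u} {H : Type v} {V : Type w} [Field k] [Ring H] [HopfAlgebra k H]
  [AddCommGroup V] [Module k V] (Y : YetterDrinfeldModule k H V)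

/-- The ideal `⊕ₙ ker (Sₙ : V^{⊗ n} → V^{⊗ n})` of the tensor algebra: it consists of the elements
all of whose homogeneous components `tₙ` satisfy `Sₙ tₙ = 0`. (For `n ≤ 1` the map `Sₙ` is the
identity.) -/
noncomputable def nicholsIdeal : Ideal (TensorAlgebra k V) where
  carrier := {t | ∀ n, symmetrizer Y.braid n (degreeProj k V n t) = 0}
  zero_mem' := by simp
  add_mem' := by
    intro s t hs ht n
    rw [map_add, map_add, hs n, ht n, add_zero]
  smul_mem' := by
    intro s t ht
    exact (mem_radical _).1 (mul_mem_radical Y.braid s ((mem_radical _).2 ht))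

lemma mem_nicholsIdeal {t : TensorAlgebra k V} : t ∈ Y.nicholsIdeal ↔ t ∈ radical Y.braid :=
  (mem_radical _).symm

instance : Y.nicholsIdeal.IsTwoSided where
  mul_mem_of_left := by
    intro a b ha
    rw [mem_nicholsIdeal] at ha ⊢
    exact Y.radical_mul_mem b ha

/-- The Nichols algebra `B(V) = T(V) / ⊕ₙ ker Sₙ`. -/
abbrev NicholsAlgebra := TensorAlgebra k V ⧸ Y.nicholsIdeal

/-- The canonical map `T(V) → B(V)`. -/
noncomputable abbrev nicholsMk : TensorAlgebra k V →ₐ[k] Y.NicholsAlgebra :=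
  Ideal.Quotient.mkₐ k Y.nicholsIdeal

/-- The canonical map `V → B(V)`. -/
noncomputable def nicholsι : V →ₗ[k] Y.NicholsAlgebra :=
  Y.nicholsMk.toLinearMap ∘ₗ TensorAlgebra.ι k

/-- The degree `n` part `B(V)(n)` of the Nichols algebra. -/
noncomputable def nicholsDegree (n : ℕ) : Submodule k Y.NicholsAlgebra :=
  (tensorDegree k V n).map Y.nicholsMk.toLinearMap

/-- The coaction of `H` on the Nichols algebra, induced by the coaction on the tensor algebra. -/
noncomputable def nicholsCoaction : Y.NicholsAlgebra →ₐ[k] H ⊗[k] Y.NicholsAlgebra :=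
  Ideal.Quotient.liftₐ Y.nicholsIdeal
    ((Algebra.TensorProduct.map (AlgHom.id k H) Y.nicholsMk).comp Y.tensorCoaction) <| by
      intro t ht
      exact apply_eq_zero_of_omega Y.braid
        (fun n => Y.omega_tensorCoaction n t (Y.mem_nicholsIdeal.1 ht))
        (Algebra.TensorProduct.map (AlgHom.id k H) Y.nicholsMk).toLinearMap
        (by
          intro h s hs
          have : Y.nicholsMk s = 0 := Ideal.Quotient.eq_zero_iff_mem.2 (Y.mem_nicholsIdeal.2 hs)
          simp only [AlgHom.toLinearMap_apply, Algebra.TensorProduct.map_tmul, this,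
            TensorProduct.tmul_zero])

/-- The comultiplication of the Nichols algebra, induced by that of the tensor algebra. -/
noncomputable def nicholsComul :
    Y.NicholsAlgebra →ₗ[k] Y.NicholsAlgebra ⊗[k] Y.NicholsAlgebra :=
  (Y.nicholsIdeal.restrictScalars k).liftQ
      (TensorProduct.map Y.nicholsMk.toLinearMap Y.nicholsMk.toLinearMap ∘ₗ Y.tensorComul)
      (by
        intro t ht
        exact Y.tensorComul_radical _
          (fun s hs => Ideal.Quotient.eq_zero_iff_mem.2 (Y.mem_nicholsIdeal.2 hs))
          (Y.mem_nicholsIdeal.1 ht)) ∘ₗ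
    (Submodule.Quotient.restrictScalarsEquiv k Y.nicholsIdeal).symm.toLinearMap

@[simp] lemma nicholsCoaction_mk (t : TensorAlgebra k V) : Y.nicholsCoaction (Y.nicholsMk t) =
    Y.nicholsMk.toLinearMap.lTensor H (Y.tensorCoaction t) := rfl

@[simp] lemma nicholsComul_mk (t : TensorAlgebra k V) : Y.nicholsComul (Y.nicholsMk t) =
    TensorProduct.map Y.nicholsMk.toLinearMap Y.nicholsMk.toLinearMap (Y.tensorComul t) := rfl

/-- A subspace `W ⊆ V` is an `H`-subcomodule if `δ(W) ⊆ H ⊗ W`. -/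
def IsSubcomodule (W : Submodule k V) : Prop :=
  W.map Y.coaction ≤ LinearMap.range (W.subtype.lTensor H)

/-- Left coideal subalgebras of `B(V)` in the category of `ℕ₀`-graded left `H`-comodules. -/
structure IsLeftCoidealSubalgebra (C : Subalgebra k Y.NicholsAlgebra) : Prop where
  /-- `C` is a graded subspace: it is spanned by its homogeneous parts `C(n) = C ∩ B(V)(n)`. -/
  graded : Subalgebra.toSubmodule C = ⨆ n, Subalgebra.toSubmodule C ⊓ Y.nicholsDegree n
  /-- `δ(C) ⊆ H ⊗ C` -/
  subcomodule : (Subalgebra.toSubmodule C).map Y.nicholsCoaction.toLinearMap ≤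
    LinearMap.range ((Subalgebra.toSubmodule C).subtype.lTensor H)
  /-- `Δ(C) ⊆ B(V) ⊗ C` -/
  leftCoideal : (Subalgebra.toSubmodule C).map Y.nicholsComul ≤
    LinearMap.range ((Subalgebra.toSubmodule C).subtype.lTensor Y.NicholsAlgebra)

/-- `C` can be extended in degree `n`: there is `x ∈ B(V)(n)` with `x ∉ C` such that `⟨C, x⟩` is
a left coideal subalgebra in the category of `ℕ₀`-graded `H`-comodules. -/
def CanBeExtendedInDegree (C : Subalgebra k Y.NicholsAlgebra) (n : ℕ) : Prop :=
  ∃ x ∈ Y.nicholsDegree n, x ∉ C ∧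
    Y.IsLeftCoidealSubalgebra (Algebra.adjoin k ((C : Set Y.NicholsAlgebra) ∪ {x}))

/-- The subalgebra (with one) `⟨W⟩` of `B(V)` generated by a subspace `W` of `V`. -/
noncomputable def generated (W : Submodule k V) : Subalgebra k Y.NicholsAlgebra :=
  Algebra.adjoin k (Y.nicholsι '' (W : Set V))

/-- The degree `n` part `C(n) = C ∩ B(V)(n)`, as a subspace of `C`. -/
noncomputable def degreePart (C : Subalgebra k Y.NicholsAlgebra) (n : ℕ) : Submodule k C :=
  (Y.nicholsDegree n).comap C.val.toLinearMap

/-- The degree `n` part `(C ⊗ D)(n) = ⊕_{i + j = n} C(i) ⊗ D(j)` of the tensor product. -/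
noncomputable def tensorDegreePart (C D : Subalgebra k Y.NicholsAlgebra) (n : ℕ) :
    Submodule k (C ⊗[k] D) :=
  ⨆ p ∈ Finset.HasAntidiagonal.antidiagonal n,
    Submodule.map₂ (TensorProduct.mk k C D) (Y.degreePart C p.1) (Y.degreePart D p.2)

end Nichols

section Dual

open Coalgebra HopfAlgebra

variable {k : Type u} {H : Type v} {V : Type w} [Field k] [Ring H] [HopfAlgebra k H]
  [AddCommGroup V] [Module k V]

/-- evaluation at `x`: `g ⊗ f ↦ f(x) g` -/
noncomputable def evalAt {X : Type*} [AddCommGroup X] [Module k X] (x : V) :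
    X ⊗[k] Module.Dual k V →ₗ[k] X :=
  (TensorProduct.rid k X).toLinearMap ∘ₗ (Module.Dual.eval k V x).lTensor X

@[simp] lemma evalAt_tmul {X : Type*} [AddCommGroup X] [Module k X] (x : V) (g : X)
    (f : Module.Dual k V) : evalAt x (g ⊗ₜ f) = f x • g := by simp [evalAt]

variable [Module.Finite k V]

/-- For a linear map `f ↦ φ f` from `V*` to the space of linear maps `V → H`, the linear map
`δ : V* → H ⊗ V*`, `δ(f) = f₍₋₁₎ ⊗ f₍₀₎`, with `f₍₋₁₎ f₍₀₎(x) = φ f x` for all `x`. -/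
noncomputable def dualCoactionOf (φ : Module.Dual k V →ₗ[k] (V →ₗ[k] H)) :
    Module.Dual k V →ₗ[k] H ⊗[k] Module.Dual k V :=
  (TensorProduct.comm k (Module.Dual k V) H).toLinearMap ∘ₗ
    (dualTensorHomEquiv k V H).symm.toLinearMap ∘ₗ φ

lemma eq_of_evalAt {X : Type*} [AddCommGroup X] [Module k X] {y z : X ⊗[k] Module.Dual k V}
    (h : ∀ x : V, evalAt x y = evalAt x z) : y = z := by
  apply (TensorProduct.comm k X (Module.Dual k V)).injective
  apply (dualTensorHomEquiv k V X).injective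
  have e : ∀ (y : X ⊗[k] Module.Dual k V) (x : V),
      dualTensorHomEquiv k V X (TensorProduct.comm k X (Module.Dual k V) y) x = evalAt x y := by
    intro y x
    induction y with
    | zero => simp
    | add a b ha hb => simp only [map_add, LinearMap.add_apply, ha, hb]
    | tmul g f => simp [dualTensorHomEquiv]
  ext x
  rw [e, e, h]

lemma evalAt_dualCoactionOf (φ : Module.Dual k V →ₗ[k] (V →ₗ[k] H)) (f : Module.Dual k V)
    (x : V) : evalAt x (dualCoactionOf φ f) = φ f x := by
  have e : ∀ (y : Module.Dual k V ⊗[k] H) (x : V),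
      evalAt x (TensorProduct.comm k _ H y) = dualTensorHomEquiv k V H y x := by
    intro y x
    induction y with
    | zero => simp
    | add a b ha hb => simp only [map_add, LinearMap.add_apply, ha, hb]
    | tmul g f => simp [dualTensorHomEquiv]
  simp [dualCoactionOf, e]

end Dual

section DualModule

open Coalgebra HopfAlgebra

variable {k : Type u} {H : Type v} {V : Type w} [Field k] [Ring H] [HopfAlgebra k H]
  [AddCommGroup V] [Module k V] (Y : YetterDrinfeldModule k H V)

/-- The linear map `g ⊗ x ↦ f(x) g` for a functional `f`. -/
noncomputable def evalFun (f : Module.Dual k V) : H ⊗[k] V →ₗ[k] H :=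
  (TensorProduct.rid k H).toLinearMap ∘ₗ f.lTensor H

@[simp] lemma evalFun_tmul (f : Module.Dual k V) (g : H) (x : V) :
    evalFun f (g ⊗ₜ[k] x) = f x • g := by simp [evalFun]

/-- The inverse of a bijective antipode. -/
noncomputable def antipodeInv (hS : Function.Bijective (antipode k : H → H)) : H →ₗ[k] H :=
  (LinearEquiv.ofBijective (antipode k) hS).symm.toLinearMap

variable (hS : Function.Bijective (antipode k : H → H))

@[simp] lemma antipode_antipodeInv (h : H) : antipode k (antipodeInv hS h) = h :=
  (LinearEquiv.ofBijective (antipode k) hS).apply_symm_apply h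

lemma counit_antipodeInv (h : H) : counit (R := k) (antipodeInv hS h) = counit (R := k) h := by
  conv_rhs => rw [← antipode_antipodeInv hS h, HopfAlgebra.counit_antipode]

lemma comul_antipodeInv (h : H) : comul (R := k) (antipodeInv hS h) =
    TensorProduct.map (antipodeInv hS) (antipodeInv hS) (TensorProduct.comm k H H (comul h)) := by
  obtain ⟨g, rfl⟩ := hS.2 h
  have hg : ∀ g, antipodeInv hS (antipode k g) = g := fun g => hS.1 (antipode_antipodeInv hS _)
  rw [hg, comul_antipode]
  induction (comul g : H ⊗[k] H) with
  | zero => simp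
  | add a b ha hb => simp only [map_add, ← ha, ← hb]
  | tmul a b => simp [hg]

/-- The linear map `f ↦ (x ↦ S⁻¹(x₍₋₁₎) f(x₍₀₎))`. -/
noncomputable def dualPairing : Module.Dual k V →ₗ[k] (V →ₗ[k] H) where
  toFun f := antipodeInv hS ∘ₗ evalFun f ∘ₗ Y.coaction
  map_add' f g := by
    ext x
    simp [evalFun, LinearMap.lTensor_add]
  map_smul' c f := by
    ext x
    simp [evalFun, LinearMap.lTensor_smul]

/-- The dual action `(h · f)(x) = f(S(h) · x)`. -/
noncomputable def dualAction : H →ₐ[k] Module.End k (Module.Dual k V) :=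
  AlgHom.ofLinearMap
    (Module.Dual.transpose ∘ₗ Y.action.toLinearMap ∘ₗ antipode k)
    (by ext; simp [Module.Dual.transpose])
    (by
      intro a b
      ext
      simp [Module.Dual.transpose, HopfAlgebra.antipode_mul_antidistrib])

@[simp] lemma dualAction_apply (h : H) (f : Module.Dual k V) (x : V) :
    Y.dualAction h f x = f (Y.action (antipode k h) x) := rfl

variable [Module.Finite k V]

/-- The dual Yetter--Drinfeld module `V*` of a finite-dimensional Yetter--Drinfeld module over a
Hopf algebra with bijective antipode: `(h · f)(x) = f(S(h) · x)`, and
`f₍₋₁₎ f₍₀₎(x) = S⁻¹(x₍₋₁₎) f(x₍₀₎)` for all `x ∈ V`. -/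
noncomputable def dual : YetterDrinfeldModule k H (Module.Dual k V) where
  action := Y.dualAction
  coaction := dualCoactionOf (Y.dualPairing hS)
  coassoc f := by
    have e0 : ∀ y z : H ⊗[k] (H ⊗[k] Module.Dual k V),
        (TensorProduct.assoc k H H _).symm y = (TensorProduct.assoc k H H _).symm z → y = z :=
      fun y z h => (TensorProduct.assoc k H H _).symm.injective h
    apply e0
    rw [LinearEquiv.symm_apply_apply]
    apply eq_of_evalAt
    intro x
    have l : ∀ z : H ⊗[k] Module.Dual k V, evalAt x (comul.rTensor (Module.Dual k V) z) =
        comul (R := k) (evalAt x z) := by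
      intro z
      induction z with
      | zero => simp
      | add a b ha hb => simp only [map_add, ha, hb]
      | tmul a b => simp
    let E : H ⊗[k] Module.Dual k V →ₗ[k] (V →ₗ[k] H) :=
      dualTensorHom k V H ∘ₗ (TensorProduct.comm k H (Module.Dual k V)).toLinearMap
    have r1 : ∀ z : H ⊗[k] Module.Dual k V, evalAt x ((TensorProduct.assoc k H H _).symm
        ((dualCoactionOf (Y.dualPairing hS)).lTensor H z)) =
        TensorProduct.map LinearMap.id (antipodeInv hS)
          (TensorProduct.comm k H H ((E z).lTensor H (Y.coaction x))) := by
      intro z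
      induction z with
      | zero => simp
      | add a b ha hb => simp only [map_add, ha, hb, LinearMap.lTensor_add, LinearMap.add_apply]
      | tmul g p =>
        have a1 : ∀ z : H ⊗[k] Module.Dual k V,
            evalAt x ((TensorProduct.assoc k H H _).symm (g ⊗ₜ z)) = g ⊗ₜ[k] evalAt x z := by
          intro z
          induction z with
          | zero => simp
          | add a b ha hb => simp only [map_add, TensorProduct.tmul_add, ha, hb]
          | tmul a b => simp
        rw [LinearMap.lTensor_tmul, a1, evalAt_dualCoactionOf]
        simp only [dualPairing, LinearMap.coe_mk, AddHom.coe_mk, LinearMap.comp_apply]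
        induction Y.coaction x with
        | zero => simp
        | add a b ha hb => simp only [map_add, TensorProduct.tmul_add, ha, hb]
        | tmul a y => simp [E]
    have hE : E (dualCoactionOf (Y.dualPairing hS) f) =
        antipodeInv hS ∘ₗ evalFun f ∘ₗ Y.coaction := by
      have : ∀ (z : H ⊗[k] Module.Dual k V) (y : V), E z y = evalAt y z := by
        intro z y
        induction z with
        | zero => simp
        | add a b ha hb => simp only [map_add, LinearMap.add_apply, ha, hb]
        | tmul a b => simp [E]
      ext y
      rw [this, evalAt_dualCoactionOf]
      rfl
    have r2 : ∀ t : H ⊗[k] (H ⊗[k] V), (antipodeInv hS ∘ₗ evalFun f).lTensor H t =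
        (antipodeInv hS).lTensor H ((TensorProduct.rid k (H ⊗[k] H))
          (f.lTensor (H ⊗[k] H) ((TensorProduct.assoc k H H V).symm t))) := by
      intro t
      induction t with
      | zero => simp
      | add a b ha hb => simp only [map_add, ha, hb]
      | tmul a t =>
        induction t with
        | zero => simp
        | add a b ha hb => simp only [map_add, TensorProduct.tmul_add, ha, hb]
        | tmul b y => simp
    have r3 : ∀ t : H ⊗[k] V, TensorProduct.rid k (H ⊗[k] H)
        (f.lTensor (H ⊗[k] H) (comul.rTensor V t)) = comul (R := k) (evalFun f t) := by
      intro t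
      induction t with
      | zero => simp
      | add a b ha hb => simp only [map_add, ha, hb]
      | tmul a y => simp
    have r4 : (antipodeInv hS ∘ₗ evalFun f ∘ₗ Y.coaction).lTensor H (Y.coaction x) =
        (antipodeInv hS ∘ₗ evalFun f).lTensor H (Y.coaction.lTensor H (Y.coaction x)) := by
      rw [← LinearMap.comp_assoc, LinearMap.lTensor_comp]
      rfl
    have r5 : ∀ t : H ⊗[k] H, TensorProduct.map LinearMap.id (antipodeInv hS)
        (TensorProduct.comm k H H ((antipodeInv hS).lTensor H t)) =
        TensorProduct.map (antipodeInv hS) (antipodeInv hS) (TensorProduct.comm k H H t) := by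
      intro t
      induction t with
      | zero => simp
      | add a b ha hb => simp only [map_add, ha, hb]
      | tmul a y => simp
    rw [r1, l, evalAt_dualCoactionOf, hE, r4, r2, ← Y.coassoc, LinearEquiv.symm_apply_apply, r3]
    simp only [dualPairing, LinearMap.coe_mk, AddHom.coe_mk, LinearMap.comp_apply,
      comul_antipodeInv]
    exact (r5 _).symm
  counit_coaction f := by
    apply eq_of_evalAt
    intro x
    have l : ∀ z : H ⊗[k] Module.Dual k V, evalAt x (counit.rTensor (Module.Dual k V) z) =
        counit (R := k) (evalAt x z) := by
      intro z
      induction z with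
      | zero => simp
      | add a b ha hb => simp only [map_add, ha, hb]
      | tmul a b => simp
    rw [l, evalAt_dualCoactionOf, evalAt_tmul]
    have r : ∀ t : H ⊗[k] V, counit (R := k) (evalFun f t) =
      TensorProduct.lid k k (f.lTensor k (counit.rTensor V t)) := by
      intro z
      induction z with
      | zero => simp
      | add a b ha hb => simp only [map_add, ha, hb]
      | tmul a b => simp [mul_comm]
    simp [dualPairing, counit_antipodeInv, r, Y.counit_coaction]
  compat h f := by
    revert h
    rw [compat_iff]
    intro h
    apply eq_of_evalAt
    intro x
    apply hS.1
    have key := congrArg (evalFun f) (Y.diagAction_coaction (antipode k h) x)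
    have l : ∀ t : H ⊗[k] H, antipode k (evalAt x (TensorProduct.homTensorHomMap (RingHom.id k) _ _ _ _
        (TensorProduct.map (LinearMap.mul k H) Y.dualAction.toLinearMap t)
          (dualCoactionOf (Y.dualPairing hS) f))) =
        evalFun f ((LinearMap.mul' k H).rTensor V (TensorProduct.rightComm k H V H
          ((Y.coaction ∘ₗ Y.action.toLinearMap.flip x).rTensor H (TensorProduct.map (antipode k)
            (antipode k) (TensorProduct.comm k H H t))))) := by
      intro t
      induction t with
      | zero => simp
      | add a b ha hb => simp only [map_add, LinearMap.add_apply, ha, hb]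
      | tmul a b =>
        have h1 : ∀ z : H ⊗[k] Module.Dual k V, evalAt x (TensorProduct.map (LinearMap.mul k H a)
            (Y.dualAction b) z) = a * evalAt (Y.action (antipode k b) x) z := by
          intro z
          induction z with
          | zero => simp
          | add a b ha hb => simp only [map_add, mul_add, ha, hb]
          | tmul g p => simp
        have h2 : ∀ z : H ⊗[k] V, evalFun f z * antipode k a =
            evalFun f ((LinearMap.mul' k H).rTensor V (TensorProduct.rightComm k H V H
              (z ⊗ₜ antipode k a))) := by
          intro z
          induction z with
          | zero => simp
          | add a b ha hb => simp only [map_add, add_mul, TensorProduct.add_tmul, ha, hb]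
          | tmul g p => simp
        simp only [TensorProduct.map_tmul, TensorProduct.homTensorHomMap_apply,
          AlgHom.toLinearMap_apply, h1, evalAt_dualCoactionOf, TensorProduct.comm_tmul,
          LinearMap.rTensor_tmul, ← h2, HopfAlgebra.antipode_mul_antidistrib]
        simp [dualPairing]
    have r : ∀ t : H ⊗[k] H, antipode k (evalAt x ((LinearMap.mul' k H).rTensor _
        (TensorProduct.rightComm k H _ H ((dualCoactionOf (Y.dualPairing hS) ∘ₗ
          Y.dualAction.toLinearMap.flip f).rTensor H t)))) =
        evalFun f (TensorProduct.homTensorHomMap (RingHom.id k) _ _ _ _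
          (TensorProduct.map (LinearMap.mul k H) Y.action.toLinearMap (TensorProduct.map (antipode k)
            (antipode k) (TensorProduct.comm k H H t))) (Y.coaction x)) := by
      intro t
      induction t with
      | zero => simp
      | add a b ha hb => simp only [map_add, LinearMap.add_apply, ha, hb]
      | tmul a b =>
        have h1 : ∀ z : H ⊗[k] Module.Dual k V, evalAt x ((LinearMap.mul' k H).rTensor _
            (TensorProduct.rightComm k H _ H (z ⊗ₜ b))) = evalAt x z * b := by
          intro z
          induction z with
          | zero => simp
          | add a b ha hb => simp only [map_add, add_mul, TensorProduct.add_tmul, ha, hb]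
          | tmul g p => simp
        have h2 : ∀ z : H ⊗[k] V, antipode k b * evalFun (Y.dualAction a f) z =
            evalFun f (TensorProduct.map (LinearMap.mul k H (antipode k b))
              (Y.action (antipode k a)) z) := by
          intro z
          induction z with
          | zero => simp
          | add a b ha hb => simp only [map_add, mul_add, ha, hb]
          | tmul g p => simp
        simp only [TensorProduct.map_tmul, TensorProduct.homTensorHomMap_apply,
          AlgHom.toLinearMap_apply, h1, evalAt_dualCoactionOf, TensorProduct.comm_tmul,
          LinearMap.rTensor_tmul, ← h2, HopfAlgebra.antipode_mul_antidistrib,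
          LinearMap.comp_apply, LinearMap.flip_apply]
        simp [dualPairing]
    simp only [diagAction, rightTwist, LinearMap.comp_apply, comul_antipode] at key ⊢
    rw [l]
    exact key.symm.trans (r _).symm

/-- The subspace `V₂* ⊆ V*` belonging to a decomposition `V = V₁ ⊕ V₂`: the functionals on `V₂`
are extended by zero on `V₁`, that is, composed with the projection of `V` onto `V₂` along `V₁`. -/
noncomputable def complementDual {k : Type u} {V : Type w} [Field k] [AddCommGroup V] [Module k V]
    (V₁ V₂ : Submodule k V) (hV : IsCompl V₁ V₂) : Submodule k (Module.Dual k V) :=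
  LinearMap.range (V₂.projectionOnto V₁ hV.symm).dualMap

end DualModule

end YetterDrinfeldModule

/-! For a functional f on V, extended by zero to all degrees other than 1, let ∂_f = (id ⊗ f)Δ be
the corresponding skew derivation of B(V), and let K be the common kernel of all ∂_f with f in V₂*.
If Δ(x) lies in B(V) ⊗ D and the functionals in V₂* vanish on D, then x lies in K
(`nicholsDerivation_eq_zero`). The algebra ⟨V₁⟩ is a left coideal
(`isLeftCoidealSubalgebra_generated`), and the functionals, being derivations at the counit, vanish
on it because they vanish on V₁; so ⟨V₁⟩ ⊆ K. They also vanish on any x of degree at least 2, hence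
on ⟨V₁, x⟩. So an x that extends ⟨V₁⟩ in such a degree must lie in K, and it is enough to prove that
K and ⟨V₁⟩ agree in degrees at most N.

This is a dimension count. The words in V₂* act on B(V) by composites of skew derivations, and
composing with the counit gives a pairing of T(V*) with B(V). Right multiplication by a vector is
adjoint to splitting off the first letter of a word in V* (`counit_derivationAction_mul_ι`), so a
tensor of degree n that pairs to zero with B(V)(n) is killed by the braided symmetrizer of V*
(`omega_dual_eq_zero`). Therefore the pairing of T(V₂*)(j) with B(V)(j) has rank at least dim
⟨V₂*⟩(j), and there are that many u_a in T(V₂*)(j) and e_a in B(V)(j) dual to each other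
(`exists_dual_elements`).

Since V₂* is a subcomodule, the ∂_f with f in V₂* are left K-linear (`nicholsDerivation_mul`).
Applying the u_a then shows that the e_a, over all degrees j, are left linearly independent over K,
which yields ∑_j dim ⟨V₂*⟩(j) · dim K(≤ N − j) ≤ dim B(V)(≤ N)
(`sum_finrank_le_finrank_nicholsDegreeLE`). By hypothesis the right side is at most the dimension of
⟨V₁⟩ ⊗ ⟨V₂⟩ in degrees at most N, which is at most ∑_j dim ⟨V₂⟩(j) · dim ⟨V₁⟩(≤ N − j). As dim
⟨V₂⟩(j) = dim ⟨V₂*⟩(j) and ⟨V₁⟩ ⊆ K, the two sums agree term by term, and the term j = 0 gives K(≤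
N) = ⟨V₁⟩(≤ N). -/

namespace YetterDrinfeldModule

open Coalgebra HopfAlgebra

/-! ### Skew derivations of the tensor algebra. -/

section Derivation

variable {k : Type u} {H : Type v} {V : Type w} [Field k] [Ring H] [HopfAlgebra k H]
  [AddCommGroup V] [Module k V] (Y : YetterDrinfeldModule k H V)

/-- The point derivation of the tensor algebra that extends the functional `f` on `V` and vanishes
in all degrees other than `1`. -/
noncomputable def pointDerivation (f : Module.Dual k V) : TensorAlgebra k V →ₗ[k] k :=
  LinearMap.mul' k k ∘ₗ TensorProduct.map f TensorAlgebra.algebraMapInv.toLinearMap ∘ₗ uncons k V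

@[simp] lemma pointDerivation_one (f : Module.Dual k V) : pointDerivation f 1 = 0 := by
  simp [pointDerivation]

@[simp] lemma pointDerivation_ι_mul (f : Module.Dual k V) (v : V) (t : TensorAlgebra k V) :
    pointDerivation f (TensorAlgebra.ι k v * t) = f v * TensorAlgebra.algebraMapInv t := by
  simp [pointDerivation]

@[simp] lemma algebraMapInv_ι (v : V) :
    TensorAlgebra.algebraMapInv (TensorAlgebra.ι k v) = (0 : k) := by
  simp [TensorAlgebra.algebraMapInv]

lemma pointDerivation_ι (f : Module.Dual k V) (v : V) :
    pointDerivation f (TensorAlgebra.ι k v) = f v := by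
  have := pointDerivation_ι_mul f v 1
  simpa using this

/-- In degree 1 a product has only contributions from degrees (1, 0) and (0, 1). This rule lets
vanishing on generators pass to the generated subalgebra. -/
lemma pointDerivation_mul (f : Module.Dual k V) (s t : TensorAlgebra k V) :
    pointDerivation f (s * t) = pointDerivation f s * TensorAlgebra.algebraMapInv t +
      TensorAlgebra.algebraMapInv s * pointDerivation f t := by
  induction s using words_induction with
  | one => simp
  | add a b ha hb => simp only [add_mul, map_add, ha, hb]; ring
  | smul r a ha => simp only [Algebra.smul_mul_assoc, map_smul, ha, smul_eq_mul]; ring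
  | mul v a ha => rw [mul_assoc, pointDerivation_ι_mul]; simp [mul_assoc]

/-- The counit is right counital for the comultiplication of the tensor algebra. -/
lemma tensorComul_counit (t : TensorAlgebra k V) :
    (TensorAlgebra.algebraMapInv.toLinearMap).lTensor _ (Y.tensorComul t) = t ⊗ₜ[k] (1 : k) := by
  have h0 : TensorAlgebra.algebraMapInv.toLinearMap ∘ₗ cons k V = 0 := by ext v t; simp
  have h : ∀ v z, (TensorAlgebra.algebraMapInv.toLinearMap).lTensor _
      (Y.primitiveMul (v ⊗ₜ z)) = (LinearMap.mulLeft k (TensorAlgebra.ι k v)).rTensor k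
        ((TensorAlgebra.algebraMapInv.toLinearMap).lTensor _ z) := by
    intro v z
    simp only [primitiveMul, LinearMap.comp_apply, LinearMap.add_apply, map_add]
    -- The second summand of `primitiveMul` prepends a letter to the right leg, so the counit kills
    -- it and only v a ⊗ b survives.
    rw [← LinearMap.comp_apply (LinearMap.lTensor _ _) ((cons k V).lTensor _),
      ← LinearMap.lTensor_comp, h0, LinearMap.lTensor_zero, LinearMap.zero_apply, add_zero]
    induction z with
    | zero => simp
    | add a b ha hb => simp only [TensorProduct.tmul_add, map_add, ha, hb]
    | tmul a b => simp
  induction t using words_induction with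
  | one => simp [tensorComul]
  | add s t hs ht => simp only [map_add, hs, ht, TensorProduct.add_tmul]
  | smul r t ht => rw [map_smul, map_smul, ht, TensorProduct.smul_tmul']
  | mul v t ih =>
    have h1 : Y.tensorComul (TensorAlgebra.ι k v * t) = Y.primitiveMul (v ⊗ₜ Y.tensorComul t) := by
      simp [tensorComul]
    rw [h1, h, ih]
    simp

/-- The right skew derivation `∂_f = (id ⊗ f) Δ` of the tensor algebra. -/
noncomputable def skewDerivation : Module.Dual k V →ₗ[k] Module.End k (TensorAlgebra k V) where
  toFun f := (TensorProduct.rid k (TensorAlgebra k V)).toLinearMap ∘ₗ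
    (pointDerivation f).lTensor _ ∘ₗ Y.tensorComul
  map_add' f g := by
    have : pointDerivation (f + g) = pointDerivation f + pointDerivation g := by
      apply words_ext
      · simp
      · intro v t _; simp [add_mul]
    ext t
    simp [this, LinearMap.lTensor_add]
  map_smul' c f := by
    have : pointDerivation (c • f) = c • pointDerivation f := by
      apply words_ext
      · simp
      · intro v t _; simp [mul_assoc]
    ext t
    simp [this, LinearMap.lTensor_smul]

lemma skewDerivation_apply (f : Module.Dual k V) (t : TensorAlgebra k V) :
    Y.skewDerivation f t =
      TensorProduct.rid k _ ((pointDerivation f).lTensor _ (Y.tensorComul t)) := rfl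

@[simp] lemma skewDerivation_one (f : Module.Dual k V) : Y.skewDerivation f 1 = 0 := by
  simp [skewDerivation_apply, tensorComul]

/-- Multiply Δ(t) = ∑ a ⊗ b from the left by v ⊗ 1 + 1 ⊗ v. The first summand gives v ∂_f(t). In the
second, v₍₋₁₎ · a ⊗ v₍₀₎ b, the functional sees only f(v₍₀₎) ε(b), and counitality contracts ∑ a
ε(b) to t. -/
lemma skewDerivation_ι_mul (f : Module.Dual k V) (v : V) (t : TensorAlgebra k V) :
    Y.skewDerivation f (TensorAlgebra.ι k v * t) = TensorAlgebra.ι k v * Y.skewDerivation f t +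
      Y.tensorAction (evalFun f (Y.coaction v)) t := by
  have h1 : Y.tensorComul (TensorAlgebra.ι k v * t) = Y.primitiveMul (v ⊗ₜ Y.tensorComul t) := by
    simp [tensorComul]
  have h2 : ∀ z, TensorProduct.rid k _ ((pointDerivation f).lTensor _ (Y.primitiveMul (v ⊗ₜ z))) =
      TensorAlgebra.ι k v * TensorProduct.rid k _ ((pointDerivation f).lTensor _ z) +
        Y.tensorAction (evalFun f (Y.coaction v)) (TensorProduct.rid k _
          ((TensorAlgebra.algebraMapInv.toLinearMap).lTensor _ z)) := by
    intro z
    induction z with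
    | zero => simp
    | add a b ha hb => simp only [TensorProduct.tmul_add, map_add, mul_add, ha, hb]; abel
    | tmul a b =>
      simp only [primitiveMul, LinearMap.comp_apply, LinearMap.add_apply, LinearEquiv.coe_coe,
        TensorProduct.assoc_symm_tmul, map_add, LinearMap.rTensor_tmul, braiding_tmul]
      congr 1
      · simp
      · induction Y.coaction v with
        | zero => simp
        | add a b ha hb => simp only [TensorProduct.add_tmul, map_add, LinearMap.add_apply, ha, hb]
        | tmul g x => simp [mul_comm, smul_smul]
  rw [skewDerivation_apply, h1, h2, tensorComul_counit]
  simp [skewDerivation_apply]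

/-- The action of `H` on a product `t v` with `v` of degree one. -/
lemma tensorAction_mul_ι (h : H) (t : TensorAlgebra k V) (v : V) :
    Y.tensorAction h (t * TensorAlgebra.ι k v) = LinearMap.mul' k _ (TensorProduct.map
      (Y.tensorAction.flip t) (TensorAlgebra.ι k ∘ₗ Y.action.toLinearMap.flip v) (comul h)) := by
  have hc : ∀ (h : H) (w : V) (t : TensorAlgebra k V),
      Y.tensorAction h (TensorAlgebra.ι k w * t) = LinearMap.mul' k _ (TensorProduct.map
      (TensorAlgebra.ι k ∘ₗ Y.action.toLinearMap.flip w) (Y.tensorAction.flip t) (comul h)) := by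
    intro h w t
    have := LinearMap.congr_fun (Y.cons_equivariant h) (w ⊗ₜ t)
    simp only [LinearMap.comp_apply, cons_tmul, diagAction_tmul] at this
    rw [← this]
    induction (comul h : H ⊗[k] H) with
    | zero => simp
    | add a b ha hb => simp only [map_add, ha, hb]
    | tmul a b => simp
  induction t using words_induction generalizing h with
  | one =>
    have e := hc h v 1
    rw [mul_one] at e
    rw [one_mul, e]
    -- For the empty word both expansions collapse to h · v, by the two counit axioms of H.
    have l : ∀ z : H ⊗[k] H, LinearMap.mul' k _ (TensorProduct.map
      (TensorAlgebra.ι k ∘ₗ Y.action.toLinearMap.flip v) (Y.tensorAction.flip 1) z) =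
      TensorAlgebra.ι k (Y.action (TensorProduct.rid k H (counit.lTensor H z)) v) := by
      intro z
      induction z with
      | zero => simp
      | add a b ha hb => simp only [map_add, LinearMap.add_apply, ha, hb]
      | tmul a b =>
        simp [tensorAction_one, Algebra.algebraMap_eq_smul_one]
    have r : ∀ z : H ⊗[k] H, LinearMap.mul' k _ (TensorProduct.map
      (Y.tensorAction.flip 1) (TensorAlgebra.ι k ∘ₗ Y.action.toLinearMap.flip v) z) =
      TensorAlgebra.ι k (Y.action (TensorProduct.lid k H (counit.rTensor H z)) v) := by
      intro z
      induction z with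
      | zero => simp
      | add a b ha hb => simp only [map_add, LinearMap.add_apply, ha, hb]
      | tmul a b =>
        simp [tensorAction_one, Algebra.algebraMap_eq_smul_one]
    rw [l, r]
    simp
  | add s t hs ht => simp only [add_mul, map_add, hs, ht, TensorProduct.map_add_left,
      LinearMap.add_apply]
  | smul r t ht => simp only [Algebra.smul_mul_assoc, map_smul, ht, TensorProduct.map_smul_left,
      LinearMap.smul_apply]
  | mul w t ih =>
    rw [mul_assoc, hc]
    -- Both ways of expanding h · (w t v) are (h₍₁₎ · w)(h₍₂₎ · t)(h₍₃₎ · v); coassociativity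
    -- identifies them.
    have key := congrArg (LinearMap.mul' k _ ∘ₗ TensorProduct.map
      (TensorAlgebra.ι k ∘ₗ Y.action.toLinearMap.flip w) (LinearMap.mul' k _ ∘ₗ TensorProduct.map
      (Y.tensorAction.flip t) (TensorAlgebra.ι k ∘ₗ Y.action.toLinearMap.flip v)))
      (Coalgebra.coassoc_apply (R := k) h)
    have e1 : ∀ z : H ⊗[k] H, (LinearMap.mul' k _ ∘ₗ TensorProduct.map
      (TensorAlgebra.ι k ∘ₗ Y.action.toLinearMap.flip w) (LinearMap.mul' k _ ∘ₗ TensorProduct.map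
      (Y.tensorAction.flip t) (TensorAlgebra.ι k ∘ₗ Y.action.toLinearMap.flip v)))
      (comul.lTensor H z) = LinearMap.mul' k _ (TensorProduct.map
      (TensorAlgebra.ι k ∘ₗ Y.action.toLinearMap.flip w)
      (Y.tensorAction.flip (t * TensorAlgebra.ι k v)) z) := by
      intro z
      induction z with
      | zero => simp
      | add a b ha hb => simp only [map_add, ha, hb]
      | tmul a b => simp [ih]
    have e2 : ∀ z : H ⊗[k] H, (LinearMap.mul' k _ ∘ₗ TensorProduct.map
      (TensorAlgebra.ι k ∘ₗ Y.action.toLinearMap.flip w) (LinearMap.mul' k _ ∘ₗ TensorProduct.map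
      (Y.tensorAction.flip t) (TensorAlgebra.ι k ∘ₗ Y.action.toLinearMap.flip v)))
      (TensorProduct.assoc k H H H (comul.rTensor H z)) = LinearMap.mul' k _ (TensorProduct.map
      (Y.tensorAction.flip (TensorAlgebra.ι k w * t))
      (TensorAlgebra.ι k ∘ₗ Y.action.toLinearMap.flip v) z) := by
      intro z
      induction z with
      | zero => simp
      | add a b ha hb => simp only [map_add, ha, hb]
      | tmul a b =>
        simp only [LinearMap.rTensor_tmul, TensorProduct.map_tmul, LinearMap.mul'_apply,
          LinearMap.flip_apply, hc]
        induction (comul a : H ⊗[k] H) with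
        | zero => simp
        | add a b ha hb => simp only [map_add, TensorProduct.add_tmul, add_mul, ha, hb]
        | tmul a b => simp [mul_assoc]
    rw [← e1, ← key, e2]

end Derivation

/-! ### The Leibniz rule for right multiplication, in terms of the dual coaction. -/

section DualDerivation

variable {k : Type u} {H : Type v} {V : Type w} [Field k] [Ring H] [HopfAlgebra k H]
  [AddCommGroup V] [Module k V] (Y : YetterDrinfeldModule k H V)

/-- The contraction of an element of `H ⊗ V` with functionals on `V`. -/
noncomputable def contraction (z : H ⊗[k] V) : Module.Dual k V →ₗ[k] H where
  toFun f := evalFun f z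
  map_add' f g := by simp [evalFun, LinearMap.lTensor_add]
  map_smul' c f := by simp [evalFun, LinearMap.lTensor_smul]

@[simp] lemma contraction_apply (z : H ⊗[k] V) (f : Module.Dual k V) :
    contraction z f = evalFun f z := rfl

/-- The linear map `g ⊗ f ↦ F(f) · (S(g) · v)`. -/
noncomputable def twistedMul (F : Module.Dual k V →ₗ[k] TensorAlgebra k V) (v : V) :
    H ⊗[k] Module.Dual k V →ₗ[k] TensorAlgebra k V :=
  LinearMap.mul' k _ ∘ₗ (TensorProduct.comm k _ _).toLinearMap ∘ₗ TensorProduct.map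
    (TensorAlgebra.ι k ∘ₗ Y.action.toLinearMap.flip v ∘ₗ antipode k) F

@[simp] lemma twistedMul_tmul (F : Module.Dual k V →ₗ[k] TensorAlgebra k V) (v : V) (g : H)
    (f : Module.Dual k V) : Y.twistedMul F v (g ⊗ₜ f) =
      F f * TensorAlgebra.ι k (Y.action (antipode k g) v) := by
  simp [twistedMul]

variable [Module.Finite k V] (hS : Function.Bijective (antipode k : H → H))

/-- Elements of H ⊗ V* are compared by evaluating at vectors; this is the defining formula of the
dual coaction in that form. -/
lemma evalAt_dual_coaction (f : Module.Dual k V) (v : V) :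
    evalAt v ((Y.dual hS).coaction f) = antipodeInv hS (evalFun f (Y.coaction v)) :=
  evalAt_dualCoactionOf _ f v

/-- `f(w₍₀₎) w₍₋₂₎ ⊗ w₍₋₁₎ = f₍₀₎(w₍₀₎) w₍₋₁₎ ⊗ S(f₍₋₁₎)`. -/
lemma comul_evalFun (f : Module.Dual k V) (w : V) :
    comul (R := k) (evalFun f (Y.coaction w)) = TensorProduct.comm k H H (TensorProduct.map
      (antipode k) (contraction (Y.coaction w)) ((Y.dual hS).coaction f)) := by
  let E : H ⊗[k] Module.Dual k V →ₗ[k] (V →ₗ[k] H) :=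
    dualTensorHom k V H ∘ₗ (TensorProduct.comm k H (Module.Dual k V)).toLinearMap
  have hE : ∀ (z : H ⊗[k] Module.Dual k V) (y : V), E z y = evalAt y z := by
    intro z y
    induction z with
    | zero => simp
    | add a b ha hb => simp only [map_add, LinearMap.add_apply, ha, hb]
    | tmul a b => simp [E]
  have h1 : ∀ (z : H ⊗[k] Module.Dual k V) (y : H ⊗[k] V), TensorProduct.comm k H H
      (TensorProduct.map (antipode k) (contraction y) z) = (antipode k ∘ₗ E z).lTensor H y := by
    intro z y
    induction z with
    | zero => simp
    | add a b ha hb => simp only [map_add, LinearMap.comp_add, LinearMap.lTensor_add,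
        LinearMap.add_apply, ha, hb]
    | tmul g p =>
      induction y with
      | zero => simp
      | add a b ha hb =>
        simp only [TensorProduct.map_tmul, TensorProduct.comm_tmul, contraction_apply,
          map_add, TensorProduct.add_tmul] at ha hb ⊢
        rw [ha, hb]
      | tmul a x => simp [E]
  -- The antipode cancels the S⁻¹ of the dual coaction: S(f₍₋₁₎) f₍₀₎(v) = v₍₋₁₎ f(v₍₀₎). With
  -- coassociativity of the coaction of V this gives the claim.
  have h2 : antipode k ∘ₗ E ((Y.dual hS).coaction f) = evalFun f ∘ₗ Y.coaction := by
    ext v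
    simp [hE, evalAt_dual_coaction]
  have h3 : ∀ z : H ⊗[k] V, (evalFun f).lTensor H (TensorProduct.assoc k H H V
      (comul.rTensor V z)) = comul (R := k) (evalFun f z) := by
    intro z
    induction z with
    | zero => simp
    | add a b ha hb => simp only [map_add, ha, hb]
    | tmul a x =>
      simp only [LinearMap.rTensor_tmul, evalFun_tmul, map_smul]
      induction (comul a : H ⊗[k] H) with
      | zero => simp
      | add a b ha hb => simp only [TensorProduct.add_tmul, map_add, smul_add, ha, hb]
      | tmul a b => simp
  rw [h1, h2, LinearMap.lTensor_comp, LinearMap.comp_apply, ← Y.coassoc, h3]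

/-- `∂_f(t v) = f(v) t + ∂_{f₍₀₎}(t) (S(f₍₋₁₎) · v)` for `v` of degree one. -/
lemma skewDerivation_mul_ι (f : Module.Dual k V) (t : TensorAlgebra k V) (v : V) :
    Y.skewDerivation f (t * TensorAlgebra.ι k v) =
      f v • t + Y.twistedMul (Y.skewDerivation.flip t) v ((Y.dual hS).coaction f) := by
  induction t using words_induction with
  | one =>
    have h0 : Y.skewDerivation.flip 1 = 0 := by ext; simp
    have h1 : ∀ z : H ⊗[k] V, counit (R := k) (evalFun f z) =
        TensorProduct.lid k k (f.lTensor k (counit.rTensor V z)) := by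
      intro z
      induction z with
      | zero => simp
      | add a b ha hb => simp only [map_add, ha, hb]
      | tmul a b => simp [mul_comm]
    have h2 := Y.skewDerivation_ι_mul f v 1
    rw [mul_one] at h2
    rw [one_mul, h2, h0, tensorAction_one, h1, Y.counit_coaction]
    simp [twistedMul, Algebra.algebraMap_eq_smul_one]
  | add s t hs ht =>
    simp only [add_mul, map_add, hs, ht, smul_add, twistedMul, TensorProduct.map_add_right,
      LinearMap.comp_add, LinearMap.add_apply]
    abel
  | smul r t ht =>
    simp only [Algebra.smul_mul_assoc, map_smul, ht, smul_add, twistedMul,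
      TensorProduct.map_smul_right, LinearMap.comp_smul, LinearMap.smul_apply]
    rw [smul_comm]
  | mul w t ih =>
    -- The element f(w₍₀₎) w₍₋₁₎ acts on t v through its coproduct, which `comul_evalFun` rewrites
    -- so that S(f₍₋₁₎) acts on v and the rest, belonging to f₍₀₎, acts on t. Together with w
    -- ∂_{f₍₀₎}(t) this assembles to ∂_{f₍₀₎}(w t) in front of S(f₍₋₁₎) · v.
    rw [mul_assoc, skewDerivation_ι_mul, ih, tensorAction_mul_ι, comul_evalFun Y hS]
    have h1 : ∀ z : H ⊗[k] Module.Dual k V,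
        Y.twistedMul (Y.skewDerivation.flip (TensorAlgebra.ι k w * t)) v z =
        TensorAlgebra.ι k w * Y.twistedMul (Y.skewDerivation.flip t) v z +
        LinearMap.mul' k _ (TensorProduct.map (Y.tensorAction.flip t)
          (TensorAlgebra.ι k ∘ₗ Y.action.toLinearMap.flip v) (TensorProduct.comm k H H
            (TensorProduct.map (antipode k) (contraction (Y.coaction w)) z))) := by
      intro z
      induction z with
      | zero => simp
      | add a b ha hb => simp only [map_add, mul_add, ha, hb]; abel
      | tmul g p => simp [skewDerivation_ι_mul, add_mul, mul_assoc]
    rw [h1, mul_add]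
    simp [add_assoc]

end DualDerivation

/-! ### Counit, point derivations and skew derivations on the Nichols algebra. -/

section Pairing

variable {k : Type u} {H : Type v} {V : Type w} [Field k] [Ring H] [HopfAlgebra k H]
  [AddCommGroup V] [Module k V] (Y : YetterDrinfeldModule k H V)

lemma omega_zero_eq_algebraMap (c : V ⊗[k] V →ₗ[k] V ⊗[k] V) : omega c 0 =
    Algebra.linearMap k (TensorAlgebra k V) ∘ₗ TensorAlgebra.algebraMapInv.toLinearMap := by
  rw [omega_zero]
  apply words_ext
  · simp [degreeProj_one]
  · intro v t _; simp [degreeProj_zero_mul]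

/-- Writing the counit as a map that factors through S₀ makes its vanishing on the radical
immediate. -/
lemma algebraMapInv_comp_omega_zero (c : V ⊗[k] V →ₗ[k] V ⊗[k] V) :
    TensorAlgebra.algebraMapInv.toLinearMap ∘ₗ omega c 0 =
      TensorAlgebra.algebraMapInv.toLinearMap := by
  rw [omega_zero_eq_algebraMap]
  ext t
  simp

lemma nicholsMk_eq_zero {t : TensorAlgebra k V} (ht : t ∈ radical Y.braid) : Y.nicholsMk t = 0 :=
  Ideal.Quotient.eq_zero_iff_mem.2 (Y.mem_nicholsIdeal.2 ht)

lemma nicholsMk_eq_zero_iff {t : TensorAlgebra k V} :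
    Y.nicholsMk t = 0 ↔ t ∈ radical Y.braid :=
  ⟨fun h => Y.mem_nicholsIdeal.1 (Ideal.Quotient.eq_zero_iff_mem.1 h), Y.nicholsMk_eq_zero⟩

lemma nicholsMk_surjective : Function.Surjective Y.nicholsMk := Ideal.Quotient.mkₐ_surjective k _

/-- The linear map on the Nichols algebra induced by a linear map on the tensor algebra that
vanishes on `⊕ₙ ker Sₙ`. -/
noncomputable def nicholsLift {P : Type*} [AddCommGroup P] [Module k P]
    (F : TensorAlgebra k V →ₗ[k] P) (hF : ∀ t ∈ radical Y.braid, F t = 0) :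
    Y.NicholsAlgebra →ₗ[k] P :=
  (Y.nicholsIdeal.restrictScalars k).liftQ F (fun t ht => hF t (Y.mem_nicholsIdeal.1 ht)) ∘ₗ
    (Submodule.Quotient.restrictScalarsEquiv k Y.nicholsIdeal).symm.toLinearMap

/-- The counit of the Nichols algebra. -/
noncomputable def nicholsCounit : Y.NicholsAlgebra →ₐ[k] k :=
  Ideal.Quotient.liftₐ Y.nicholsIdeal TensorAlgebra.algebraMapInv <| by
    intro t ht
    have h := LinearMap.congr_fun (algebraMapInv_comp_omega_zero Y.braid) t
    rw [LinearMap.comp_apply, (mem_radical _).1 (Y.mem_nicholsIdeal.1 ht) 0, map_zero] at h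
    exact h.symm

@[simp] lemma nicholsCounit_mk (t : TensorAlgebra k V) :
    Y.nicholsCounit (Y.nicholsMk t) = TensorAlgebra.algebraMapInv t := rfl

/-- The functional equals (f ⊗ ε) after `firstComponent`: each term from `slide` has a nonempty word
in its second leg and is killed by ε. Since ε factors through S₀, `omega_firstComponent` applies. -/
lemma pointDerivation_radical (c : V ⊗[k] V →ₗ[k] V ⊗[k] V) (f : Module.Dual k V)
    {t : TensorAlgebra k V} (ht : t ∈ radical c) : pointDerivation f t = 0 := by
  have h0 : TensorAlgebra.algebraMapInv.toLinearMap ∘ₗ cons k V = 0 := by ext v t; simp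
  have h1 : ∀ y, (TensorAlgebra.algebraMapInv.toLinearMap).lTensor V (slide c y) = 0 := by
    intro y
    rw [slide, LinearMap.comp_apply, ← LinearMap.comp_apply, ← LinearMap.lTensor_comp, h0]
    simp
  have h2 : pointDerivation f = LinearMap.mul' k k ∘ₗ f.rTensor k ∘ₗ
      (TensorAlgebra.algebraMapInv.toLinearMap).lTensor V ∘ₗ firstComponent c := by
    apply words_ext
    · simp [firstComponent]
    · intro v t _
      simp [firstComponent, h1]
  rw [h2, ← algebraMapInv_comp_omega_zero c, LinearMap.lTensor_comp]
  simp [omega_firstComponent c ht]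

/-- The point derivation of the Nichols algebra that extends a functional on `V`. -/
noncomputable def nicholsPointDerivation (f : Module.Dual k V) : Y.NicholsAlgebra →ₗ[k] k :=
  Y.nicholsLift (pointDerivation f) fun _ ht => pointDerivation_radical _ f ht

@[simp] lemma nicholsPointDerivation_mk (f : Module.Dual k V) (t : TensorAlgebra k V) :
    Y.nicholsPointDerivation f (Y.nicholsMk t) = pointDerivation f t := rfl

lemma nicholsPointDerivation_mul (f : Module.Dual k V) (x y : Y.NicholsAlgebra) :
    Y.nicholsPointDerivation f (x * y) = Y.nicholsPointDerivation f x * Y.nicholsCounit y +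
      Y.nicholsCounit x * Y.nicholsPointDerivation f y := by
  obtain ⟨s, rfl⟩ := Y.nicholsMk_surjective x
  obtain ⟨t, rfl⟩ := Y.nicholsMk_surjective y
  rw [← map_mul]
  simp only [nicholsPointDerivation_mk, nicholsCounit_mk, pointDerivation_mul]

/-- Shows that ∂_f descends from the tensor algebra, so linearity in f can be checked on
representatives. -/
lemma rid_nicholsComul_mk (f : Module.Dual k V) (t : TensorAlgebra k V) :
    TensorProduct.rid k _ ((Y.nicholsPointDerivation f).lTensor _ (Y.nicholsComul (Y.nicholsMk t)))
      = Y.nicholsMk (Y.skewDerivation f t) := by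
  rw [nicholsComul_mk, skewDerivation_apply]
  induction Y.tensorComul t with
  | zero => simp
  | add a b ha hb => simp only [map_add, ha, hb]
  | tmul a b => simp [-Ideal.Quotient.mkₐ_eq_mk]

/-- The right skew derivation `∂_f = (id ⊗ f) Δ` of the Nichols algebra. -/
noncomputable def nicholsDerivation : Module.Dual k V →ₗ[k] Module.End k Y.NicholsAlgebra where
  toFun f := (TensorProduct.rid k _).toLinearMap ∘ₗ (Y.nicholsPointDerivation f).lTensor _ ∘ₗ
    Y.nicholsComul
  map_add' f g := by
    refine LinearMap.ext fun x => ?_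
    obtain ⟨t, rfl⟩ := Y.nicholsMk_surjective x
    refine (Y.rid_nicholsComul_mk _ t).trans ?_
    rw [map_add, LinearMap.add_apply, map_add]
    exact (congrArg₂ _ (Y.rid_nicholsComul_mk f t) (Y.rid_nicholsComul_mk g t)).symm
  map_smul' c f := by
    refine LinearMap.ext fun x => ?_
    obtain ⟨t, rfl⟩ := Y.nicholsMk_surjective x
    refine (Y.rid_nicholsComul_mk _ t).trans ?_
    rw [map_smul, LinearMap.smul_apply, map_smul]
    exact (congrArg (c • ·) (Y.rid_nicholsComul_mk f t)).symm

lemma nicholsDerivation_apply (f : Module.Dual k V) (x : Y.NicholsAlgebra) :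
    Y.nicholsDerivation f x = TensorProduct.rid k _
      ((Y.nicholsPointDerivation f).lTensor _ (Y.nicholsComul x)) := rfl

@[simp] lemma nicholsDerivation_mk (f : Module.Dual k V) (t : TensorAlgebra k V) :
    Y.nicholsDerivation f (Y.nicholsMk t) = Y.nicholsMk (Y.skewDerivation f t) :=
  Y.rid_nicholsComul_mk f t

/-- The right action of `T(V*)` on the Nichols algebra by skew derivations. -/
noncomputable def derivationAction :
    TensorAlgebra k (Module.Dual k V) →ₗ[k] Module.End k Y.NicholsAlgebra :=
  (MulOpposite.opLinearEquiv k).symm.toLinearMap ∘ₗ (TensorAlgebra.lift k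
    ((MulOpposite.opLinearEquiv k).toLinearMap ∘ₗ Y.nicholsDerivation)).toLinearMap

@[simp] lemma derivationAction_one : Y.derivationAction 1 = 1 := by simp [derivationAction]

@[simp] lemma derivationAction_ι (f : Module.Dual k V) :
    Y.derivationAction (TensorAlgebra.ι k f) = Y.nicholsDerivation f := by
  simp [derivationAction]

/-- The left factor acts first. This order is what lets the first letter of a word in V* meet the
last letter of a word in V. -/
lemma derivationAction_mul (s t : TensorAlgebra k (Module.Dual k V)) :
    Y.derivationAction (s * t) = Y.derivationAction t * Y.derivationAction s := by
  simp [derivationAction]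

/-! ### The pairing of T(V*) with B(V) and its radical. -/

variable [Module.Finite k V] (hS : Function.Bijective (antipode k : H → H))

/-- Left contraction of `T(V*)` with vectors: `u ↦ (v ↦ (ev_v ⊗ id) Δ_{1,n-1}(u))`. -/
noncomputable def leftContraction :
    TensorAlgebra k (Module.Dual k V) →ₗ[k] V →ₗ[k] TensorAlgebra k (Module.Dual k V) :=
  dualTensorHom k V (TensorAlgebra k (Module.Dual k V)) ∘ₗ firstComponent (Y.dual hS).braid

/-- Braiding f past the first letter q of a tensor leaves f₍₋₁₎ · q in front, whose value at v is
q(S(f₍₋₁₎) · v). The resulting recursion has the same shape as `skewDerivation_mul_ι`, and this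
match is the source of the adjunction below. -/
lemma leftContraction_ι_mul (f : Module.Dual k V) (t : TensorAlgebra k (Module.Dual k V)) (v : V) :
    Y.leftContraction hS (TensorAlgebra.ι k f * t) v = f v • t +
      LinearMap.mul' k _ (TensorProduct.comm k _ _ (TensorProduct.map
        (Y.leftContraction hS t ∘ₗ Y.action.toLinearMap.flip v ∘ₗ antipode k) (TensorAlgebra.ι k)
          ((Y.dual hS).coaction f))) := by
  have h : ∀ y,
      dualTensorHom k V (TensorAlgebra k (Module.Dual k V)) (slide (Y.dual hS).braid (f ⊗ₜ y)) v =
      LinearMap.mul' k _ (TensorProduct.comm k _ _ (TensorProduct.map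
        (dualTensorHom k V (TensorAlgebra k (Module.Dual k V)) y ∘ₗ
          Y.action.toLinearMap.flip v ∘ₗ antipode k) (TensorAlgebra.ι k)
        ((Y.dual hS).coaction f))) := by
    intro y
    induction y with
    | zero => simp
    | add a b ha hb => simp only [TensorProduct.tmul_add, map_add, LinearMap.add_apply,
        LinearMap.add_comp, TensorProduct.map_add_left, ha, hb]
    | tmul q s =>
      simp only [slide, LinearMap.comp_apply, LinearEquiv.coe_coe, TensorProduct.assoc_symm_tmul,
        LinearMap.rTensor_tmul, braid, braiding_tmul]
      induction (Y.dual hS).coaction f with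
      | zero => simp
      | add a b ha hb => simp only [TensorProduct.add_tmul, map_add, LinearMap.add_apply, ha, hb]
      | tmul g p =>
        have : (Y.dual hS).action g q v = q (Y.action (antipode k g) v) := rfl
        simp [this]
  rw [leftContraction, LinearMap.comp_apply, LinearMap.comp_apply, firstComponent, peel_mul,
    map_add, LinearMap.add_apply, h]
  simp

/-- Right multiplication by `v` is adjoint to left contraction with `v`. -/
lemma counit_derivationAction_mul_ι (u : TensorAlgebra k (Module.Dual k V)) (v : V)
    (x : TensorAlgebra k V) :
    Y.nicholsCounit (Y.derivationAction u (Y.nicholsMk (x * TensorAlgebra.ι k v))) =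
      Y.nicholsCounit (Y.derivationAction (Y.leftContraction hS u v) (Y.nicholsMk x)) := by
  induction u using words_induction generalizing x v with
  | one => simp [leftContraction, firstComponent, -Ideal.Quotient.mkₐ_eq_mk]
  | add s t hs ht => simp only [map_add, LinearMap.add_apply, hs, ht]
  | smul r t ht => simp only [map_smul, LinearMap.smul_apply, ht]
  | mul f t ih =>
    -- After ∂_f the new last letter is S(f₍₋₁₎) · v and the new left factor is ∂_{f₍₀₎}(x), so the
    -- induction hypothesis is needed for other vectors and other x.
    rw [derivationAction_mul, derivationAction_ι, Module.End.mul_apply, nicholsDerivation_mk,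
      Y.skewDerivation_mul_ι hS, leftContraction_ι_mul]
    simp only [map_add, map_smul, LinearMap.add_apply, LinearMap.smul_apply]
    congr 1
    induction (Y.dual hS).coaction f with
    | zero => simp
    | add a b ha hb => simp only [map_add, LinearMap.add_apply, ha, hb]
    | tmul g p =>
      simp only [twistedMul_tmul, LinearMap.flip_apply, ih, TensorProduct.map_tmul,
        TensorProduct.comm_tmul, LinearMap.mul'_apply, derivationAction_mul, derivationAction_ι,
        Module.End.mul_apply, nicholsDerivation_mk, LinearMap.comp_apply,
        AlgHom.toLinearMap_apply]

/-- An element of `T(V*)` that annihilates `V^{⊗ n}` under the pairing given by skew derivations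
has degree `n` part in the kernel of the braided symmetrizer. -/
lemma omega_dual_eq_zero (n : ℕ) (u : TensorAlgebra k (Module.Dual k V))
    (hu : ∀ x ∈ tensorDegree k V n,
      Y.nicholsCounit (Y.derivationAction u (Y.nicholsMk x)) = 0) :
    omega (Y.dual hS).braid n u = 0 := by
  induction n generalizing u with
  | zero =>
    have h1 := hu 1 (by simp)
    -- Every ∂_f kills 1, so pairing with 1 reads off the scalar part of u.
    have h2 : ∀ u : TensorAlgebra k (Module.Dual k V), Y.nicholsCounit (Y.derivationAction u
        (Y.nicholsMk 1)) = TensorAlgebra.algebraMapInv u := by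
      intro u
      induction u using words_induction with
      | one => simp [-Ideal.Quotient.mkₐ_eq_mk]
      | add s t hs ht => simp only [map_add, LinearMap.add_apply, hs, ht]
      | smul r t ht => simp only [map_smul, LinearMap.smul_apply, ht]
      | mul f t _ =>
        rw [derivationAction_mul, derivationAction_ι, Module.End.mul_apply, nicholsDerivation_mk]
        simp
    rw [h2] at h1
    rw [omega_zero_eq_algebraMap]
    simp [h1]
  | succ n ih =>
    rw [omega_succ]
    -- By `omega_succ` the symmetrizer of degree n + 1 factors through `firstComponent` and the one
    -- of degree n. Vanishing in V* ⊗ T(V*) is tested by evaluating the first leg at each v, which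
    -- produces the left contraction of u with v.
    have h : (omega (Y.dual hS).braid n).lTensor _ (firstComponent (Y.dual hS).braid u) = 0 := by
      apply (TensorProduct.comm k _ _).injective
      rw [map_zero]
      apply eq_of_evalAt
      intro v
      have e : ∀ y : Module.Dual k V ⊗[k] TensorAlgebra k (Module.Dual k V),
          evalAt v (TensorProduct.comm k _ _
          ((omega (Y.dual hS).braid n).lTensor (Module.Dual k V) y)) =
          omega (Y.dual hS).braid n
            (dualTensorHom k V (TensorAlgebra k (Module.Dual k V)) y v) := by
        intro y
        induction y with
        | zero => simp
        | add a b ha hb => simp only [map_add, LinearMap.add_apply, ha, hb]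
        | tmul => simp
      rw [e, map_zero]
      -- The contraction of u with v annihilates degree n because, by adjointness, its value at x is
      -- the value of u at x v, of degree n + 1.
      apply ih
      intro x hx
      have := Y.counit_derivationAction_mul_ι hS u v x
      rw [leftContraction, LinearMap.comp_apply] at this
      rw [← this]
      apply hu
      rw [tensorDegree, pow_succ]
      exact Submodule.mul_mem_mul hx ⟨v, rfl⟩
    rw [h, map_zero]

end Pairing

/-! ### The grading of the Nichols algebra and the degree behaviour of point derivations. -/

section Grading

variable {k : Type u} {H : Type v} {V : Type w} [Field k] [Ring H] [HopfAlgebra k H]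
  [AddCommGroup V] [Module k V] (Y : YetterDrinfeldModule k H V)

lemma degreeProj_of_mem {n : ℕ} {t : TensorAlgebra k V} (ht : t ∈ tensorDegree k V n) :
    degreeProj k V n t = t := by
  rw [degreeProj, GradedAlgebra.proj_apply]
  exact DirectSum.decompose_of_mem_same _ ht

lemma degreeProj_of_mem_ne {m n : ℕ} {t : TensorAlgebra k V} (ht : t ∈ tensorDegree k V n)
    (h : n ≠ m) : degreeProj k V m t = 0 := by
  rw [degreeProj, GradedAlgebra.proj_apply]
  exact DirectSum.decompose_of_mem_ne _ ht h

lemma degreeProj_mem (n : ℕ) (t : TensorAlgebra k V) :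
    degreeProj k V n t ∈ tensorDegree k V n := by
  rw [degreeProj, GradedAlgebra.proj_apply]
  exact SetLike.coe_mem _

lemma iSup_tensorDegree : ⨆ n, tensorDegree k V n = ⊤ :=
  (DirectSum.Decomposition.isInternal (tensorDegree k V)).submodule_iSup_eq_top

/-- Each condition defining the radical sees only one homogeneous component, so the radical is
graded and the projections descend to B(V). -/
lemma degreeProj_radical (c : V ⊗[k] V →ₗ[k] V ⊗[k] V) (n : ℕ) {t : TensorAlgebra k V}
    (ht : t ∈ radical c) : degreeProj k V n t ∈ radical c := by
  rw [mem_radical]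
  intro m
  by_cases h : n = m
  · subst h
    rw [omega, LinearMap.comp_apply, degreeProj_idem]
    exact (mem_radical c).1 ht n
  · rw [omega, LinearMap.comp_apply, degreeProj_of_mem_ne (degreeProj_mem n t) h, map_zero]

/-- The projection of the Nichols algebra onto its degree `n` part. -/
noncomputable def nicholsProj (n : ℕ) : Module.End k Y.NicholsAlgebra :=
  Y.nicholsLift (Y.nicholsMk.toLinearMap ∘ₗ degreeProj k V n) fun _ ht =>
    Y.nicholsMk_eq_zero (degreeProj_radical _ n ht)

lemma nicholsProj_mk (n : ℕ) (t : TensorAlgebra k V) :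
    Y.nicholsProj n (Y.nicholsMk t) = Y.nicholsMk (degreeProj k V n t) := rfl

lemma nicholsProj_of_mem {n : ℕ} {x : Y.NicholsAlgebra} (hx : x ∈ Y.nicholsDegree n) :
    Y.nicholsProj n x = x := by
  obtain ⟨t, ht, rfl⟩ := hx
  exact congrArg Y.nicholsMk (degreeProj_of_mem ht)

instance [Module.Finite k V] (n : ℕ) : Module.Finite k (Y.nicholsDegree n) := by
  rw [Module.Finite.iff_fg]
  refine Submodule.FG.map _ (Submodule.FG.pow ?_ n)
  rw [← Module.Finite.iff_fg]
  infer_instance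

/-- Used to recover from the counit the scalar that is left when a word of degree j acts on an
element of degree j. -/
lemma eq_algebraMap_of_mem_nicholsDegree_zero {x : Y.NicholsAlgebra}
    (hx : x ∈ Y.nicholsDegree 0) : x = algebraMap k _ (Y.nicholsCounit x) := by
  obtain ⟨t, ht, rfl⟩ := hx
  rw [tensorDegree, pow_zero] at ht
  obtain ⟨r, rfl⟩ := Submodule.mem_one.1 ht
  have h : Y.nicholsMk (algebraMap k _ r) = algebraMap k _ r := AlgHom.commutes _ r
  rw [AlgHom.toLinearMap_apply, h, AlgHom.commutes]
  rfl

lemma pointDerivation_of_mem (f : Module.Dual k V) {n : ℕ} (hn : 2 ≤ n) {t : TensorAlgebra k V}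
    (ht : t ∈ tensorDegree k V n) : pointDerivation f t = 0 := by
  obtain ⟨n, rfl⟩ := Nat.exists_eq_add_of_le hn
  have h : ∀ s ∈ tensorDegree k V (n + 1), TensorAlgebra.algebraMapInv s = (0 : k) := by
    intro s hs
    rw [tensorDegree, pow_succ'] at hs
    induction hs using Submodule.mul_induction_on' with
    | mem_mul_mem a ha b hb => obtain ⟨v, rfl⟩ := ha; simp
    | add a _ b _ ha hb => rw [map_add, ha, hb, add_zero]
  rw [tensorDegree, show 2 + n = n + 1 + 1 by ring, pow_succ'] at ht
  induction ht using Submodule.mul_induction_on' with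
  | mem_mul_mem a ha b hb => obtain ⟨v, rfl⟩ := ha; simp [h b hb]
  | add a _ b _ ha hb => rw [map_add, ha, hb, add_zero]

/-- The reason why adjoining an element of degree at least 2 cannot spoil the vanishing of a
functional on the subalgebra. -/
lemma nicholsPointDerivation_of_mem (f : Module.Dual k V) {n : ℕ} (hn : 2 ≤ n)
    {x : Y.NicholsAlgebra} (hx : x ∈ Y.nicholsDegree n) : Y.nicholsPointDerivation f x = 0 := by
  obtain ⟨t, ht, rfl⟩ := hx
  exact pointDerivation_of_mem f hn ht

/-- The zero set of a derivation at the counit contains 1 and is closed under products. -/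
lemma nicholsPointDerivation_adjoin (f : Module.Dual k V) (s : Set Y.NicholsAlgebra)
    (hs : ∀ x ∈ s, Y.nicholsPointDerivation f x = 0) {x : Y.NicholsAlgebra}
    (hx : x ∈ Algebra.adjoin k s) : Y.nicholsPointDerivation f x = 0 := by
  induction hx using Algebra.adjoin_induction with
  | mem x hx => exact hs x hx
  | algebraMap r =>
    rw [Algebra.algebraMap_eq_smul_one, map_smul]
    have : Y.nicholsPointDerivation f (Y.nicholsMk 1) = 0 := by
      rw [nicholsPointDerivation_mk, pointDerivation_one]
    rw [map_one] at this
    rw [this, smul_zero]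
  | add x y _ _ hx hy => rw [map_add, hx, hy, add_zero]
  | mul x y _ _ hx hy => rw [nicholsPointDerivation_mul, hx, hy]; simp

/-- If `Δ(x) ∈ B(V) ⊗ D` and the point derivation of `f` vanishes on `D`, then `∂_f(x) = 0`. -/
lemma nicholsDerivation_eq_zero (f : Module.Dual k V) (D : Submodule k Y.NicholsAlgebra)
    (hD : ∀ x ∈ D, Y.nicholsPointDerivation f x = 0) {x : Y.NicholsAlgebra}
    (hx : Y.nicholsComul x ∈ LinearMap.range (D.subtype.lTensor Y.NicholsAlgebra)) :
    Y.nicholsDerivation f x = 0 := by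
  obtain ⟨z, hz⟩ := hx
  rw [nicholsDerivation_apply, ← hz, ← LinearMap.comp_apply, ← LinearMap.lTensor_comp]
  have : Y.nicholsPointDerivation f ∘ₗ D.subtype = 0 := by
    ext x
    exact hD x x.2
  rw [this]
  simp

/-! ### Subalgebras generated by subspaces of V. -/

/-- The algebra map `T(W) → T(V)` for a subspace `W` of `V`. -/
noncomputable def wordMap (W : Submodule k V) : TensorAlgebra k W →ₐ[k] TensorAlgebra k V :=
  TensorAlgebra.lift k (TensorAlgebra.ι k ∘ₗ W.subtype)

@[simp] lemma wordMap_ι (W : Submodule k V) (w : W) :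
    wordMap W (TensorAlgebra.ι k w) = TensorAlgebra.ι k (w : V) := by
  simp [wordMap]

lemma wordMap_mem (W : Submodule k V) {n : ℕ} {t : TensorAlgebra k W}
    (ht : t ∈ tensorDegree k W n) : wordMap W t ∈ tensorDegree k V n := by
  have h : (LinearMap.range (TensorAlgebra.ι k : W →ₗ[k] _)).map (wordMap W).toLinearMap ≤
      LinearMap.range (TensorAlgebra.ι k : V →ₗ[k] _) := by
    rintro _ ⟨_, ⟨w, rfl⟩, rfl⟩
    exact ⟨w, by simp⟩
  have h2 := pow_le_pow_left' h n
  rw [← Submodule.map_pow] at h2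
  exact h2 ⟨t, ht, rfl⟩

/-- Representing elements by tensors over W makes degrees, coaction and comultiplication accessible
to induction on words with letters in W. -/
lemma generated_eq_range (W : Submodule k V) :
    Y.generated W = (Y.nicholsMk.comp (wordMap W)).range := by
  apply le_antisymm
  · refine Algebra.adjoin_le ?_
    rintro _ ⟨w, hw, rfl⟩
    exact ⟨TensorAlgebra.ι k ⟨w, hw⟩, congrArg Y.nicholsMk (wordMap_ι W ⟨w, hw⟩)⟩
  · rintro _ ⟨t, rfl⟩
    change Y.nicholsMk.comp (wordMap W) t ∈ Y.generated W
    induction t using words_induction with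
    | one => rw [map_one]; exact one_mem _
    | add s t hs ht => rw [map_add]; exact add_mem hs ht
    | smul r t ht => rw [map_smul]; exact Subalgebra.smul_mem _ ht r
    | mul w t ht =>
      rw [map_mul]
      refine mul_mem (Algebra.subset_adjoin ⟨w, w.2, ?_⟩) ht
      rw [AlgHom.comp_apply, wordMap_ι]
      rfl

lemma mem_generated_iff (W : Submodule k V) (x : Y.NicholsAlgebra) :
    x ∈ Y.generated W ↔ ∃ t, Y.nicholsMk (wordMap W t) = x := by
  rw [generated_eq_range]
  rfl

/-- Every homogeneous element of `⟨W⟩` is represented by a homogeneous tensor over `W`. -/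
lemma exists_homogeneous_of_mem_generated (W : Submodule k V) {n : ℕ} {x : Y.NicholsAlgebra}
    (hx : x ∈ Y.generated W) (hn : x ∈ Y.nicholsDegree n) :
    ∃ t ∈ tensorDegree k W n, Y.nicholsMk (wordMap W t) = x := by
  obtain ⟨t, rfl⟩ := (Y.mem_generated_iff W x).1 hx
  refine ⟨degreeProj k W n t, degreeProj_mem n t, ?_⟩
  -- Since `wordMap` preserves degrees, projecting commutes with it, and the degree n component of
  -- an arbitrary representative still represents x.
  rw [← Y.nicholsProj_of_mem hn, nicholsProj_mk]
  have ht : t ∈ ⨆ n, tensorDegree k W n := by rw [iSup_tensorDegree]; trivial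
  clear hx hn
  congr 1
  induction ht using Submodule.iSup_induction' with
  | mem m t ht =>
    by_cases h : m = n
    · subst h
      rw [degreeProj_of_mem ht, degreeProj_of_mem (wordMap_mem W ht)]
    · rw [degreeProj_of_mem_ne ht h, degreeProj_of_mem_ne (wordMap_mem W ht) h, map_zero]
  | zero => simp
  | add s t _ _ hs ht => simp only [map_add, hs, ht]

lemma generated_graded (W : Submodule k V) : Subalgebra.toSubmodule (Y.generated W) =
    ⨆ n, Subalgebra.toSubmodule (Y.generated W) ⊓ Y.nicholsDegree n := by
  apply le_antisymm
  · intro x hx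
    obtain ⟨t, rfl⟩ := (Y.mem_generated_iff W x).1 hx
    clear hx
    have ht : t ∈ ⨆ n, tensorDegree k W n := by rw [iSup_tensorDegree]; trivial
    induction ht using Submodule.iSup_induction' with
    | mem m t ht =>
      exact Submodule.mem_iSup_of_mem m
        ⟨(Y.mem_generated_iff W _).2 ⟨t, rfl⟩, ⟨_, wordMap_mem W ht, rfl⟩⟩
    | zero => rw [map_zero, map_zero]; exact zero_mem _
    | add s t _ _ hs ht => rw [map_add, map_add]; exact add_mem hs ht
  · exact iSup_le fun n => inf_le_left

/-- For a letter w of W, the product with w ⊗ 1 + 1 ⊗ w puts into the right leg at most a letter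
w₍₀₎, which is in W again. The action of w₍₋₁₎ affects only the left leg; W need not be stable under
H, so that leg ranges over all of T(V). -/
lemma tensorComul_wordMap_mem {W : Submodule k V} (hW : Y.IsSubcomodule W) (t : TensorAlgebra k W) :
    Y.tensorComul (wordMap W t) ∈
      LinearMap.range ((wordMap W).toLinearMap.lTensor (TensorAlgebra k V)) := by
  induction t using words_induction with
  | one => exact ⟨1 ⊗ₜ 1, by simp [tensorComul]⟩
  | add s t hs ht => rw [map_add, map_add]; exact add_mem hs ht
  | smul r t ht => rw [map_smul, map_smul]; exact Submodule.smul_mem _ r ht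
  | mul w t ht =>
    obtain ⟨z, hz⟩ := ht
    have h1 : Y.tensorComul (wordMap W (TensorAlgebra.ι k w * t)) =
        Y.primitiveMul (w ⊗ₜ Y.tensorComul (wordMap W t)) := by
      simp [tensorComul]
    rw [h1, ← hz]
    clear hz h1
    induction z with
    | zero => simp
    | add a b ha hb => rw [map_add, TensorProduct.tmul_add, map_add]; exact add_mem ha hb
    | tmul a b =>
      obtain ⟨y, hy⟩ := hW ⟨w, w.2, rfl⟩
      simp only [primitiveMul, LinearMap.comp_apply, LinearMap.add_apply, LinearEquiv.coe_coe,
        LinearMap.lTensor_tmul, TensorProduct.assoc_symm_tmul, LinearMap.rTensor_tmul,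
        braiding_tmul, cons_tmul, ← hy]
      refine add_mem ⟨(TensorAlgebra.ι k (w : V) * a) ⊗ₜ b, by simp⟩ ?_
      clear hy
      induction y with
      | zero => simp
      | add a b ha hb => simp only [TensorProduct.add_tmul, map_add]; exact add_mem ha hb
      | tmul g x => exact ⟨Y.tensorAction g a ⊗ₜ (TensorAlgebra.ι k x * b), by simp⟩

lemma tensorCoaction_wordMap_mem {W : Submodule k V} (hW : Y.IsSubcomodule W)
    (t : TensorAlgebra k W) : Y.tensorCoaction (wordMap W t) ∈
      LinearMap.range ((wordMap W).toLinearMap.lTensor H) := by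
  -- Seen as the range of an algebra map, H ⊗ T(W) is closed under products, so it is enough to
  -- treat single letters.
  have h : ∀ z, z ∈ LinearMap.range ((wordMap W).toLinearMap.lTensor H) ↔
      z ∈ (Algebra.TensorProduct.map (AlgHom.id k H) (wordMap W)).range := fun z => Iff.rfl
  induction t using words_induction with
  | one => rw [h, map_one, map_one]; exact one_mem _
  | add s t hs ht => rw [map_add, map_add]; exact add_mem hs ht
  | smul r t ht => rw [map_smul, map_smul]; exact Submodule.smul_mem _ r ht
  | mul w t ht =>
    rw [h] at ht ⊢
    rw [map_mul, map_mul]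
    refine mul_mem ?_ ht
    obtain ⟨y, hy⟩ := hW ⟨w, w.2, rfl⟩
    rw [wordMap_ι, tensorCoaction, TensorAlgebra.lift_ι_apply, LinearMap.comp_apply, ← hy, ← h]
    clear hy
    induction y with
    | zero => simp
    | add a b ha hb => simp only [map_add]; exact add_mem ha hb
    | tmul g x => exact ⟨g ⊗ₜ TensorAlgebra.ι k x, by simp⟩

/-- The subalgebra generated by a subcomodule of `V` is a left coideal subalgebra. -/
lemma isLeftCoidealSubalgebra_generated {W : Submodule k V} (hW : Y.IsSubcomodule W) :
    Y.IsLeftCoidealSubalgebra (Y.generated W) where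
  graded := Y.generated_graded W
  subcomodule := by
    rintro _ ⟨x, hx, rfl⟩
    obtain ⟨t, rfl⟩ := (Y.mem_generated_iff W x).1 hx
    obtain ⟨z, hz⟩ := Y.tensorCoaction_wordMap_mem hW t
    rw [AlgHom.toLinearMap_apply, nicholsCoaction_mk, ← hz]
    clear hz hx
    induction z with
    | zero => simp
    | add a b ha hb => simp only [map_add]; exact add_mem ha hb
    | tmul g s => exact ⟨g ⊗ₜ ⟨_, (Y.mem_generated_iff W _).2 ⟨s, rfl⟩⟩, rfl⟩
  leftCoideal := by
    rintro _ ⟨x, hx, rfl⟩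
    obtain ⟨t, rfl⟩ := (Y.mem_generated_iff W x).1 hx
    obtain ⟨z, hz⟩ := Y.tensorComul_wordMap_mem hW t
    rw [nicholsComul_mk, ← hz]
    clear hz hx
    induction z with
    | zero => simp
    | add a b ha hb => simp only [map_add]; exact add_mem ha hb
    | tmul g s => exact ⟨Y.nicholsMk g ⊗ₜ ⟨_, (Y.mem_generated_iff W _).2 ⟨s, rfl⟩⟩, rfl⟩

end Grading

/-! ### Linear algebra: ranks of pairings and dimension bounds. -/

section Dimension

variable {k : Type*} {U E : Type*} [Field k] [AddCommGroup U] [Module k U] [AddCommGroup E]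
  [Module k E]

/-- A pairing of rank `r` with a finite-dimensional space admits dual families of length `r`. -/
lemma exists_dual_families [Module.Finite k U] [Module.Finite k E] (P : U →ₗ[k] Module.Dual k E) :
    ∃ (u : Fin (Module.finrank k (U ⧸ LinearMap.ker P)) → U)
      (e : Fin (Module.finrank k (U ⧸ LinearMap.ker P)) → E),
      ∀ a b, P (u a) (e b) = if a = b then 1 else 0 := by
  let β := Module.finBasis k (U ⧸ LinearMap.ker P)
  let Q : U ⧸ LinearMap.ker P →ₗ[k] Module.Dual k E := (LinearMap.ker P).liftQ P le_rfl
  have hQ : Function.Injective Q :=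
    LinearMap.ker_eq_bot.1 (Submodule.ker_liftQ_eq_bot _ _ _ le_rfl)
  -- U / ker P embeds into E*, so every functional on it extends to E* and is, E being
  -- finite-dimensional, evaluation at a vector of E. Applied to the coordinates of a basis this
  -- gives the dual family.
  have hs := LinearMap.dualMap_surjective_of_injective hQ
  have hu : ∀ a, ∃ u, Submodule.Quotient.mk u = β a := fun a => Submodule.Quotient.mk_surjective _ _
  have he : ∀ b, ∃ e : E, ∀ q, Q q e = β.coord b q := by
    intro b
    obtain ⟨ψ, hψ⟩ := hs (β.coord b)
    obtain ⟨e, rfl⟩ := (Module.evalEquiv k E).surjective ψ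
    exact ⟨e, fun φ => by rw [← hψ]; rfl⟩
  choose u hu using hu
  choose e he using he
  refine ⟨u, e, fun a b => ?_⟩
  have h : P (u a) = Q (β a) := by rw [← hu]; rfl
  rw [h, he, Module.Basis.coord_apply, Module.Basis.repr_self, Finsupp.single_apply]

/-- Bounds the rank of P from below: any quotient of U in which the kernel of P dies is a quotient
of U / ker P. -/
lemma finrank_le_finrank_quotient_ker {E' : Type*} [AddCommGroup E'] [Module k E']
    [Module.Finite k U] (P : U →ₗ[k] E) (Q : U →ₗ[k] E') (hQ : Function.Surjective Q)
    (h : LinearMap.ker P ≤ LinearMap.ker Q) :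
    Module.finrank k E' ≤ Module.finrank k (U ⧸ LinearMap.ker P) := by
  refine LinearMap.finrank_le_finrank_of_surjective (f := (LinearMap.ker P).liftQ Q h) fun y => ?_
  obtain ⟨u, rfl⟩ := hQ y
  exact ⟨Submodule.Quotient.mk u, rfl⟩

lemma finrank_biSup_le {ι : Type*} (s : Finset ι) (p : ι → Submodule k E)
    (hp : ∀ i ∈ s, Module.Finite k (p i)) :
    Module.finrank k ↥(⨆ i ∈ s, p i) ≤ ∑ i ∈ s, Module.finrank k (p i) := by
  classical
  have hf : ∀ s' ⊆ s, Module.Finite k ↥(⨆ i ∈ s', p i) := fun s' hs' =>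
    Module.Finite.iff_fg.2 (Submodule.fg_biSup _ _ fun i hi =>
      Module.Finite.iff_fg.1 (hp i (hs' hi)))
  induction s using Finset.induction_on with
  | empty =>
    have : (⨆ i ∈ (∅ : Finset ι), p i) = ⊥ := by simp
    rw [this, finrank_bot]; exact Nat.zero_le _
  | insert a s ha ih =>
    rw [Finset.iSup_insert, Finset.sum_insert ha]
    have h1 := ih (fun i hi => hp i (Finset.mem_insert_of_mem hi))
      (fun s' hs' => hf s' (hs'.trans (Finset.subset_insert a s)))
    have h2 := hp a (Finset.mem_insert_self a s)
    have h3 := hf s (Finset.subset_insert a s)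
    exact (Submodule.finrank_add_le_finrank_add_finrank _ _).trans (Nat.add_le_add_left h1 _)

lemma map₂_mk_le_range {E' : Type*} [AddCommGroup E'] [Module k E'] (p : Submodule k E)
    (q : Submodule k E') : Submodule.map₂ (TensorProduct.mk k E E') p q ≤
      LinearMap.range (TensorProduct.map p.subtype q.subtype) :=
  Submodule.map₂_le.2 fun x hx y hy => ⟨(⟨x, hx⟩ : p) ⊗ₜ (⟨y, hy⟩ : q), rfl⟩

lemma finite_map₂_mk {E' : Type*} [AddCommGroup E'] [Module k E'] (p : Submodule k E)
    (q : Submodule k E') [Module.Finite k p] [Module.Finite k q] :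
    Module.Finite k (Submodule.map₂ (TensorProduct.mk k E E') p q) :=
  Submodule.finiteDimensional_of_le (map₂_mk_le_range p q)

lemma finrank_map₂_mk_le {E' : Type*} [AddCommGroup E'] [Module k E'] (p : Submodule k E)
    (q : Submodule k E') [Module.Finite k p] [Module.Finite k q] :
    Module.finrank k (Submodule.map₂ (TensorProduct.mk k E E') p q) ≤
      Module.finrank k p * Module.finrank k q := by
  refine (Submodule.finrank_mono (map₂_mk_le_range p q)).trans ?_
  rw [← Module.finrank_tensorProduct]
  exact LinearMap.finrank_range_le _

end Dimension

/-! ### The common kernel K of skew derivations and linearity over it. -/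

section Invariants

variable {k : Type u} {H : Type v} {V : Type w} [Field k] [Ring H] [HopfAlgebra k H]
  [AddCommGroup V] [Module k V] (Y : YetterDrinfeldModule k H V)

/-- The rule `skewDerivation_mul_ι` strips the last letter, so the induction has to append letters
on the right. -/
lemma words_induction_right {P : TensorAlgebra k V → Prop} (one : P 1)
    (add : ∀ s t, P s → P t → P (s + t)) (smul : ∀ (r : k) t, P t → P (r • t))
    (mul : ∀ t v, P t → P (t * TensorAlgebra.ι k v)) (t : TensorAlgebra k V) : P t := by
  have key : ∀ s, P s → P (s * t) := by
    induction t using TensorAlgebra.induction with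
    | algebraMap r =>
      intro s hs
      rw [← Algebra.commutes, ← Algebra.smul_def]
      exact smul r s hs
    | ι v => intro s hs; exact mul s v hs
    | add a b ha hb => intro s hs; rw [mul_add]; exact add _ _ (ha s hs) (hb s hs)
    | mul a b ha hb => intro s hs; rw [← mul_assoc]; exact hb _ (ha s hs)
  simpa using key 1 one

/-- The common kernel of the skew derivations `∂_f` with `f` in `W`. -/
noncomputable def derivationInvariants (W : Submodule k (Module.Dual k V)) :
    Submodule k Y.NicholsAlgebra :=
  ⨅ f : W, LinearMap.ker (Y.nicholsDerivation f)

lemma mem_derivationInvariants {W : Submodule k (Module.Dual k V)} {x : Y.NicholsAlgebra} :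
    x ∈ Y.derivationInvariants W ↔ ∀ f ∈ W, Y.nicholsDerivation f x = 0 := by
  simp [derivationInvariants]

/-- The elements of degree at most `n` in the Nichols algebra. -/
noncomputable def nicholsDegreeLE (n : ℕ) : Submodule k Y.NicholsAlgebra :=
  ⨆ i ∈ Finset.range (n + 1), Y.nicholsDegree i

lemma nicholsDegree_le_nicholsDegreeLE {i n : ℕ} (h : i ≤ n) :
    Y.nicholsDegree i ≤ Y.nicholsDegreeLE n :=
  le_iSup₂_of_le (f := fun i (_ : i ∈ Finset.range (n + 1)) => Y.nicholsDegree i) i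
    (Finset.mem_range.2 (Nat.lt_succ_of_le h)) le_rfl

instance [Module.Finite k V] (n : ℕ) : Module.Finite k (Y.nicholsDegreeLE n) :=
  Module.Finite.iff_fg.2 (Submodule.fg_biSup _ _ fun _ _ => Module.Finite.iff_fg.1 inferInstance)

lemma nicholsDegree_mul_mem {m n : ℕ} {x y : Y.NicholsAlgebra} (hx : x ∈ Y.nicholsDegree m)
    (hy : y ∈ Y.nicholsDegree n) : x * y ∈ Y.nicholsDegree (m + n) := by
  obtain ⟨s, hs, rfl⟩ := hx
  obtain ⟨t, ht, rfl⟩ := hy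
  refine ⟨s * t, ?_, map_mul Y.nicholsMk s t⟩
  rw [tensorDegree, pow_add]
  exact Submodule.mul_mem_mul hs ht

lemma nicholsDegreeLE_mul_mem {m n N : ℕ} (h : m + n ≤ N) {x y : Y.NicholsAlgebra}
    (hx : x ∈ Y.nicholsDegreeLE m) (hy : y ∈ Y.nicholsDegree n) : x * y ∈ Y.nicholsDegreeLE N := by
  have : Y.nicholsDegreeLE m ≤ (Y.nicholsDegreeLE N).comap (LinearMap.mulRight k y) := by
    refine iSup₂_le fun i hi x hx => ?_
    have hi' := Finset.mem_range.1 hi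
    exact Y.nicholsDegree_le_nicholsDegreeLE (by omega) (Y.nicholsDegree_mul_mem hx hy)
  exact this hx

variable [Module.Finite k V]

/-- ∂_f lowers the degree by one. The two clauses separate degree 0, where it is zero, and so avoid
a truncated n − 1. -/
lemma skewDerivation_mem (hS : Function.Bijective (antipode k : H → H))
    (f : Module.Dual k V) {n : ℕ} {t : TensorAlgebra k V}
    (ht : t ∈ tensorDegree k V n) : (n = 0 → Y.skewDerivation f t = 0) ∧
      ∀ m, n = m + 1 → Y.skewDerivation f t ∈ tensorDegree k V m := by
  induction n generalizing f t with
  | zero =>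
    refine ⟨fun _ => ?_, fun m hm => by omega⟩
    rw [tensorDegree, pow_zero] at ht
    obtain ⟨r, rfl⟩ := Submodule.mem_one.1 ht
    rw [Algebra.algebraMap_eq_smul_one, map_smul, skewDerivation_one, smul_zero]
  | succ n ih =>
    refine ⟨fun h => by omega, fun m hm => ?_⟩
    obtain rfl : n = m := by omega
    rw [tensorDegree, pow_succ] at ht
    induction ht using Submodule.mul_induction_on' with
    | mem_mul_mem a ha b hb =>
      obtain ⟨v, rfl⟩ := hb
      -- In the right Leibniz rule H acts on a single letter only, so no statement on degrees of the
      -- action on T(V) is needed.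
      rw [Y.skewDerivation_mul_ι hS]
      refine add_mem (Submodule.smul_mem _ _ ha) ?_
      induction (Y.dual hS).coaction f with
      | zero => simp
      | add a b ha hb => rw [map_add]; exact add_mem ha hb
      | tmul g p =>
        rw [twistedMul_tmul, LinearMap.flip_apply]
        cases n with
        | zero => rw [(ih p ha).1 rfl, zero_mul]; exact zero_mem _
        | succ n =>
          rw [tensorDegree, pow_succ]
          exact Submodule.mul_mem_mul ((ih p ha).2 n rfl) ⟨_, rfl⟩
    | add a _ b _ ha hb => rw [map_add]; exact add_mem ha hb

/-- A word of degree j lowers degrees by j. Only m ≤ j matters: in the triangular argument, terms of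
larger degree have a coefficient already known to vanish. -/
lemma derivationAction_mem (hS : Function.Bijective (antipode k : H → H))
    {j : ℕ} {u : TensorAlgebra k (Module.Dual k V)}
    (hu : u ∈ tensorDegree k (Module.Dual k V) j) {m : ℕ} {x : Y.NicholsAlgebra}
    (hx : x ∈ Y.nicholsDegree m) : (m < j → Y.derivationAction u x = 0) ∧
      (m = j → Y.derivationAction u x ∈ Y.nicholsDegree 0) := by
  induction j generalizing u m x with
  | zero =>
    refine ⟨fun h => by omega, ?_⟩
    rintro rfl
    rw [tensorDegree, pow_zero] at hu
    obtain ⟨r, rfl⟩ := Submodule.mem_one.1 hu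
    rw [Algebra.algebraMap_eq_smul_one, map_smul, derivationAction_one]
    exact Submodule.smul_mem _ _ hx
  | succ j ih =>
    rw [tensorDegree, pow_succ'] at hu
    induction hu using Submodule.mul_induction_on' with
    | mem_mul_mem a ha b hb =>
      obtain ⟨f, rfl⟩ := ha
      obtain ⟨t, ht, rfl⟩ := hx
      rw [derivationAction_mul, derivationAction_ι, Module.End.mul_apply,
        AlgHom.toLinearMap_apply, nicholsDerivation_mk]
      cases m with
      | zero =>
        refine ⟨fun _ => ?_, fun h => by omega⟩
        rw [(Y.skewDerivation_mem hS f ht).1 rfl, map_zero, map_zero]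
      | succ m =>
        have := ih hb ⟨_, (Y.skewDerivation_mem hS f ht).2 m rfl, rfl⟩
        exact ⟨fun h => this.1 (by omega), fun h => this.2 (by omega)⟩
    | add a _ b _ ha hb =>
      rw [map_add, LinearMap.add_apply]
      exact ⟨fun h => by rw [ha.1 h, hb.1 h, add_zero], fun h => add_mem (ha.2 h) (hb.2 h)⟩

/-- The skew derivations `∂_f` with `f` in a subcomodule `W` of `V*` are left linear over their
common kernel. -/
lemma nicholsDerivation_mul (hS : Function.Bijective (antipode k : H → H))
    {W : Submodule k (Module.Dual k V)} (hW : (Y.dual hS).IsSubcomodule W)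
    {c : Y.NicholsAlgebra} (hc : c ∈ Y.derivationInvariants W) {f : Module.Dual k V} (hf : f ∈ W)
    (y : Y.NicholsAlgebra) : Y.nicholsDerivation f (c * y) = c * Y.nicholsDerivation f y := by
  rw [mem_derivationInvariants] at hc
  obtain ⟨t, rfl⟩ := Y.nicholsMk_surjective y
  obtain ⟨s, rfl⟩ := Y.nicholsMk_surjective c
  induction t using words_induction_right generalizing f with
  | one => rw [nicholsDerivation_mk _ _ 1, skewDerivation_one, map_one, mul_one, hc f hf, map_zero,
      mul_zero]
  | add a b ha hb => rw [map_add, mul_add, map_add, ha hf, hb hf, map_add, mul_add]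
  | smul r a ha => rw [map_smul, mul_smul_comm, map_smul, ha hf, map_smul, mul_smul_comm]
  | mul t v ih =>
    -- The right Leibniz rule for s t v involves ∂_{f₍₀₎}(s t), and f₍₀₎ stays in the subcomodule W,
    -- so the induction hypothesis, stated for all functionals of W, applies.
    obtain ⟨z, hz⟩ := hW ⟨f, hf, rfl⟩
    have h : ∀ z : H ⊗[k] W,
        Y.nicholsMk (Y.twistedMul (Y.skewDerivation.flip (s * t)) v (W.subtype.lTensor H z)) =
        Y.nicholsMk s *
          Y.nicholsMk (Y.twistedMul (Y.skewDerivation.flip t) v (W.subtype.lTensor H z)) := by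
      intro z
      induction z with
      | zero => simp only [map_zero, mul_zero]
      | add a b ha hb => simp only [map_add, mul_add, ha, hb]
      | tmul g p =>
        have := ih p.2
        rw [← map_mul, nicholsDerivation_mk, nicholsDerivation_mk] at this
        rw [LinearMap.lTensor_tmul, twistedMul_tmul, twistedMul_tmul, LinearMap.flip_apply,
          LinearMap.flip_apply, map_mul Y.nicholsMk, map_mul Y.nicholsMk, Submodule.subtype_apply,
          this, mul_assoc]
    rw [← map_mul, ← mul_assoc, nicholsDerivation_mk, nicholsDerivation_mk,
      Y.skewDerivation_mul_ι hS, Y.skewDerivation_mul_ι hS, ← hz, map_add, h, map_add, mul_add,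
      map_smul, map_smul, map_mul, mul_smul_comm]

lemma derivationAction_wordMap_mul (hS : Function.Bijective (antipode k : H → H))
    {W : Submodule k (Module.Dual k V)}
    (hW : (Y.dual hS).IsSubcomodule W) {c : Y.NicholsAlgebra}
    (hc : c ∈ Y.derivationInvariants W) (u : TensorAlgebra k W) (y : Y.NicholsAlgebra) :
    Y.derivationAction (wordMap W u) (c * y) = c * Y.derivationAction (wordMap W u) y := by
  induction u using words_induction (V := W) generalizing y with
  | one => rw [map_one, derivationAction_one]; rfl
  | add a b ha hb => simp only [map_add, LinearMap.add_apply, mul_add, ha, hb]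
  | smul r a ha => simp only [map_smul, LinearMap.smul_apply, mul_smul_comm, ha]
  | mul f t ih =>
    rw [map_mul (wordMap W), wordMap_ι, derivationAction_mul, derivationAction_ι,
      Module.End.mul_apply, Module.End.mul_apply, Y.nicholsDerivation_mul hS hW hc f.2, ih]

end Invariants

/-! ### Dual families and the two dimension estimates. -/

section Counting

variable {k : Type u} {H : Type v} {V : Type w} [Field k] [Ring H] [HopfAlgebra k H]
  [AddCommGroup V] [Module k V] (Y : YetterDrinfeldModule k H V)

lemma complementDual_apply {V₁ V₂ : Submodule k V} (hV : IsCompl V₁ V₂) {f : Module.Dual k V}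
    (hf : f ∈ complementDual V₁ V₂ hV) {v : V} (hv : v ∈ V₁) : f v = 0 := by
  obtain ⟨g, rfl⟩ := hf
  rw [LinearMap.dualMap_apply, (Submodule.projectionOnto_apply_eq_zero_iff hV.symm).2 hv, map_zero]

lemma nicholsPointDerivation_generated {W : Submodule k V} {f : Module.Dual k V}
    (hf : ∀ v ∈ W, f v = 0) : ∀ x ∈ Y.generated W, Y.nicholsPointDerivation f x = 0 := by
  intro x hx
  refine Y.nicholsPointDerivation_adjoin f _ ?_ hx
  rintro _ ⟨v, hv, rfl⟩
  exact (pointDerivation_ι f v).trans (hf v hv)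

variable [Module.Finite k V]

instance (W : Submodule k V) (n : ℕ) : Module.Finite k (tensorDegree k W n) := by
  rw [Module.Finite.iff_fg]
  refine Submodule.FG.pow ?_ n
  rw [← Module.Finite.iff_fg]
  infer_instance

instance finite_degreePart (C : Subalgebra k Y.NicholsAlgebra) (n : ℕ) :
    Module.Finite k (Y.degreePart C n) :=
  Module.Finite.of_injective
    (C.val.toLinearMap.restrict (p := Y.degreePart C n) (q := Y.nicholsDegree n) fun _ hx => hx)
    fun _ _ h => Subtype.ext (Subtype.ext (congrArg (Y.nicholsDegree n).subtype h))

/-- Homogeneous elements of `T(W)` and of the Nichols algebra that are dual to each other under the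
pairing given by skew derivations; their number is at least the dimension of `⟨W⟩(j)`. -/
lemma exists_dual_elements (hS : Function.Bijective (antipode k : H → H))
    (W : Submodule k (Module.Dual k V)) (j : ℕ) :
    ∃ r, Module.finrank k ((Y.dual hS).degreePart ((Y.dual hS).generated W) j) ≤ r ∧
      ∃ (u : Fin r → TensorAlgebra k W) (e : Fin r → Y.NicholsAlgebra),
        (∀ a, u a ∈ tensorDegree k W j) ∧ (∀ a, e a ∈ Y.nicholsDegree j) ∧
        ∀ a b, Y.nicholsCounit (Y.derivationAction (wordMap W (u a)) (e b)) =
          if a = b then 1 else 0 := by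
  let P : tensorDegree k W j →ₗ[k] Module.Dual k (Y.nicholsDegree j) :=
    LinearMap.mk₂ k (fun u x => Y.nicholsCounit (Y.derivationAction (wordMap W u) x))
      (by intro a b x; simp only [Submodule.coe_add, map_add, LinearMap.add_apply])
      (by intro r a x; simp only [Submodule.coe_smul, map_smul, LinearMap.smul_apply])
      (by intro a b x; simp only [Submodule.coe_add, map_add])
      (by intro r a x; simp only [Submodule.coe_smul, map_smul])
  let Q : tensorDegree k W j →ₗ[k] (Y.dual hS).degreePart ((Y.dual hS).generated W) j :=
    { toFun u := ⟨⟨(Y.dual hS).nicholsMk (wordMap W u),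
          ((Y.dual hS).mem_generated_iff W _).2 ⟨u, rfl⟩⟩, ⟨_, wordMap_mem W u.2, rfl⟩⟩
      map_add' a b := by
        refine Subtype.ext (Subtype.ext ?_)
        change (Y.dual hS).nicholsMk (wordMap W (a + b)) = _
        rw [map_add, map_add]
        rfl
      map_smul' r a := by
        refine Subtype.ext (Subtype.ext ?_)
        change (Y.dual hS).nicholsMk (wordMap W (r • a)) = _
        rw [map_smul, map_smul]
        rfl }
  have hQ : Function.Surjective Q := by
    rintro ⟨⟨x, hx⟩, hx'⟩
    obtain ⟨t, ht, h⟩ := (Y.dual hS).exists_homogeneous_of_mem_generated W hx hx'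
    exact ⟨⟨t, ht⟩, Subtype.ext (Subtype.ext h)⟩
  -- A tensor over W in the kernel of the pairing is killed by the symmetrizer of V*, hence is zero
  -- in B(V*). So the rank of P is at least dim ⟨W⟩(j). The dual elements are found in B(V)(j), with
  -- no further restriction on where they lie.
  have hPQ : LinearMap.ker P ≤ LinearMap.ker Q := by
    intro u hu
    refine Subtype.ext (Subtype.ext ?_)
    change (Y.dual hS).nicholsMk (wordMap W u) = 0
    rw [nicholsMk_eq_zero_iff, mem_radical]
    intro m
    -- u is homogeneous of degree j, so only the symmetrizer of that degree needs an argument.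
    by_cases hm : j = m
    · subst hm
      apply Y.omega_dual_eq_zero hS
      intro x hx
      exact LinearMap.congr_fun (LinearMap.mem_ker.1 hu) ⟨_, ⟨x, hx, rfl⟩⟩
    · rw [omega, LinearMap.comp_apply, degreeProj_of_mem_ne (wordMap_mem W u.2) hm, map_zero]
  obtain ⟨u, e, h⟩ := exists_dual_families P
  exact ⟨_, finrank_le_finrank_quotient_ker P Q hQ hPQ, fun a => u a, fun a => e a,
    fun a => (u a).2, fun a => (e a).2, h⟩

/-- The elements of degree at most `n` in the common kernel of the skew derivations `∂_f` with `f`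
in `W`. -/
noncomputable def derivationInvariantsLE (W : Submodule k (Module.Dual k V)) (n : ℕ) :
    Submodule k Y.NicholsAlgebra :=
  Y.derivationInvariants W ⊓ Y.nicholsDegreeLE n

instance (W : Submodule k (Module.Dual k V)) (n : ℕ) :
    Module.Finite k (Y.derivationInvariantsLE W n) :=
  Submodule.finiteDimensional_of_le inf_le_right

/-- The dual elements e_a of all degrees are left independent over K, by a triangular argument with
the words u_a. Coefficients are bounded by degree ≤ N − j rather than taken homogeneous, so it is
not necessary to know that K is graded. -/
lemma sum_finrank_le_finrank_nicholsDegreeLE (hS : Function.Bijective (antipode k : H → H))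
    {W : Submodule k (Module.Dual k V)} (hW : (Y.dual hS).IsSubcomodule W) (N : ℕ) :
    ∑ j ∈ Finset.range (N + 1),
      Module.finrank k ((Y.dual hS).degreePart ((Y.dual hS).generated W) j) *
        Module.finrank k (Y.derivationInvariantsLE W (N - j)) ≤
      Module.finrank k (Y.nicholsDegreeLE N) := by
  choose r hr u e hu he hue using Y.exists_dual_elements hS W
  -- One coefficient from K(≤ N − j) for each e_a of degree j; all products c e_a then have degree
  -- at most N.
  let I := Σ j : Fin (N + 1), Fin (r j)
  let Θ : ((p : I) → Y.derivationInvariantsLE W (N - p.1)) →ₗ[k] Y.NicholsAlgebra :=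
    ∑ p : I, LinearMap.mulRight k (e p.1 p.2) ∘ₗ (Submodule.subtype _) ∘ₗ LinearMap.proj p
  have hΘ : ∀ c, Θ c = ∑ p : I, (c p : Y.NicholsAlgebra) * e p.1 p.2 := by
    intro c
    simp [Θ]
  have hinj : Function.Injective Θ := by
    rw [← LinearMap.ker_eq_bot, LinearMap.ker_eq_bot']
    intro c hc
    rw [hΘ] at hc
    -- Strong induction on N − j, that is, downwards from the top degree j = N.
    have key : ∀ (m : ℕ) (p : I), N - p.1 = m → c p = 0 := by
      intro m
      induction m using Nat.strong_induction_on with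
      | _ m ih =>
        intro p hp
        have h := congrArg (Y.derivationAction (wordMap W (u p.1 p.2))) hc
        rw [map_sum, map_zero, Finset.sum_eq_single p] at h
        -- Acting by u_a passes the coefficient by K-linearity and turns e_a into 1, so this term is
        -- the coefficient itself; all other terms are shown to vanish.
        · rw [Y.derivationAction_wordMap_mul hS hW (c p).2.1,
            Y.eq_algebraMap_of_mem_nicholsDegree_zero
              ((Y.derivationAction_mem hS (wordMap_mem W (hu p.1 p.2)) (he p.1 p.2)).2 rfl),
            hue, if_pos rfl, map_one, mul_one] at h
          exact Subtype.ext h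
        · intro q _ hqp
          rcases lt_trichotomy (q.1 : ℕ) p.1 with hlt | heq | hgt
          · rw [Y.derivationAction_wordMap_mul hS hW (c q).2.1,
              (Y.derivationAction_mem hS (wordMap_mem W (hu p.1 p.2)) (he q.1 q.2)).1 hlt, mul_zero]
          · obtain ⟨j, a⟩ := p
            obtain ⟨j', b⟩ := q
            obtain rfl : j' = j := Fin.ext heq
            have hab : a ≠ b := fun hab => hqp (by rw [hab])
            rw [Y.derivationAction_wordMap_mul hS hW (c _).2.1,
              Y.eq_algebraMap_of_mem_nicholsDegree_zero
                ((Y.derivationAction_mem hS (wordMap_mem W (hu j' a)) (he j' b)).2 rfl),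
              hue, if_neg hab, map_zero, mul_zero]
          -- In larger degree the result need not vanish, but the coefficient is already zero by
          -- induction. The bound q.1 ≤ N excludes a truncated subtraction.
          · have hq := q.1.2
            have h0 : c q = 0 := ih (N - q.1) (by omega) q rfl
            rw [h0, Submodule.coe_zero, zero_mul, map_zero]
        · intro hp
          exact absurd (Finset.mem_univ p) hp
    funext p
    exact key _ p rfl
  have hle : LinearMap.range Θ ≤ Y.nicholsDegreeLE N := by
    rintro _ ⟨c, rfl⟩
    rw [hΘ]
    refine Submodule.sum_mem _ fun p _ => ?_
    have hp := p.1.2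
    exact Y.nicholsDegreeLE_mul_mem (by omega) (c p).2.2 (he p.1 p.2)
  have h1 := Submodule.finrank_mono hle
  rw [LinearMap.finrank_range_of_inj hinj, Module.finrank_pi_fintype, Fintype.sum_sigma] at h1
  refine le_trans ?_ h1
  rw [← Fin.sum_univ_eq_sum_range (fun j => Module.finrank k
    ((Y.dual hS).degreePart ((Y.dual hS).generated W) j) *
      Module.finrank k (Y.derivationInvariantsLE W (N - j)))]
  refine Finset.sum_le_sum fun j _ => ?_
  refine le_trans ?_ (Finset.sum_const (s := (Finset.univ : Finset (Fin (r j))))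
    (Module.finrank k (Y.derivationInvariantsLE W (N - j)))).ge
  rw [Finset.card_univ, Fintype.card_fin, smul_eq_mul]
  exact Nat.mul_le_mul_right _ (hr j)

/-- For i + j ≤ N the piece C(i) ⊗ D(j) lies in C(≤ N − j) ⊗ D(j). Grouping by the degree j of the
right factor gives a sum of the same form as in `sum_finrank_le_finrank_nicholsDegreeLE`; as only an
upper bound is wanted, no directness is required. -/
lemma finrank_tensorDegreePart_le (C D : Subalgebra k Y.NicholsAlgebra) (N : ℕ) :
    Module.finrank k ↥(⨆ i ∈ Finset.range (N + 1), Y.tensorDegreePart C D i) ≤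
      ∑ j ∈ Finset.range (N + 1), Module.finrank k (Y.degreePart D j) *
        Module.finrank k ↥(Subalgebra.toSubmodule C ⊓ Y.nicholsDegreeLE (N - j)) := by
  let F : ℕ → Submodule k C := fun m => (Y.nicholsDegreeLE m).comap C.val.toLinearMap
  have hm : ∀ m, (F m).map C.val.toLinearMap = Subalgebra.toSubmodule C ⊓ Y.nicholsDegreeLE m := by
    intro m
    ext x
    constructor
    · rintro ⟨y, hy, rfl⟩
      exact ⟨y.2, hy⟩
    · rintro ⟨h1, h2⟩
      exact ⟨⟨x, h1⟩, h2, rfl⟩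
  have hF : ∀ m, Module.finrank k (F m) =
      Module.finrank k ↥(Subalgebra.toSubmodule C ⊓ Y.nicholsDegreeLE m) := by
    intro m
    rw [← hm]
    exact (Submodule.equivMapOfInjective C.val.toLinearMap Subtype.val_injective (F m)).finrank_eq
  have hfin : ∀ m, Module.Finite k (F m) := fun m =>
    Module.Finite.of_injective
      (C.val.toLinearMap.restrict (p := F m) (q := Y.nicholsDegreeLE m) fun _ hx => hx)
      fun _ _ h => Subtype.ext (Subtype.ext (congrArg (Y.nicholsDegreeLE m).subtype h))
  let M : ℕ → Submodule k (C ⊗[k] D) := fun j =>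
    Submodule.map₂ (TensorProduct.mk k C D) (F (N - j)) (Y.degreePart D j)
  have hM : ∀ j, Module.Finite k (M j) := fun j => finite_map₂_mk _ _
  have hle : (⨆ i ∈ Finset.range (N + 1), Y.tensorDegreePart C D i) ≤
      ⨆ j ∈ Finset.range (N + 1), M j := by
    refine iSup₂_le fun i hi => iSup₂_le fun p hp => ?_
    rw [Finset.HasAntidiagonal.mem_antidiagonal] at hp
    have hi' := Finset.mem_range.1 hi
    refine le_trans ?_ (le_iSup₂_of_le (f := fun j (_ : j ∈ Finset.range (N + 1)) => M j) p.2
      (Finset.mem_range.2 (by omega)) le_rfl)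
    exact Submodule.map₂_le_map₂_left
      (Submodule.comap_mono (Y.nicholsDegree_le_nicholsDegreeLE (by omega)))
  have : Module.Finite k ↥(⨆ j ∈ Finset.range (N + 1), M j) :=
    Module.Finite.iff_fg.2 (Submodule.fg_biSup _ _ fun j _ => Module.Finite.iff_fg.1 (hM j))
  refine (Submodule.finrank_mono hle).trans ((finrank_biSup_le _ _ fun j _ => hM j).trans ?_)
  refine Finset.sum_le_sum fun j _ => ?_
  rw [mul_comm, ← hF]
  exact finrank_map₂_mk_le _ _

/-- The unit is nonzero because its counit is 1. Needed to cancel the factor of the term j = 0. -/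
lemma finrank_degreePart_zero_pos (C : Subalgebra k Y.NicholsAlgebra) :
    0 < Module.finrank k (Y.degreePart C 0) := by
  have h1 : (1 : C) ∈ Y.degreePart C 0 :=
    ⟨1, SetLike.GradedOne.one_mem, map_one Y.nicholsMk⟩
  rw [Module.finrank_pos_iff_exists_ne_zero]
  refine ⟨⟨1, h1⟩, fun h => ?_⟩
  have h2 : (1 : Y.NicholsAlgebra) = 0 :=
    congrArg (fun x : Y.degreePart C 0 => ((x : C) : Y.NicholsAlgebra)) h
  have h3 := congrArg Y.nicholsCounit h2
  rw [map_one, map_zero] at h3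
  exact one_ne_zero h3

/-- If `V₁` is a subcomodule of `V`, then the functionals that vanish on `V₁` form a subcomodule
of `V*`. -/
lemma isSubcomodule_complementDual (hS : Function.Bijective (antipode k : H → H))
    {V₁ V₂ : Submodule k V} (hV : IsCompl V₁ V₂) (hV₁ : Y.IsSubcomodule V₁) :
    (Y.dual hS).IsSubcomodule (complementDual V₁ V₂ hV) := by
  rintro _ ⟨f, hf, rfl⟩
  -- The idempotent with image V₂ and kernel V₁; its transpose projects V* onto V₂*.
  let π : V →ₗ[k] V := V₂.subtype ∘ₗ V₂.projectionOnto V₁ hV.symm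
  have hπ : ∀ v, v - π v ∈ V₁ := by
    intro v
    rw [← Submodule.projectionOnto_apply_eq_zero_iff hV.symm, map_sub]
    change V₂.projectionOnto V₁ hV.symm v - V₂.projectionOnto V₁ hV.symm
      (V₂.projectionOnto V₁ hV.symm v : V) = 0
    rw [Submodule.projectionOnto_apply_left, sub_self]
  have hπ' : ∀ g : Module.Dual k V, π.dualMap g ∈ complementDual V₁ V₂ hV := fun g =>
    ⟨V₂.subtype.dualMap g, rfl⟩
  -- For v in V₁ the value is S⁻¹(v₍₋₁₎) f(v₍₀₎), with v₍₀₎ in V₁, where f vanishes.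
  have h0 : ∀ v ∈ V₁, evalAt v ((Y.dual hS).coaction f) = 0 := by
    intro v hv
    rw [evalAt_dual_coaction]
    obtain ⟨z, hz⟩ := hV₁ ⟨v, hv, rfl⟩
    have : ∀ z, evalFun f (V₁.subtype.lTensor H z) = 0 := by
      intro z
      induction z with
      | zero => simp
      | add a b ha hb => simp only [map_add, ha, hb, add_zero]
      | tmul g x => simp [complementDual_apply hV hf x.2]
    rw [← hz, this, map_zero]
  have hsub : ∀ (x y : V) (z : H ⊗[k] Module.Dual k V),
      evalAt (x - y) z = evalAt x z - evalAt y z := by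
    intro x y z
    induction z with
    | zero => simp
    | add a b ha hb => simp only [map_add, ha, hb]; abel
    | tmul g p => simp [sub_smul]
  -- By `h0` the value of δ(f) at v depends only on π v, so δ(f) is fixed by the projection onto H ⊗
  -- V₂*.
  have h1 : π.dualMap.lTensor H ((Y.dual hS).coaction f) = (Y.dual hS).coaction f := by
    apply eq_of_evalAt
    intro v
    have e : ∀ z : H ⊗[k] Module.Dual k V, evalAt v (π.dualMap.lTensor H z) = evalAt (π v) z := by
      intro z
      induction z with
      | zero => simp
      | add a b ha hb => simp only [map_add, ha, hb]
      | tmul g p => simp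
    rw [e]
    have := h0 _ (hπ v)
    rw [hsub, sub_eq_zero] at this
    exact this.symm
  rw [← h1]
  exact ⟨(π.dualMap.codRestrict _ hπ').lTensor H ((Y.dual hS).coaction f), by
    rw [← LinearMap.comp_apply, ← LinearMap.lTensor_comp, LinearMap.subtype_comp_codRestrict]⟩

end Counting

end YetterDrinfeldModule

/-! ### The main theorem. -/

theorem mainTheorem3 {k : Type u} {H : Type v} {V : Type w} [Field k] [IsAlgClosed k] [CharZero k]
    [Ring H] [HopfAlgebra k H] (hS : Function.Bijective (HopfAlgebra.antipode k : H → H))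
    [AddCommGroup V] [Module k V] [Module.Finite k V] (Y : YetterDrinfeldModule k H V)
    (V₁ V₂ : Submodule k V) (hV₁ : Y.IsSubcomodule V₁) (hV₂ : Y.IsSubcomodule V₂)
    (hV : IsCompl V₁ V₂) (N : ℕ) (hN : 2 ≤ N)
    (hdim : Module.finrank k ↥(⨆ i ∈ Finset.range (N + 1), Y.nicholsDegree i) ≤
      Module.finrank k ↥(⨆ i ∈ Finset.range (N + 1),
        Y.tensorDegreePart (Y.generated V₁) (Y.generated V₂) i))
    (hiso : ∃ e : Y.generated V₂ ≃ₗ[k]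
        (Y.dual hS).generated (YetterDrinfeldModule.complementDual V₁ V₂ hV),
      ∀ (n : ℕ) (x : Y.generated V₂),
        (x : Y.NicholsAlgebra) ∈ Y.nicholsDegree n ↔
          (e x : (Y.dual hS).NicholsAlgebra) ∈ (Y.dual hS).nicholsDegree n) :
    Y.IsLeftCoidealSubalgebra (Y.generated V₁) ∧
      ∀ n, 2 ≤ n → n ≤ N → ¬ Y.CanBeExtendedInDegree (Y.generated V₁) n := by
  have hC := Y.isLeftCoidealSubalgebra_generated hV₁
  refine ⟨hC, ?_⟩
  rintro n hn hnN ⟨x, hx, hxC, hD⟩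
  let W := YetterDrinfeldModule.complementDual V₁ V₂ hV
  have hW := Y.isSubcomodule_complementDual hS hV hV₁
  have hφ : ∀ f ∈ W, ∀ y ∈ Y.generated V₁, Y.nicholsPointDerivation f y = 0 := fun f hf =>
    Y.nicholsPointDerivation_generated fun v hv =>
      YetterDrinfeldModule.complementDual_apply hV hf hv
  have hCK : Subalgebra.toSubmodule (Y.generated V₁) ≤ Y.derivationInvariants W := fun y hy =>
    Y.mem_derivationInvariants.2 fun f hf =>
      Y.nicholsDerivation_eq_zero f _ (hφ f hf) (hC.leftCoideal ⟨y, hy, rfl⟩)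
  -- ⟨V₁, x⟩ is a left coideal on whose generators the functionals of V₂* vanish: on ⟨V₁⟩ by `hφ`,
  -- on x because its degree n is at least 2.
  have hxK : x ∈ Y.derivationInvariants W := by
    rw [Y.mem_derivationInvariants]
    intro f hf
    refine Y.nicholsDerivation_eq_zero f _ ?_
      (hD.leftCoideal ⟨x, Algebra.subset_adjoin (Or.inr rfl), rfl⟩)
    intro y hy
    refine Y.nicholsPointDerivation_adjoin f _ ?_ hy
    rintro z (hz | rfl)
    · exact hφ f hf z hz
    · exact Y.nicholsPointDerivation_of_mem f hn hx
  obtain ⟨e, he⟩ := hiso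
  -- The graded isomorphism enters only through the equality of dimensions in each degree.
  have hd : ∀ j, Module.finrank k (Y.degreePart (Y.generated V₂) j) =
      Module.finrank k ((Y.dual hS).degreePart ((Y.dual hS).generated W) j) := by
    intro j
    have hmap : (Y.degreePart (Y.generated V₂) j).map e.toLinearMap =
        (Y.dual hS).degreePart ((Y.dual hS).generated W) j := by
      ext y
      constructor
      · rintro ⟨z, hz, rfl⟩
        exact (he j z).1 hz
      · intro hy
        refine ⟨e.symm y, (he j _).2 ?_, e.apply_symm_apply y⟩
        rw [e.apply_symm_apply]
        exact hy
    rw [← hmap]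
    exact (e.submoduleMap (Y.degreePart (Y.generated V₂) j)).finrank_eq
  have hle : ∀ m, Subalgebra.toSubmodule (Y.generated V₁) ⊓ Y.nicholsDegreeLE m ≤
      Y.derivationInvariantsLE W m := fun m => inf_le_inf_right _ hCK
  have h1 := Y.sum_finrank_le_finrank_nicholsDegreeLE hS hW N
  have h2 := Y.finrank_tensorDegreePart_le (Y.generated V₁) (Y.generated V₂) N
  -- The sum formed with K is at most the sum formed with ⟨V₁⟩, while `hterm` gives the opposite
  -- inequality termwise. So all terms coincide, in particular the one for j = 0.
  have h3 := (h1.trans hdim).trans h2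
  have hterm : ∀ j ∈ Finset.range (N + 1), Module.finrank k (Y.degreePart (Y.generated V₂) j) *
      Module.finrank k ↥(Subalgebra.toSubmodule (Y.generated V₁) ⊓ Y.nicholsDegreeLE (N - j)) ≤
      Module.finrank k ((Y.dual hS).degreePart ((Y.dual hS).generated W) j) *
        Module.finrank k (Y.derivationInvariantsLE W (N - j)) := by
    intro j _
    rw [hd]
    exact Nat.mul_le_mul_left _ (Submodule.finrank_mono (hle _))
  have h0 := (Finset.sum_eq_sum_iff_of_le hterm).1 (le_antisymm (Finset.sum_le_sum hterm) h3) 0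
    (Finset.mem_range.2 (Nat.succ_pos N))
  rw [← hd] at h0
  have h4 := Nat.eq_of_mul_eq_mul_left (Y.finrank_degreePart_zero_pos _) h0
  -- `N - 0` is the index in the term j = 0 and reduces to N: here K and ⟨V₁⟩ are found to agree in
  -- all degrees at most N.
  have h5 := Submodule.eq_of_le_of_finrank_le (hle (N - 0)) h4.ge
  have h6 : x ∈ Y.derivationInvariantsLE W (N - 0) :=
    ⟨hxK, Y.nicholsDegree_le_nicholsDegreeLE hnN hx⟩
  rw [← h5] at h6
  exact hxC h6.1
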